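/- **Setting.** A unit has potential outcomes $Y^{m}$, $m\in\{0,1\}$, a ground-truth binary treatment $M^*\in\{0,1\}$, an outcome $Y=Y^{M^*}$, covariates $C\in\mathbb R^d$, an instrument $Z\in\mathbb R$, an annotation indicator $A\in\{0,1\}$, annotation covariates $X\in\mathbb R^k$ and unstructured data $U\in\mathbb R^\ell$; $Y,Z,C$ have finite second moments. The observation is $W=(Y,M,C,Z,A,X,U)\sim P$. Let $Z^\perp=Z-C^{\mathsf T}\gamma$, where $\gamma$ is a coefficient vector of the linear projection of $Z$ on $C$ (i.e. $E[C Z^\perp]=0$); $\gamma$ is treated as known and $Z^\perp$ is bounded almost surely. The instrument is relevant ($E[Z^\perp M^*]\neq0$) and exogenous ($E[Y^m\mid C,Z]=E[Y^m\mid C]$ for $m\in\{0,1\}$), treatment effects are homogeneous ($Y^{1}-Y^{0}$ is a.s. constant), and $E[Y^{0}\mid C]$ is a linear function of $C$. The target is $\theta=E[Y^{1}-Y^{0}]$. Put $\tilde X=(X,U,Z,C)$ and $\mu(\tilde x)=E[M\mid A=1,\tilde X=\tilde x]$. **Assumptions.** (1) $M=AM^*$. (2) $(U,M^*)\perp A\mid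 X$, and moreover $(C,Z)\perp A\mid (X,U,M^*)$. (3) $\pi(x)=P(A=1\mid X=x)$ is known and $\pi(x)\in[\eta,1]$ for all $x$, for some $0<\eta<1$. (4) A learner turns a training sample of size $m$ into an imputation function $\hat\mu$ with $E\big[\int(\hat\mu-\mu)^2\,dP_{\tilde X}\big]\to0$ as $m\to\infty$. **Estimator.** From an i.i.d. estimation sample $(W_i)_{i\in\mathcal I}$ and an independent i.i.d. training sample $(W_{i'})_{i'\in\mathcal I'}$, both from $P$, on the latter of which $\hat\mu$ is learned, form $$\hat\theta=\frac{\sum_{i\in\mathcal I}Z_i^\perp Y_i}{\sum_{i\in\mathcal I}Z_i^\perp\hat\varphi_i},\qquad \hat\varphi_i=\hat\mu(\tilde X_i)+\frac{A_i}{\pi(X_i)}\big(M_i-\hat\mu(\tilde X_i)\big).$$ Let $\theta_{\rm num}=E[Z^\perp Y]$, $\theta_{\rm den}=E[Z^\perp\mu(\tilde X)]$, $\varphi_{\rm num}(W)=Z^\perp Y-\theta_{\rm num}$, $\varphi_{\rm den}(W)=Z^\perp\big[\mu(\tilde X)+\frac{A}{\pi(X)}(M-\mu(\tilde X))\big]-\theta_{\rm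 den}$ and $\varphi(W)=\theta_{\rm den}^{-1}\big(\varphi_{\rm num}(W)-\theta\,\varphi_{\rm den}(W)\big)$. **Model.** Let $\mathcal P_\pi$ be the set of laws $Q$ of $W$ under which $M=0$ whenever $A=0$ and $Q(A=1\mid\tilde X)=\pi(X)$, with $Z^\perp$ and $Z^\perp Y$ square integrable and $E_Q[Z^\perp\mu_Q(\tilde X)]\neq 0$, where $Z^\perp=Z-C^{\mathsf T}\gamma$ for the fixed $\gamma$ and $\mu_Q(\tilde X)=E_Q[M\mid A=1,\tilde X]$. On $\mathcal P_\pi$ consider the functional $\theta(Q)=E_Q[Z^\perp\mu_Q(\tilde X)]^{-1}E_Q[Z^\perp Y]$. Regular submodels are paths $(Q_t)_{t\ge0}$ in $\mathcal P_\pi$ through $Q_0=P$ that are differentiable in quadratic mean at $0$ with a score in $L^2(P)$ and along which the second moments of $Z^\perp$ and $Z^\perp Y$ stay bounded near $t=0$. The tangent space is the closed linear span in $L^2(P)$ of the scores. **Proposition.** In this setting, under Assumptions (1)–(4): (a) $\theta=\theta(P)=\theta_{\rm den}^{-1}\theta_{\rm num}$, and as $|\mathcal I|,|\mathcal I'|\to\infty$,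 $$\sqrt{|\mathcal I|}\,(\hat\theta-\theta)\xrightarrow{d}N\big(0,\operatorname{Var}(\varphi(W))\big),\qquad \sqrt{|\mathcal I|}\,(\hat\theta-\theta)-\frac1{\sqrt{|\mathcal I|}}\sum_{i\in\mathcal I}\varphi(W_i)\xrightarrow{p}0 .$$ (b) $\varphi$ is an influence function of $\theta(\cdot)$ at $P$ in $\mathcal P_\pi$: it has mean zero and finite variance, and along every regular submodel with score $g$ the derivative of $t\mapsto\theta(Q_t)$ at $t=0^+$ exists and equals $E_P[\varphi g]$. (c) If in addition the outcome is mean independent of annotation given the features, $E[Y\mid A,\tilde X]=E[Y\mid\tilde X]$ a.s., then $\varphi$ is the efficient influence function of $\theta(\cdot)$ at $P$ in $\mathcal P_\pi$, i.e. it also lies in the tangent space, and $\hat\theta$ is efficient: its asymptotic variance $\operatorname{Var}(\varphi(W))$ is at most the asymptotic variance $\operatorname{Var}(\psi(W))$ of every regular asymptotically linear estimator sequence $T_n=T_n(W_1,\dots,W_n)$ of $\theta(\cdot)$ at $P$, $\psi$ being its influence function. (Regular: $\sqrt n\,(T_n-\theta(Q_{1/\sqrt n}))$ has, under i.i.d.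 sampling from $Q_{1/\sqrt n}$, the same limit law for every regular submodel $Q$.) -/

import Mathlib

open MeasureTheory ProbabilityTheory Filter Topology
open scoped ENNReal NNReal

noncomputable section

namespace MARS

/-! ### Observed data -/

/-- The numerical value `0` or `1` of a binary variable. -/
def ind (b : Bool) : ℝ := if b then 1 else 0

/-- The observation space of one unit, `W = (Y, M, C, Z, A, X, U)`: outcome, annotated treatment,
covariates, instrument, annotation indicator, annotation covariates, unstructured data. -/
abbrev Obs (d k l : ℕ) : Type :=
  ℝ × Bool × (Fin d → ℝ) × ℝ × Bool × (Fin k → ℝ) × (Fin l → ℝ)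

/-- The space of the features `X̃ = (X, U, Z, C)` used for imputation. -/
abbrev Feat (d k l : ℕ) : Type := (Fin k → ℝ) × (Fin l → ℝ) × ℝ × (Fin d → ℝ)

namespace Obs

variable {d k l : ℕ}

def outcome (w : Obs d k l) : ℝ := w.1
def treat (w : Obs d k l) : Bool := w.2.1
def covs (w : Obs d k l) : Fin d → ℝ := w.2.2.1
def instr (w : Obs d k l) : ℝ := w.2.2.2.1
def annot (w : Obs d k l) : Bool := w.2.2.2.2.1
def annotCovs (w : Obs d k l) : Fin k → ℝ := w.2.2.2.2.2.1
def unstr (w : Obs d k l) : Fin l → ℝ := w.2.2.2.2.2.2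

/-- The features `X̃ = (X, U, Z, C)` of an observation. -/
def feat (w : Obs d k l) : Feat d k l := (w.annotCovs, w.unstr, w.instr, w.covs)

/-- The residualized instrument `Z^⊥ = Z - Cᵀγ`, as a known function of the observation. -/
def resid (γ : Fin d → ℝ) (w : Obs d k l) : ℝ := w.instr - ∑ j, γ j * w.covs j

end Obs

/-! ### The population model for one unit -/

/-- The random variables attached to one unit, latent ones included: the potential outcomes
`Y^m`, `m ∈ {0,1}`, the ground-truth treatment `M*`, and the observed variables. -/
structure Population (Ω : Type*) [MeasurableSpace Ω] (d k l : ℕ) where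
  Ypot : Bool → Ω → ℝ
  Mstar : Ω → Bool
  Y : Ω → ℝ
  M : Ω → Bool
  C : Ω → Fin d → ℝ
  Z : Ω → ℝ
  A : Ω → Bool
  X : Ω → Fin k → ℝ
  U : Ω → Fin l → ℝ
  measurable_Ypot : ∀ m, Measurable (Ypot m)
  measurable_Mstar : Measurable Mstar
  measurable_Y : Measurable Y
  measurable_M : Measurable M
  measurable_C : Measurable C
  measurable_Z : Measurable Z
  measurable_A : Measurable A
  measurable_X : Measurable X
  measurable_U : Measurable U

namespace Population

variable {Ω : Type*} [MeasurableSpace Ω] {d k l : ℕ} (S : Population Ω d k l)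

/-- The observation `W` of the unit. -/
def obs (ω : Ω) : Obs d k l := (S.Y ω, S.M ω, S.C ω, S.Z ω, S.A ω, S.X ω, S.U ω)

/-- The features `X̃ = (X, U, Z, C)` of the unit. -/
def feat (ω : Ω) : Feat d k l := (S.X ω, S.U ω, S.Z ω, S.C ω)

/-- The residualized instrument `Z^⊥ = Z - Cᵀγ` of the unit. -/
def resid (γ : Fin d → ℝ) (ω : Ω) : ℝ := S.Z ω - ∑ j, γ j * S.C ω j

theorem measurable_obs : Measurable S.obs :=
  S.measurable_Y.prodMk (S.measurable_M.prodMk (S.measurable_C.prodMk (S.measurable_Z.prodMk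
    (S.measurable_A.prodMk (S.measurable_X.prodMk S.measurable_U)))))

theorem measurable_XUMstar : Measurable fun ω => (S.X ω, S.U ω, S.Mstar ω) :=
  S.measurable_X.prodMk (S.measurable_U.prodMk S.measurable_Mstar)

/-- The law `P` of the observation `W`. -/
def law (Pr : Measure Ω) [IsProbabilityMeasure Pr] : ProbabilityMeasure (Obs d k l) :=
  ⟨Pr.map S.obs, Measure.isProbabilityMeasure_map S.measurable_obs.aemeasurable⟩

/-- The average treatment effect `θ = E[Y^{m=1} - Y^{m=0}]`. -/
def ate (Pr : Measure Ω) : ℝ := ∫ ω, (S.Ypot true ω - S.Ypot false ω) ∂Pr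

/-- `γ` is a coefficient vector of the linear projection `E*[Z | C]`: the projection error
`Z - Cᵀγ` is orthogonal to every component of `C`. -/
def IsProjectionCoef (Pr : Measure Ω) (γ : Fin d → ℝ) : Prop :=
  ∀ j, ∫ ω, S.C ω j * S.resid γ ω ∂Pr = 0

/-- Consistency of the annotation: `M = A M*`. -/
def ConsistentAnnotation (Pr : Measure Ω) : Prop :=
  ∀ᵐ ω ∂Pr, ind (S.M ω) = ind (S.A ω) * ind (S.Mstar ω)

/-- Consistency of the potential outcomes: `Y = ∑ₘ 𝟙(M* = m) Y^m`. -/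
def ConsistentOutcome (Pr : Measure Ω) : Prop :=
  ∀ᵐ ω ∂Pr, S.Y ω = S.Ypot (S.Mstar ω) ω

/-- Missing at random structured data: `[(U, M*) ⫫ A] | X`. -/
def MissingAtRandom [StandardBorelSpace Ω] (Pr : Measure Ω) [IsFiniteMeasure Pr] : Prop :=
  CondIndepFun (MeasurableSpace.comap S.X inferInstance) S.measurable_X.comap_le
    (fun ω => (S.U ω, S.Mstar ω)) S.A Pr

/-- The context variables satisfy `[(C, Z) ⫫ A] | (X, U, M*)`. -/
def ContextIndependent [StandardBorelSpace Ω] (Pr : Measure Ω) [IsFiniteMeasure Pr] : Prop :=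
  CondIndepFun (MeasurableSpace.comap (fun ω => (S.X ω, S.U ω, S.Mstar ω)) inferInstance)
    S.measurable_XUMstar.comap_le (fun ω => (S.C ω, S.Z ω)) S.A Pr

/-- `π` is the annotation score: `P(A = 1 | X) = π(X)`. -/
def IsAnnotationScore (Pr : Measure Ω) (π : (Fin k → ℝ) → ℝ) : Prop :=
  Pr[fun ω => ind (S.A ω) | MeasurableSpace.comap S.X inferInstance] =ᵐ[Pr] fun ω => π (S.X ω)

/-- Exogeneity of the instrument: `E[Y^m | C, Z] = E[Y^m | C]` for `m ∈ {0,1}`. -/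
def ExogenousInstrument (Pr : Measure Ω) : Prop :=
  ∀ m, Pr[S.Ypot m | MeasurableSpace.comap (fun ω => (S.C ω, S.Z ω)) inferInstance]
    =ᵐ[Pr] Pr[S.Ypot m | MeasurableSpace.comap S.C inferInstance]

/-- Relevance of the instrument: `E[Z^⊥ M*] ≠ 0`. -/
def RelevantInstrument (Pr : Measure Ω) (γ : Fin d → ℝ) : Prop :=
  ∫ ω, S.resid γ ω * ind (S.Mstar ω) ∂Pr ≠ 0

/-- Homogeneous treatment effects: `Y^{m=1} - Y^{m=0}` is almost surely a constant. -/
def HomogeneousEffects (Pr : Measure Ω) : Prop :=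
  ∃ Δ : ℝ, ∀ᵐ ω ∂Pr, S.Ypot true ω - S.Ypot false ω = Δ

/-- The conditional mean of the untreated potential outcome is linear: `E[Y^{m=0} | C] = Cᵀβ`. -/
def LinearOutcome (Pr : Measure Ω) : Prop :=
  ∃ β : Fin d → ℝ, Pr[S.Ypot false | MeasurableSpace.comap S.C inferInstance]
    =ᵐ[Pr] fun ω => ∑ j, β j * S.C ω j

/-- The outcome is mean independent of annotation given the features:
`E[Y | A, X̃] = E[Y | X̃]`. -/
def OutcomeMeanIndependent (Pr : Measure Ω) : Prop :=
  Pr[S.Y | MeasurableSpace.comap (fun ω => (S.A ω, S.feat ω)) inferInstance]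
    =ᵐ[Pr] Pr[S.Y | MeasurableSpace.comap S.feat inferInstance]

end Population

/-! ### The functional, the model with known annotation score, and the estimator -/

section Functional

variable {d k l : ℕ}

/-- `μ(x̃) = E[M | A = 1, X̃ = x̃]` under the observed-data law `P`. -/
def imputationFun (P : Measure (Obs d k l)) (x : Feat d k l) : ℝ :=
  ∫ m, ind m ∂(condDistrib Obs.treat Obs.feat (P[|{w | w.annot = true}]) x)

/-- The functional `θ_num(P) = E[Z^⊥ Y]`. -/
def thetaNum (γ : Fin d → ℝ) (P : Measure (Obs d k l)) : ℝ :=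
  ∫ w, w.resid γ * w.outcome ∂P

/-- The functional `θ_den(P) = E[Z^⊥ μ(X̃)]`. -/
def thetaDen (γ : Fin d → ℝ) (P : Measure (Obs d k l)) : ℝ :=
  ∫ w, w.resid γ * imputationFun P w.feat ∂P

/-- The functional `θ(P) = θ_den(P)⁻¹ θ_num(P)`. -/
def theta (γ : Fin d → ℝ) (P : ProbabilityMeasure (Obs d k l)) : ℝ :=
  (thetaDen γ (P : Measure (Obs d k l)))⁻¹ * thetaNum γ (P : Measure (Obs d k l))

/-- The pseudo-treatment `f(X̃) + (A / π(X)) (M - f(X̃))` built from an imputation function `f`. -/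
def pseudoTreat (π : (Fin k → ℝ) → ℝ) (f : Feat d k l → ℝ) (w : Obs d k l) : ℝ :=
  f w.feat + ind w.annot / π w.annotCovs * (ind w.treat - f w.feat)

/-- `φ_num(W) = Z^⊥ Y - θ_num`. -/
def phiNum (γ : Fin d → ℝ) (P : Measure (Obs d k l)) (w : Obs d k l) : ℝ :=
  w.resid γ * w.outcome - thetaNum γ P

/-- `φ_den(W) = Z^⊥ [μ(X̃) + (A / π(X)) (M - μ(X̃))] - θ_den`. -/
def phiDen (π : (Fin k → ℝ) → ℝ) (γ : Fin d → ℝ) (P : Measure (Obs d k l))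
    (w : Obs d k l) : ℝ :=
  w.resid γ * pseudoTreat π (imputationFun P) w - thetaDen γ P

/-- `φ(W) = θ_den⁻¹ (φ_num(W) - θ φ_den(W))`. -/
def phi (π : (Fin k → ℝ) → ℝ) (γ : Fin d → ℝ) (P : Measure (Obs d k l)) (θ : ℝ)
    (w : Obs d k l) : ℝ :=
  (thetaDen γ P)⁻¹ * (phiNum γ P w - θ * phiDen π γ P w)

/-- The moment function `|Z^⊥| (1 + |Y|)`; its square integrability says that `Z^⊥` and `Z^⊥ Y`
have finite second moments. -/
def momentFun (γ : Fin d → ℝ) (w : Obs d k l) : ℝ := |w.resid γ| * (1 + |w.outcome|)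

/-- The semiparametric model `𝒫_π` of observed-data laws with known annotation score `π`:
`M = 0` without annotation, `P(A = 1 | X̃) = π(X)`, and the functional is well defined and has
finite second moments. The law of `X̃` and the law of `(Y, M)` given `(A, X̃)` are unrestricted. -/
def modelKnownScore (π : (Fin k → ℝ) → ℝ) (γ : Fin d → ℝ) :
    Set (ProbabilityMeasure (Obs d k l)) :=
  {Q | (∀ᵐ w ∂(Q : Measure (Obs d k l)), w.annot = false → w.treat = false) ∧
    (Q : Measure (Obs d k l))[fun w => ind w.annot | MeasurableSpace.comap Obs.feat inferInstance]
      =ᵐ[(Q : Measure (Obs d k l))] (fun w => π w.annotCovs) ∧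
    MemLp (momentFun γ) 2 (Q : Measure (Obs d k l)) ∧
    thetaDen γ (Q : Measure (Obs d k l)) ≠ 0}

/-- The estimator `θ̂ = ∑ᵢ Zᵢ^⊥ Yᵢ / ∑ᵢ Zᵢ^⊥ φ̂ᵢ` with pseudo-treatment `φ̂ᵢ` built from the
imputation function `f`, on an estimation sample of size `n`. -/
def thetaHat (π : (Fin k → ℝ) → ℝ) (γ : Fin d → ℝ) (f : Feat d k l → ℝ) {n : ℕ}
    (w : Fin n → Obs d k l) : ℝ :=
  (∑ i, (w i).resid γ * (w i).outcome) / ∑ i, (w i).resid γ * pseudoTreat π f (w i)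

/-- Mean squared error consistency of a learner `μ̂`, which turns a training sample of size `m`
into an imputation function: `E[∫ (μ̂(x̃) - μ(x̃))² dP_X̃(x̃)] = o(1)` as `m → ∞`. -/
def MSEConsistent (P : ProbabilityMeasure (Obs d k l))
    (muHat : ∀ m : ℕ, (Fin m → Obs d k l) → Feat d k l → ℝ) : Prop :=
  Tendsto (fun m : ℕ => ∫⁻ v, ∫⁻ x,
      ENNReal.ofReal ((muHat m v x - imputationFun (P : Measure (Obs d k l)) x) ^ 2)
        ∂((P : Measure (Obs d k l)).map Obs.feat)
        ∂(Measure.pi fun _ : Fin m => (P : Measure (Obs d k l))))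
    atTop (𝓝 0)

end Functional

/-! ### Semiparametric efficiency -/

section Efficiency

variable {𝒲 : Type*} [MeasurableSpace 𝒲]

/-- A regular (smooth) one-dimensional submodel `t ↦ Q t`, `t ≥ 0`, of the model `𝓜` through `P`
with score `g`: it is differentiable in quadratic mean at `t = 0`, i.e.
`∫ ((√dQ_t - √dP) / t - (1/2) g √dP)² → 0` as `t ↓ 0`, and the second moment of the moment
function `e` stays bounded near `t = 0`. -/
structure IsRegularSubmodel (𝓜 : Set (ProbabilityMeasure 𝒲)) (e : 𝒲 → ℝ)
    (P : ProbabilityMeasure 𝒲) (Q : ℝ → ProbabilityMeasure 𝒲) (g : 𝒲 → ℝ) : Prop where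
  at_zero : Q 0 = P
  mem : ∀ t, Q t ∈ 𝓜
  score_memLp : MemLp g 2 (P : Measure 𝒲)
  qmd : Tendsto (fun t : ℝ => ∫⁻ w, ENNReal.ofReal
      (((√((Q t : Measure 𝒲).rnDeriv ((P : Measure 𝒲) + (Q t : Measure 𝒲)) w).toReal
          - √((P : Measure 𝒲).rnDeriv ((P : Measure 𝒲) + (Q t : Measure 𝒲)) w).toReal) / t
        - 1 / 2 * g w
          * √((P : Measure 𝒲).rnDeriv ((P : Measure 𝒲) + (Q t : Measure 𝒲)) w).toReal) ^ 2)
      ∂((P : Measure 𝒲) + (Q t : Measure 𝒲))) (𝓝[>] 0) (𝓝 0)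
  moment : ∃ K : ℝ≥0, ∀ᶠ t in 𝓝[>] (0 : ℝ),
    ∫⁻ w, ENNReal.ofReal (e w ^ 2) ∂(Q t : Measure 𝒲) ≤ K

/-- `φ` is an influence function (gradient) of the functional `ϑ` at `P` relative to the model:
`φ` has mean zero and finite variance, and along every regular submodel with score `g` the
pathwise derivative of `ϑ` exists and equals `E_P[φ g]`. -/
def IsInfluenceFunction (𝓜 : Set (ProbabilityMeasure 𝒲)) (e : 𝒲 → ℝ)
    (ϑ : ProbabilityMeasure 𝒲 → ℝ) (P : ProbabilityMeasure 𝒲) (φ : 𝒲 → ℝ) : Prop :=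
  MemLp φ 2 (P : Measure 𝒲) ∧ ∫ w, φ w ∂(P : Measure 𝒲) = 0 ∧
    ∀ Q g, IsRegularSubmodel 𝓜 e P Q g →
      Tendsto (fun t : ℝ => (ϑ (Q t) - ϑ P) / t) (𝓝[>] 0)
        (𝓝 (∫ w, φ w * g w ∂(P : Measure 𝒲)))

/-- `φ` is the efficient influence function of `ϑ` at `P` relative to the model: it is an influence
function that lies in the tangent space, the closed linear span in `L²(P)` of the scores. -/
def IsEfficientInfluenceFunction (𝓜 : Set (ProbabilityMeasure 𝒲)) (e : 𝒲 → ℝ)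
    (ϑ : ProbabilityMeasure 𝒲 → ℝ) (P : ProbabilityMeasure 𝒲) (φ : 𝒲 → ℝ) : Prop :=
  IsInfluenceFunction 𝓜 e ϑ P φ ∧
    ∀ ε : ℝ≥0∞, 0 < ε → ∃ h ∈ Submodule.span ℝ {g | ∃ Q, IsRegularSubmodel 𝓜 e P Q g},
      eLpNorm (φ - h) 2 (P : Measure 𝒲) < ε

/-- `T` is a regular, asymptotically linear estimator sequence of `ϑ` at `P` with influence
function `ψ`: `√n (Tₙ - ϑ(P)) = n^{-1/2} ∑ᵢ ψ(Wᵢ) + o_P(1)` under i.i.d. sampling from `P`, and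
`√n (Tₙ - ϑ(Q_{1/√n}))` has, under i.i.d. sampling from `Q_{1/√n}`, the same limit law for every
regular submodel `Q`. -/
structure IsRAL (𝓜 : Set (ProbabilityMeasure 𝒲)) (e : 𝒲 → ℝ)
    (ϑ : ProbabilityMeasure 𝒲 → ℝ) (P : ProbabilityMeasure 𝒲)
    (T : ∀ n : ℕ, (Fin n → 𝒲) → ℝ) (ψ : 𝒲 → ℝ) : Prop where
  measurable : ∀ n, Measurable (T n)
  memLp : MemLp ψ 2 (P : Measure 𝒲)
  mean_zero : ∫ w, ψ w ∂(P : Measure 𝒲) = 0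
  asymptoticallyLinear : ∀ ε : ℝ, 0 < ε →
    Tendsto (fun n : ℕ => (Measure.pi fun _ : Fin n => (P : Measure 𝒲))
      {w | ε ≤ |√(n : ℝ) * (T n w - ϑ P) - (√(n : ℝ))⁻¹ * ∑ i, ψ (w i)|}) atTop (𝓝 0)
  regular : ∃ L : ProbabilityMeasure ℝ, ∀ Q g, IsRegularSubmodel 𝓜 e P Q g →
    TendstoInDistribution
      (fun (n : ℕ) (w : Fin n → 𝒲) => √(n : ℝ) * (T n w - ϑ (Q (1 / √(n : ℝ)))))
      atTop (id : ℝ → ℝ)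
      (fun n : ℕ => Measure.pi fun _ : Fin n => (Q (1 / √(n : ℝ)) : Measure 𝒲))
      (L : Measure ℝ)

end Efficiency

end MARS

end

open MeasureTheory ProbabilityTheory Filter Topology
open scoped ENNReal NNReal

noncomputable section

namespace MARS

/-! ### Differentiation of moments along quadratic mean differentiable paths -/

section QuadraticMean

variable {𝒲 : Type*} [MeasurableSpace 𝒲]

/-! Identification. The two independence assumptions together give `P(A = 1 | X, U, M*, C, Z) =
π(X)` (`Population.condExp_annot_complete`). Weighting `A M = A M*` by `1 / π` therefore recovers
`E[Z^⊥ M*]`, which is the denominator. Writing `Y = Y⁰ + Δ M*`, the part of `E[Z^⊥ Y]` coming from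
`Y⁰` vanishes: by exogeneity and linearity it is the inner product of `Z^⊥` with a linear function
of `C`. Hence the ratio is `Δ`.

The fact behind both inference claims is `HasScore.integral_resid_mul_pseudoTreat`: when the score
is exactly `π`, the augmented weighted moment has mean `θ_den(Q)` for every imputation function,
right or wrong. It is used twice. For the estimator, replacing `μ` by the learned `μ̂` changes the
denominator sum by terms that, given the training sample, are i.i.d. with mean zero and second
moment at most a constant times the squared error of `μ̂`; consistency without any rate is enough.
What remains is a ratio of sample means, to which a linearization and the central limit theorem
apply. For the functional, freezing the imputation function at `μ_P` turns `θ_den` into the integral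
of one fixed function over the whole model, so `θ` is a quotient of two moments. Moments are
differentiable along quadratic mean differentiable paths
(`IsRegularSubmodel.tendsto_diffQuot_integral`), and the quotient rule produces `φ`.

Efficiency. The operator `f ↦ f - E[f | A, X̃] + E[f | X̃] - E f` sends bounded functions to bounded
scores of linear paths `1 + t g` that stay in the model. It fixes `φ` once `E[φ | A, X̃] = E[φ |
X̃]`, and outcome mean independence gives this equality. Approximating `φ` by simple functions thus
puts it in the tangent space (`exists_score_near_phi`). For a regular asymptotically linear
competitor with influence function `ψ`, the limiting characteristic function along such a path is
computed by hand, with an `L²` bound on the likelihood ratio transferring the expansion to the local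
alternatives (`IsRAL.charFun_eq`). Since the limit law may not depend on the path, `E[ψ g] = E[φ
g]`. Density of these `g` near `φ` gives `E[ψ φ] = E[φ²]`, and Cauchy-Schwarz concludes. -/

theorem abs_integral_mul_le_sqrt_mul_sqrt {μ : Measure 𝒲} {f g : 𝒲 → ℝ}
    (hf : MemLp f 2 μ) (hg : MemLp g 2 μ) :
    |∫ w, f w * g w ∂μ| ≤ √(∫ w, f w ^ 2 ∂μ) * √(∫ w, g w ^ 2 ∂μ) := by
  have h := integral_mul_norm_le_Lp_mul_Lq (μ := μ) (f := f) (g := g) (p := 2) (q := 2)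
    ⟨by norm_num, by norm_num, by norm_num⟩ (by simpa using hf) (by simpa using hg)
  simp only [Real.norm_eq_abs, Real.rpow_two, sq_abs, ← Real.sqrt_eq_rpow] at h
  refine le_trans ?_ h
  refine (abs_integral_le_integral_abs).trans (le_of_eq ?_)
  simp only [abs_mul]

/-- The square root of the density of `P` with respect to `ν`. -/
def sqrtDens (P ν : Measure 𝒲) (w : 𝒲) : ℝ := √(P.rnDeriv ν w).toReal

theorem measurable_sqrtDens (P ν : Measure 𝒲) : Measurable (sqrtDens P ν) :=
  (Measure.measurable_rnDeriv P ν).ennreal_toReal.sqrt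

theorem sqrtDens_sq (P ν : Measure 𝒲) (w : 𝒲) :
    sqrtDens P ν w ^ 2 = (P.rnDeriv ν w).toReal :=
  Real.sq_sqrt ENNReal.toReal_nonneg

variable {P ν : Measure 𝒲} [IsFiniteMeasure P] [IsFiniteMeasure ν]

theorem integral_mul_sqrtDens_sq (hP : P ≪ ν) (f : 𝒲 → ℝ) :
    ∫ w, f w * sqrtDens P ν w ^ 2 ∂ν = ∫ w, f w ∂P := by
  rw [← integral_rnDeriv_smul hP]
  simp only [sqrtDens_sq, smul_eq_mul, mul_comm]

theorem integrable_mul_sqrtDens_sq (hP : P ≪ ν) {f : 𝒲 → ℝ} (hf : Integrable f P) :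
    Integrable (fun w => f w * sqrtDens P ν w ^ 2) ν := by
  have := (integrable_rnDeriv_smul_iff (μ := P) (ν := ν) (f := f) hP).2 hf
  refine this.congr (ae_of_all _ fun w => ?_)
  simp only [sqrtDens_sq, smul_eq_mul, mul_comm]

theorem memLp_mul_sqrtDens (hP : P ≪ ν) {f : 𝒲 → ℝ} (hm : Measurable f) (hf : MemLp f 2 P) :
    MemLp (fun w => f w * sqrtDens P ν w) 2 ν := by
  have hms : AEStronglyMeasurable (fun w => f w * sqrtDens P ν w) ν :=
    (hm.mul (measurable_sqrtDens P ν)).aestronglyMeasurable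
  rw [memLp_two_iff_integrable_sq hms]
  simpa only [mul_pow] using integrable_mul_sqrtDens_sq hP hf.integrable_sq

theorem sqrt_integral_sq_add_le {μ : Measure 𝒲} {f g : 𝒲 → ℝ} {a b : ℝ}
    (hf : MemLp f 2 μ) (hg : MemLp g 2 μ) (ha : ∫ w, f w ^ 2 ∂μ ≤ a) (hb : ∫ w, g w ^ 2 ∂μ ≤ b) :
    ∫ w, (f w + g w) ^ 2 ∂μ ≤ 2 * a + 2 * b := by
  calc ∫ w, (f w + g w) ^ 2 ∂μ ≤ ∫ w, (2 * f w ^ 2 + 2 * g w ^ 2) ∂μ := by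
        refine integral_mono (hf.add hg).integrable_sq
          ((hf.integrable_sq.const_mul 2).add (hg.integrable_sq.const_mul 2)) fun w => ?_
        simp only
        nlinarith [sq_nonneg (f w - g w)]
    _ = 2 * ∫ w, f w ^ 2 ∂μ + 2 * ∫ w, g w ^ 2 ∂μ := by
        rw [integral_add (hf.integrable_sq.const_mul 2) (hg.integrable_sq.const_mul 2),
          integral_const_mul, integral_const_mul]
    _ ≤ _ := by gcongr

/-- The remainder of the first order expansion of `√dQ` around `√dP` in direction `g`. -/
def qmdRem (P Q : Measure 𝒲) (g : 𝒲 → ℝ) (t : ℝ) (w : 𝒲) : ℝ :=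
  (sqrtDens Q (P + Q) w - sqrtDens P (P + Q) w) / t - 1 / 2 * g w * sqrtDens P (P + Q) w

/-- With `s`, `s'` the root densities of `P`, `Q` and `r` the remainder, `s'² - s² = (s' + s)(s' -
s)` and `s' - s = t (r + g s / 2)`. The error is thus `∫ h (s' + s) r + (1/2) ∫ h g s (s' - s)`. In
the second integral `h` need not be bounded, so it is split at level `N`: where `|h| ≤ N`, the
factor `s' - s` is of order `t` in `L²`; where `|h| > N`, `h` is moved onto `s' - s`, whose product
with `h` has bounded `L²` norm, and the tail of `g²` gives smallness. -/
theorem abs_diffQuot_sub_le {P Q : Measure 𝒲} [IsFiniteMeasure P] [IsFiniteMeasure Q]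
    {g h : 𝒲 → ℝ} {t K N : ℝ} (hg : Measurable g) (hh : Measurable h) (hgP : MemLp g 2 P)
    (hhP : MemLp h 2 P) (hhQ : MemLp h 2 Q) (hKP : ∫ w, h w ^ 2 ∂P ≤ K)
    (hKQ : ∫ w, h w ^ 2 ∂Q ≤ K) (ht : 0 < t) (hN : 0 ≤ N) :
    |(∫ w, h w ∂Q - ∫ w, h w ∂P) / t - ∫ w, h w * g w ∂P| ≤
      √(2 * K + 2 * K) * √(∫ w, qmdRem P Q g t w ^ 2 ∂(P + Q)) +
      1 / 2 * (N * √(∫ w, g w ^ 2 ∂P) *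
        (t * √(2 * (∫ w, qmdRem P Q g t w ^ 2 ∂(P + Q)) + 2 * (1 / 4 * ∫ w, g w ^ 2 ∂P))) +
        √(∫ w, {w | N < |h w|}.indicator (fun w => g w ^ 2) w ∂P) * √(2 * K + 2 * K)) := by
  set ν := P + Q
  have hPν : P ≪ ν := Measure.absolutelyContinuous_of_le (Measure.le_add_right le_rfl)
  have hQν : Q ≪ ν := Measure.absolutelyContinuous_of_le (Measure.le_add_left le_rfl)
  set s := sqrtDens P ν with hs
  set s' := sqrtDens Q ν with hs'
  set r := qmdRem P Q g t with hr
  have one2 : MemLp (fun _ : 𝒲 => (1 : ℝ)) 2 P := memLp_const 1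
  have one2' : MemLp (fun _ : 𝒲 => (1 : ℝ)) 2 Q := memLp_const 1
  have Ls : MemLp s 2 ν := by simpa using memLp_mul_sqrtDens hPν measurable_const one2
  have Ls' : MemLp s' 2 ν := by simpa using memLp_mul_sqrtDens hQν measurable_const one2'
  have Lgs : MemLp (fun w => g w * s w) 2 ν := memLp_mul_sqrtDens hPν hg hgP
  have Lhs : MemLp (fun w => h w * s w) 2 ν := memLp_mul_sqrtDens hPν hh hhP
  have Lhs' : MemLp (fun w => h w * s' w) 2 ν := memLp_mul_sqrtDens hQν hh hhQ
  have Ldiff : MemLp (fun w => s' w - s w) 2 ν := Ls'.sub Ls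
  have hr_eq : r = fun w => t⁻¹ * (s' w - s w) - 1 / 2 * (g w * s w) := by
    ext w; simp only [hr, qmdRem, hs, hs']; ring
  have Lr : MemLp r 2 ν := by
    rw [hr_eq]; exact (Ldiff.const_mul _).sub (Lgs.const_mul _)
  have Ehs : ∫ w, (h w * s w) ^ 2 ∂ν = ∫ w, h w ^ 2 ∂P := by
    simp only [mul_pow]; exact integral_mul_sqrtDens_sq hPν _
  have Ehs' : ∫ w, (h w * s' w) ^ 2 ∂ν = ∫ w, h w ^ 2 ∂Q := by
    simp only [mul_pow]; exact integral_mul_sqrtDens_sq hQν _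
  have Egs : ∫ w, (g w * s w) ^ 2 ∂ν = ∫ w, g w ^ 2 ∂P := by
    simp only [mul_pow]; exact integral_mul_sqrtDens_sq hPν _
  have hdiff : ∀ w, s' w - s w = t * (r w + 1 / 2 * (g w * s w)) := by
    intro w; rw [hr_eq]; field_simp; ring
  have L1 : MemLp (fun w => h w * s' w + h w * s w) 2 ν := Lhs'.add Lhs
  have L2 : MemLp (fun w => h w * s' w + -(h w * s w)) 2 ν := Lhs'.add Lhs.neg
  have B1 : ∫ w, (h w * s' w + h w * s w) ^ 2 ∂ν ≤ 2 * K + 2 * K :=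
    sqrt_integral_sq_add_le Lhs' Lhs (Ehs'.trans_le hKQ) (Ehs.trans_le hKP)
  have B2 : ∫ w, (h w * s' w + -(h w * s w)) ^ 2 ∂ν ≤ 2 * K + 2 * K :=
    sqrt_integral_sq_add_le Lhs' Lhs.neg (Ehs'.trans_le hKQ)
      (by simpa using Ehs.trans_le hKP)
  have B3 : ∫ w, (s' w - s w) ^ 2 ∂ν ≤ t ^ 2 * (2 * (∫ w, r w ^ 2 ∂ν) +
      2 * (1 / 4 * ∫ w, g w ^ 2 ∂P)) := by
    simp only [hdiff, mul_pow t]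
    rw [integral_const_mul]
    gcongr
    refine sqrt_integral_sq_add_le Lr (Lgs.const_mul _) le_rfl ?_
    simp only [mul_pow (1 / 2 : ℝ)]
    rw [integral_const_mul, Egs]; norm_num
  set S : Set 𝒲 := {w | N < |h w|} with hS
  have mS : MeasurableSet S := measurableSet_lt measurable_const hh.abs
  have mSc : MeasurableSet Sᶜ := mS.compl
  have Lg1 : MemLp (fun w => Sᶜ.indicator h w * (g w * s w)) 2 ν := by
    refine (Lgs.const_mul N).mono ((hh.indicator mSc).mul
      (hg.mul (measurable_sqrtDens _ _))).aestronglyMeasurable (ae_of_all _ fun w => ?_)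
    rw [norm_mul, norm_mul N]
    gcongr
    by_cases hw : w ∈ S
    · simp [hw, abs_nonneg]
    · rw [Set.indicator_of_mem (by simpa using hw), Real.norm_eq_abs, Real.norm_eq_abs,
        abs_of_nonneg hN]
      simpa [hS] using hw
  have Lg2 : MemLp (fun w => S.indicator g w * s w) 2 ν := by
    have := Lgs.indicator mS
    refine this.ae_eq (ae_of_all _ fun w => ?_)
    by_cases hw : w ∈ S <;> simp [hw]
  have Elg2 : ∫ w, (S.indicator g w * s w) ^ 2 ∂ν
      = ∫ w, S.indicator (fun w => g w ^ 2) w ∂P := by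
    simp only [mul_pow]
    rw [integral_mul_sqrtDens_sq hPν]
    congr 1; ext w
    by_cases hw : w ∈ S <;> simp [hw]
  have Elg1 : ∫ w, (Sᶜ.indicator h w * (g w * s w)) ^ 2 ∂ν ≤ N ^ 2 * ∫ w, g w ^ 2 ∂P := by
    rw [← Egs, ← integral_const_mul]
    refine integral_mono Lg1.integrable_sq (Lgs.integrable_sq.const_mul _) fun w => ?_
    simp only [mul_pow (Sᶜ.indicator h w)]
    refine mul_le_mul_of_nonneg_right ?_ (sq_nonneg _)
    by_cases hw : w ∈ S
    · simp [hw, sq_nonneg]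
    · rw [Set.indicator_of_mem (by simpa using hw), ← sq_abs (h w)]
      gcongr
      simpa [hS] using hw
  have key : (∫ w, h w ∂Q - ∫ w, h w ∂P) / t - ∫ w, h w * g w ∂P
      = ∫ w, (h w * s' w + h w * s w) * r w ∂ν
        + 1 / 2 * (∫ w, (Sᶜ.indicator h w * (g w * s w)) * (s' w - s w) ∂ν
          + ∫ w, (S.indicator g w * s w) * (h w * s' w + -(h w * s w)) ∂ν) := by
    have i1 : Integrable (fun w => (h w * s' w + h w * s w) * r w) ν := L1.integrable_mul Lr
    have i2 : Integrable (fun w => (Sᶜ.indicator h w * (g w * s w)) * (s' w - s w)) ν :=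
      Lg1.integrable_mul Ldiff
    have i3 : Integrable (fun w => (S.indicator g w * s w) * (h w * s' w + -(h w * s w))) ν :=
      Lg2.integrable_mul L2
    have j1 := integrable_mul_sqrtDens_sq hQν (hhQ.integrable (by norm_num))
    have j2 := integrable_mul_sqrtDens_sq hPν (hhP.integrable (by norm_num))
    have i4 : Integrable (fun w => 1 / 2 * ((Sᶜ.indicator h w * (g w * s w)) * (s' w - s w)
        + (S.indicator g w * s w) * (h w * s' w + -(h w * s w)))) ν := (i2.add i3).const_mul _
    have j3 : Integrable (fun w => h w * g w * sqrtDens P ν w ^ 2) ν :=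
      integrable_mul_sqrtDens_sq hPν (hhP.integrable_mul hgP)
    have j4 : Integrable (fun w =>
        (h w * sqrtDens Q ν w ^ 2 - h w * sqrtDens P ν w ^ 2) / t) ν := (j1.sub j2).div_const t
    rw [← integral_mul_sqrtDens_sq hQν h, ← integral_mul_sqrtDens_sq hPν h,
      ← integral_mul_sqrtDens_sq hPν (fun w => h w * g w), ← integral_sub j1 j2,
      ← integral_div, ← integral_sub j4 j3, ← integral_add i2 i3,
      ← integral_const_mul, ← integral_add i1 i4]
    congr 1; ext w
    have : Sᶜ.indicator h w * g w + S.indicator g w * h w = h w * g w := by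
      by_cases hw : w ∈ S <;> simp [hw, mul_comm]
    rw [show (Sᶜ.indicator h w * (g w * s w)) * (s' w - s w)
        + (S.indicator g w * s w) * (h w * s' w + -(h w * s w))
        = (Sᶜ.indicator h w * g w + S.indicator g w * h w) * (s w * (s' w - s w)) by ring, this,
      hr_eq]
    field_simp
    ring
  rw [key]
  refine (abs_add_le _ _).trans (add_le_add ?_ ?_)
  · exact (abs_integral_mul_le_sqrt_mul_sqrt L1 Lr).trans (by gcongr)
  · rw [abs_mul, abs_of_pos (by norm_num : (0 : ℝ) < 1 / 2)]
    gcongr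
    refine (abs_add_le _ _).trans (add_le_add ?_ ?_)
    · refine (abs_integral_mul_le_sqrt_mul_sqrt Lg1 Ldiff).trans ?_
      have e1 : √(∫ w, (Sᶜ.indicator h w * (g w * s w)) ^ 2 ∂ν) ≤ N * √(∫ w, g w ^ 2 ∂P) := by
        rw [← Real.sqrt_sq hN, ← Real.sqrt_mul (sq_nonneg N)]
        exact Real.sqrt_le_sqrt (by simpa [Real.sqrt_sq hN] using Elg1)
      have e2 : √(∫ w, (s' w - s w) ^ 2 ∂ν) ≤ t * √(2 * (∫ w, r w ^ 2 ∂ν) +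
          2 * (1 / 4 * ∫ w, g w ^ 2 ∂P)) := by
        rw [← Real.sqrt_sq ht.le, ← Real.sqrt_mul (sq_nonneg t)]
        exact Real.sqrt_le_sqrt (by simpa [Real.sqrt_sq ht.le] using B3)
      gcongr
    · refine (abs_integral_mul_le_sqrt_mul_sqrt Lg2 L2).trans ?_
      rw [Elg2]
      gcongr

theorem tendsto_integral_indicator_lt_abs {P : Measure 𝒲} {f h : 𝒲 → ℝ}
    (hh : Measurable h) (hf : Integrable f P) :
    Tendsto (fun N : ℕ => ∫ w, {w | (N : ℝ) < |h w|}.indicator f w ∂P) atTop (𝓝 0) := by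
  rw [show (0 : ℝ) = ∫ _, (0 : ℝ) ∂P by simp]
  refine tendsto_integral_of_dominated_convergence (fun w => |f w|) (fun N => ?_) hf.abs
    (fun N => ae_of_all _ fun w => ?_) (ae_of_all _ fun w => ?_)
  · exact hf.aestronglyMeasurable.indicator (measurableSet_lt measurable_const hh.abs)
  · by_cases hw : (N : ℝ) < |h w| <;> simp [hw]
  · obtain ⟨n, hn⟩ := exists_nat_ge |h w|
    refine tendsto_const_nhds.congr' ?_
    filter_upwards [eventually_ge_atTop n] with N hN
    have : (n : ℝ) ≤ N := by exact_mod_cast hN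
    rw [Set.indicator_of_notMem]
    simp only [Set.mem_ofPred_eq, not_lt]
    linarith

/-- The integral in `qmd` is over `P + Q t`, which may charge the set where the scores differ; there
the score is multiplied by the root density of `P`, which vanishes almost everywhere on that set.
This allows passing to a measurable version of the score. -/
theorem IsRegularSubmodel.congr_score {𝓜 : Set (ProbabilityMeasure 𝒲)} {e : 𝒲 → ℝ}
    {P : ProbabilityMeasure 𝒲} {Q : ℝ → ProbabilityMeasure 𝒲} {g g' : 𝒲 → ℝ}
    (hQ : IsRegularSubmodel 𝓜 e P Q g) (hg : g =ᵐ[(P : Measure 𝒲)] g') :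
    IsRegularSubmodel 𝓜 e P Q g' where
  at_zero := hQ.at_zero
  mem := hQ.mem
  score_memLp := (memLp_congr_ae hg).1 hQ.score_memLp
  moment := hQ.moment
  qmd := by
    refine hQ.qmd.congr fun t => ?_
    have hPν : (P : Measure 𝒲) ≪ (P : Measure 𝒲) + (Q t : Measure 𝒲) :=
      Measure.absolutelyContinuous_of_le (Measure.le_add_right le_rfl)
    replace hg := Measure.ae_rnDeriv_ne_zero_imp_of_ae
      ((P : Measure 𝒲) + (Q t : Measure 𝒲)) hg
    refine lintegral_congr_ae ?_
    filter_upwards [hg] with w hw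
    by_cases h0 : (P : Measure 𝒲).rnDeriv ((P : Measure 𝒲) + (Q t : Measure 𝒲)) w = 0
    · simp [h0]
    · rw [hw h0]

/-- Moments are differentiable along regular submodels. -/
theorem IsRegularSubmodel.tendsto_diffQuot_integral {𝓜 : Set (ProbabilityMeasure 𝒲)} {e : 𝒲 → ℝ}
    {P : ProbabilityMeasure 𝒲} {Q : ℝ → ProbabilityMeasure 𝒲} {g h : 𝒲 → ℝ} {c : ℝ}
    (hQ : IsRegularSubmodel 𝓜 e P Q g) (he : ∀ t, MemLp e 2 (Q t : Measure 𝒲))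
    (hh : Measurable h) (hhe : ∀ w, |h w| ≤ c * e w) :
    Tendsto (fun t : ℝ => (∫ w, h w ∂(Q t : Measure 𝒲) - ∫ w, h w ∂(P : Measure 𝒲)) / t)
      (𝓝[>] 0) (𝓝 (∫ w, h w * g w ∂(P : Measure 𝒲))) := by
  wlog hg : Measurable g generalizing g
  · obtain ⟨g', hg', hgg'⟩ := hQ.score_memLp.aestronglyMeasurable.aemeasurable
    have := this (hQ.congr_score hgg') hg'
    rwa [integral_congr_ae (hgg'.mono fun w hw => by simp only [hw] :
      (fun w => h w * g w) =ᵐ[(P : Measure 𝒲)] fun w => h w * g' w)]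
  have hhL : ∀ t, MemLp h 2 (Q t : Measure 𝒲) := fun t =>
    ((he t).const_mul c).mono hh.aestronglyMeasurable
      (ae_of_all _ fun w => (hhe w).trans (le_abs_self _))
  have hhP : MemLp h 2 (P : Measure 𝒲) := hQ.at_zero ▸ hhL 0
  have hgP := hQ.score_memLp
  obtain ⟨K₀, hK₀⟩ := hQ.moment
  set K : ℝ := max (c ^ 2 * K₀) (∫ w, h w ^ 2 ∂(P : Measure 𝒲)) with hK
  have hKQ : ∀ᶠ t in 𝓝[>] (0 : ℝ), ∫ w, h w ^ 2 ∂(Q t : Measure 𝒲) ≤ K := by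
    filter_upwards [hK₀] with t ht
    refine le_trans ?_ (le_max_left _ _)
    have h1 : ∫ w, e w ^ 2 ∂(Q t : Measure 𝒲) ≤ K₀ := by
      rw [integral_eq_lintegral_of_nonneg_ae (ae_of_all _ fun w => sq_nonneg _)
        (he t).integrable_sq.aestronglyMeasurable]
      exact ENNReal.toReal_le_coe_of_le_coe ht
    calc ∫ w, h w ^ 2 ∂(Q t : Measure 𝒲) ≤ ∫ w, c ^ 2 * e w ^ 2 ∂(Q t : Measure 𝒲) := by
          refine integral_mono (hhL t).integrable_sq ((he t).integrable_sq.const_mul _) fun w => ?_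
          simp only
          rw [← mul_pow, ← sq_abs]
          have := hhe w
          gcongr
      _ ≤ _ := by rw [integral_const_mul]; gcongr
  set R : ℝ → ℝ := fun t => ∫ w, qmdRem (P : Measure 𝒲) (Q t : Measure 𝒲) g t w ^ 2
    ∂((P : Measure 𝒲) + (Q t : Measure 𝒲)) with hR
  have hR0 : Tendsto R (𝓝[>] 0) (𝓝 0) := by
    have := (ENNReal.tendsto_toReal ENNReal.zero_ne_top).comp hQ.qmd
    refine this.congr fun t => ?_
    simp only [hR, Function.comp_apply]
    rw [integral_eq_lintegral_of_nonneg_ae (ae_of_all _ fun w => sq_nonneg _)]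
    · rfl
    · exact ((((measurable_sqrtDens _ _).sub (measurable_sqrtDens _ _)).div_const t).sub
        ((hg.const_mul _).mul (measurable_sqrtDens _ _))).pow_const 2 |>.aestronglyMeasurable
  set G : ℝ := ∫ w, g w ^ 2 ∂(P : Measure 𝒲)
  rw [Metric.tendsto_nhds]
  intro ε hε
  have hN0 : Tendsto (fun N : ℕ => 1 / 2 * (√(∫ w, {w | (N : ℝ) < |h w|}.indicator
      (fun w => g w ^ 2) w ∂(P : Measure 𝒲)) * √(2 * K + 2 * K))) atTop (𝓝 0) := by
    have := (Real.continuous_sqrt.tendsto _).comp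
      (tendsto_integral_indicator_lt_abs hh hgP.integrable_sq)
    have := (this.mul_const √(2 * K + 2 * K)).const_mul (1 / 2)
    simpa using this
  -- The truncation level is fixed first: its error term does not involve `t`. The other terms then
  -- vanish as `t ↓ 0` for this `N`.
  obtain ⟨N, hN⟩ := (hN0.eventually_lt_const (half_pos hε)).exists
  have htid : Tendsto (fun t : ℝ => t) (𝓝[>] 0) (𝓝 0) := nhdsWithin_le_nhds
  have hrest : Tendsto (fun t => √(2 * K + 2 * K) * √(R t) +
      1 / 2 * (N * √G * (t * √(2 * R t + 2 * (1 / 4 * G))))) (𝓝[>] 0) (𝓝 0) := by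
    have h1 := ((Real.continuous_sqrt.tendsto _).comp hR0).const_mul √(2 * K + 2 * K)
    have h2 := (Real.continuous_sqrt.tendsto _).comp
      ((hR0.const_mul 2).add_const (2 * (1 / 4 * G)))
    have h3 := ((htid.mul h2).const_mul (N * √G)).const_mul (1 / 2)
    simpa using h1.add h3
  filter_upwards [hKQ, hrest.eventually_lt_const (half_pos hε), self_mem_nhdsWithin]
    with t h1 h2 h3
  rw [Real.dist_eq]
  have := abs_diffQuot_sub_le hg hh hgP hhP (hhL t) (le_max_right _ _) h1 h3 (Nat.cast_nonneg N)
  refine this.trans_lt ?_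
  rw [mul_add, ← add_assoc]
  linarith

end QuadraticMean

/-! ### Linear paths -/

section LinearPath

variable {𝒲 : Type*} [MeasurableSpace 𝒲]

/-- The probability measure with density `1 + t g` with respect to `P`. -/
def tilt (P : Measure 𝒲) (g : 𝒲 → ℝ) (t : ℝ) : Measure 𝒲 :=
  P.withDensity fun w => ENNReal.ofReal (1 + t * g w)

variable {P : Measure 𝒲} {g : 𝒲 → ℝ} {B t : ℝ}

theorem abs_mul_le_half {𝒲 : Type*} {g : 𝒲 → ℝ} {B t : ℝ} (hB : ∀ w, |g w| ≤ B) (ht : 0 ≤ t) (htB :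
    t * B ≤ 1 / 2) (w : 𝒲) :
    |t * g w| ≤ 1 / 2 := by
  rw [abs_mul, abs_of_nonneg ht]
  exact (mul_le_mul_of_nonneg_left (hB w) ht).trans htB

theorem half_le_one_add_mul {𝒲 : Type*} {g : 𝒲 → ℝ} {B t : ℝ} (hB : ∀ w, |g w| ≤ B) (ht : 0 ≤ t)
    (htB : t * B ≤ 1 / 2) (w : 𝒲) :
    1 / 2 ≤ 1 + t * g w := by
  linarith [(abs_le.1 (abs_mul_le_half hB ht htB w)).1]

theorem one_add_mul_le_two {𝒲 : Type*} {g : 𝒲 → ℝ} {B t : ℝ} (hB : ∀ w, |g w| ≤ B) (ht : 0 ≤ t)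
    (htB : t * B ≤ 1 / 2) (w : 𝒲) :
    1 + t * g w ≤ 2 := by
  linarith [(abs_le.1 (abs_mul_le_half hB ht htB w)).2]

theorem integral_tilt (hg : Measurable g) (hB : ∀ w, |g w| ≤ B) (ht : 0 ≤ t)
    (htB : t * B ≤ 1 / 2) {E : Type*} [NormedAddCommGroup E] [NormedSpace ℝ E] (f : 𝒲 → E) :
    ∫ w, f w ∂(tilt P g t) = ∫ w, (1 + t * g w) • f w ∂P := by
  rw [tilt, integral_withDensity_eq_integral_toReal_smul (by fun_prop)
    (ae_of_all _ fun w => ENNReal.ofReal_lt_top)]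
  congr 1; ext w
  rw [ENNReal.toReal_ofReal (by linarith [half_le_one_add_mul hB ht htB w])]

theorem integrable_of_abs_le [IsProbabilityMeasure P] (hg : Measurable g) (hB : ∀ w, |g w| ≤ B) :
    Integrable g P :=
  Integrable.of_bound hg.aestronglyMeasurable B (ae_of_all _ hB)

theorem isProbabilityMeasure_tilt [IsProbabilityMeasure P] (hg : Measurable g) (hB : ∀ w, |g w| ≤ B)
    (h0 : ∫ w, g w ∂P = 0) (ht : 0 ≤ t) (htB : t * B ≤ 1 / 2) :
    IsProbabilityMeasure (tilt P g t) := by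
  have hi := integrable_of_abs_le (P := P) hg hB
  have hi' : Integrable (fun w => 1 + t * g w) P := (integrable_const 1).add (hi.const_mul t)
  constructor
  rw [tilt, withDensity_apply _ MeasurableSet.univ, Measure.restrict_univ,
    ← ofReal_integral_eq_lintegral_ofReal hi' (ae_of_all _ fun w => by
      simp only [Pi.zero_apply]; linarith [half_le_one_add_mul hB ht htB w])]
  rw [integral_add (integrable_const 1) (hi.const_mul t), integral_const_mul, h0]
  simp

theorem tilt_le (hB : ∀ w, |g w| ≤ B) (ht : 0 ≤ t) (htB : t * B ≤ 1 / 2) :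
    tilt P g t ≤ (2 : ℝ≥0∞) • P := by
  rw [← withDensity_const]
  refine withDensity_mono (ae_of_all _ fun w => ?_)
  simpa using ENNReal.ofReal_le_ofReal (one_add_mul_le_two hB ht htB w)

/-- Chain rule for densities. It holds almost everywhere for the sum measure because the tilt, and
hence the sum, is absolutely continuous with respect to `P`. -/
theorem rnDeriv_tilt [IsProbabilityMeasure P] (hg : Measurable g) [IsFiniteMeasure (tilt P g t)] :
    (tilt P g t).rnDeriv (P + tilt P g t) =ᵐ[P + tilt P g t] fun w =>
      ENNReal.ofReal (1 + t * g w) * P.rnDeriv (P + tilt P g t) w := by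
  set ν := P + tilt P g t
  have hQP : tilt P g t ≪ P := withDensity_absolutelyContinuous _ _
  have hνP : ν ≪ P := by
    refine Measure.AbsolutelyContinuous.mk fun s _ hs => ?_
    simp [ν, hs, hQP hs]
  have h2 : (tilt P g t).rnDeriv P =ᵐ[ν] fun w => ENNReal.ofReal (1 + t * g w) :=
    hνP.ae_le (Measure.rnDeriv_withDensity P (by fun_prop))
  filter_upwards [h2, Measure.rnDeriv_mul_rnDeriv (μ := tilt P g t) (ν := P) (κ := ν) hQP]
    with w h1 h2
  rw [← h2, Pi.mul_apply, h1]

/-- With `u = √(1 + x)` the remainder is exactly `-(u - 1)² / 2`, while `x = (u - 1)(u + 1)` with `u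
+ 1 ≥ 1`. -/
theorem abs_sqrt_one_add_sub_le {x : ℝ} (hx : -1 ≤ x) : |√(1 + x) - 1 - x / 2| ≤ x ^ 2 / 2 := by
  set u := √(1 + x)
  have hu : u ^ 2 = 1 + x := Real.sq_sqrt (by linarith)
  have hu0 : 0 ≤ u := Real.sqrt_nonneg _
  have hx' : x = (u - 1) * (u + 1) := by linarith
  have h1 : u - 1 - x / 2 = -((u - 1) ^ 2 / 2) := by linarith
  rw [h1, abs_neg, abs_of_nonneg (by positivity), hx', mul_pow]
  nlinarith [mul_nonneg (sq_nonneg (u - 1)) hu0, mul_nonneg (sq_nonneg (u - 1)) (mul_nonneg hu0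
      hu0)]

/-- The root density of the tilt is `√(1 + t g)` times that of `P`, so the remainder is `t⁻¹ (√(1 +
t g) - 1 - t g / 2)` times the latter. The Taylor bound makes the first factor at most `t B²`. -/
theorem lintegral_qmdRem_tilt_le [IsProbabilityMeasure P] (hg : Measurable g) (hB : ∀ w, |g w| ≤ B)
    (ht : 0 < t)
    (htB : t * B ≤ 1 / 2) [IsFiniteMeasure (tilt P g t)] :
    ∫⁻ w, ENNReal.ofReal
      (((√((tilt P g t).rnDeriv (P + tilt P g t) w).toReal
          - √(P.rnDeriv (P + tilt P g t) w).toReal) / t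
        - 1 / 2 * g w * √(P.rnDeriv (P + tilt P g t) w).toReal) ^ 2) ∂(P + tilt P g t)
      ≤ ENNReal.ofReal (t ^ 2 * B ^ 4) := by
  have hPν : P ≪ P + tilt P g t := Measure.absolutelyContinuous_of_le (Measure.le_add_right le_rfl)
  calc _ ≤ ∫⁻ w, ENNReal.ofReal (t ^ 2 * B ^ 4) * P.rnDeriv (P + tilt P g t) w
        ∂(P + tilt P g t) := by
        refine lintegral_mono_ae ?_
        filter_upwards [rnDeriv_tilt (P := P) (t := t) hg,
          P.rnDeriv_ne_top (P + tilt P g t)] with w hw hw'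
        have h1 := half_le_one_add_mul hB ht.le htB w
        rw [hw, ENNReal.toReal_mul, ENNReal.toReal_ofReal (by linarith),
          Real.sqrt_mul (by linarith)]
        conv_rhs => rw [← ENNReal.ofReal_toReal hw', ← ENNReal.ofReal_mul (by positivity)]
        refine ENNReal.ofReal_le_ofReal ?_
        set p := (P.rnDeriv (P + tilt P g t) w).toReal
        have hp : 0 ≤ p := ENNReal.toReal_nonneg
        have h2 : (√(1 + t * g w) * √p - √p) / t - 1 / 2 * g w * √p
            = t⁻¹ * (√(1 + t * g w) - 1 - t * g w / 2) * √p := by field_simp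
        rw [h2, mul_pow, Real.sq_sqrt hp]
        refine mul_le_mul_of_nonneg_right ?_ hp
        rw [← sq_abs]
        have h3 := abs_sqrt_one_add_sub_le (x := t * g w) (by linarith)
        have h5 : g w ^ 2 ≤ B ^ 2 := by
          rw [← sq_abs (g w)]; exact pow_le_pow_left₀ (abs_nonneg _) (hB w) 2
        have h4 : |t⁻¹ * (√(1 + t * g w) - 1 - t * g w / 2)| ≤ t * B ^ 2 := by
          rw [abs_mul, abs_of_pos (inv_pos.2 ht)]
          calc _ ≤ t⁻¹ * ((t * g w) ^ 2 / 2) := by gcongr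
            _ = t * (g w ^ 2 / 2) := by field_simp
            _ ≤ _ := by gcongr; nlinarith [sq_nonneg (g w)]
        calc _ ≤ (t * B ^ 2) ^ 2 := pow_le_pow_left₀ (abs_nonneg _) h4 2
          _ = _ := by ring
    _ = ENNReal.ofReal (t ^ 2 * B ^ 4) := by
        rw [lintegral_const_mul _ (Measure.measurable_rnDeriv _ _), Measure.lintegral_rnDeriv hPν]
        simp

/-- A path with densities `1 + t g` for small `t > 0` is a regular submodel with score `g`. -/
theorem exists_isRegularSubmodel_tilt {𝓜 : Set (ProbabilityMeasure 𝒲)} {e : 𝒲 → ℝ}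
    {P : ProbabilityMeasure 𝒲} (hP : P ∈ 𝓜) (hg : Measurable g) (hB : ∀ w, |g w| ≤ B)
    (h0 : ∫ w, g w ∂(P : Measure 𝒲) = 0) (he : MemLp e 2 (P : Measure 𝒲)) {δ : ℝ} (hδ : 0 < δ)
    (hmem : ∀ t, 0 < t → t < δ → t * B ≤ 1 / 2 → ∀ R : ProbabilityMeasure 𝒲,
      (R : Measure 𝒲) = tilt (P : Measure 𝒲) g t → R ∈ 𝓜) :
    ∃ Q, IsRegularSubmodel 𝓜 e P Q g ∧
      ∀ᶠ t in 𝓝[>] (0 : ℝ), t * B ≤ 1 / 2 ∧ (Q t : Measure 𝒲) = tilt (P : Measure 𝒲) g t := by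
  classical
  -- A submodel must lie in the model for every real parameter, so the path is the tilt for small
  -- positive `t` only and is constantly `P` elsewhere.
  have hQ : ∀ t : ℝ, ∃ R : ProbabilityMeasure 𝒲,
      ((0 < t ∧ t < δ ∧ t * B ≤ 1 / 2) → (R : Measure 𝒲) = tilt (P : Measure 𝒲) g t) ∧
      (¬ (0 < t ∧ t < δ ∧ t * B ≤ 1 / 2) → R = P) := by
    intro t
    by_cases h : 0 < t ∧ t < δ ∧ t * B ≤ 1 / 2
    · exact ⟨⟨tilt (P : Measure 𝒲) g t, isProbabilityMeasure_tilt hg hB h0 h.1.le h.2.2⟩,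
        fun _ => rfl, fun h' => absurd h h'⟩
    · exact ⟨P, fun h' => absurd h' h, fun _ => rfl⟩
  choose Q hQ1 hQ2 using hQ
  have hsmall : ∀ᶠ t in 𝓝[>] (0 : ℝ), 0 < t ∧ t < δ ∧ t * B ≤ 1 / 2 := by
    have hc : Tendsto (fun t : ℝ => t * B) (𝓝[>] 0) (𝓝 0) := by
      have : Tendsto (fun t : ℝ => t * B) (𝓝 0) (𝓝 (0 * B)) := tendsto_id.mul_const B
      rw [zero_mul] at this
      exact this.mono_left nhdsWithin_le_nhds
    filter_upwards [self_mem_nhdsWithin, nhdsWithin_le_nhds (Iio_mem_nhds hδ),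
      hc.eventually_le_const (by norm_num : (0 : ℝ) < 1 / 2)] with t h1 h2 h3
    exact ⟨h1, h2, h3⟩
  refine ⟨Q, ⟨hQ2 0 (by simp), fun t => ?_, ?_, ?_, ?_⟩, ?_⟩
  · by_cases h : 0 < t ∧ t < δ ∧ t * B ≤ 1 / 2
    · exact hmem t h.1 h.2.1 h.2.2 _ (hQ1 t h)
    · rw [hQ2 t h]; exact hP
  · exact MemLp.of_bound hg.aestronglyMeasurable B (ae_of_all _ hB)
  · have hlim : Tendsto (fun t : ℝ => ENNReal.ofReal (t ^ 2 * B ^ 4)) (𝓝[>] 0) (𝓝 0) := by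
      have : Tendsto (fun t : ℝ => ENNReal.ofReal (t ^ 2 * B ^ 4)) (𝓝 0)
          (𝓝 (ENNReal.ofReal (0 ^ 2 * B ^ 4))) :=
        (ENNReal.continuous_ofReal.comp (by fun_prop : Continuous fun t : ℝ => t ^ 2 * B ^
          4)).tendsto 0
      simp only [ne_eq, OfNat.ofNat_ne_zero, not_false_eq_true, zero_pow, zero_mul,
        ENNReal.ofReal_zero] at this
      exact this.mono_left nhdsWithin_le_nhds
    refine tendsto_of_tendsto_of_tendsto_of_le_of_le' tendsto_const_nhds hlim
      (Eventually.of_forall fun _ => zero_le) ?_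
    filter_upwards [hsmall] with t h
    have hT := hQ1 t h
    have : IsFiniteMeasure (tilt (P : Measure 𝒲) g t) := by rw [← hT]; infer_instance
    rw [hT]
    exact lintegral_qmdRem_tilt_le hg hB h.1 h.2.2
  -- The factor `2` bounds the density `1 + t g` on the range `t B ≤ 1 / 2`.
  · refine ⟨2 * (∫⁻ w, ENNReal.ofReal (e w ^ 2) ∂(P : Measure 𝒲)).toNNReal, ?_⟩
    filter_upwards [hsmall] with t h
    rw [hQ1 t h, ENNReal.coe_mul, ENNReal.coe_toNNReal he.integrable_sq.lintegral_lt_top.ne]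
    refine (lintegral_mono' (tilt_le hB h.1.le h.2.2) le_rfl).trans (le_of_eq ?_)
    rw [lintegral_smul_measure]
    simp
  · filter_upwards [hsmall] with t h using ⟨h.2.2, hQ1 t h⟩

end LinearPath

/-! ### Product measures of tilted laws -/

section LeCam

variable {𝒲 : Type*} [MeasurableSpace 𝒲]

/-- The likelihood ratio of `n` independent draws from the tilted law. -/
def tiltLik (g : 𝒲 → ℝ) (t : ℝ) {n : ℕ} (w : Fin n → 𝒲) : ℝ := ∏ i, (1 + t * g (w i))

variable {P : Measure 𝒲} [IsProbabilityMeasure P] {g : 𝒲 → ℝ} {B t : ℝ}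

theorem pi_tilt (hg : Measurable g) (hB : ∀ w, |g w| ≤ B) (ht : 0 ≤ t) (htB : t * B ≤ 1 / 2)
    [IsProbabilityMeasure (tilt P g t)] (n : ℕ) :
    (Measure.pi fun _ : Fin n => tilt P g t) =
      (Measure.pi fun _ : Fin n => P).withDensity fun w => ENNReal.ofReal (tiltLik g t w) := by
  have hpos := fun w => (by linarith [half_le_one_add_mul hB ht htB w] : 0 ≤ 1 + t * g w)
  refine Measure.pi_eq fun s hs => ?_
  rw [withDensity_apply _ (MeasurableSet.univ_pi hs),
    ← lintegral_indicator (MeasurableSet.univ_pi hs)]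
  have h1 : ∀ w : Fin n → 𝒲, (Set.univ.pi s).indicator
      (fun w => ENNReal.ofReal (tiltLik g t w)) w
      = ∏ i, (s i).indicator (fun x => ENNReal.ofReal (1 + t * g x)) (w i) := by
    intro w
    by_cases hw : w ∈ Set.univ.pi s
    · rw [Set.indicator_of_mem hw, tiltLik, ENNReal.ofReal_prod_of_nonneg fun i _ => hpos _]
      refine Finset.prod_congr rfl fun i _ => ?_
      rw [Set.indicator_of_mem (hw i (Set.mem_univ i))]
    · rw [Set.indicator_of_notMem hw]
      simp only [Set.mem_pi, Set.mem_univ, true_implies, not_forall] at hw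
      obtain ⟨i, hi⟩ := hw
      exact (Finset.prod_eq_zero (Finset.mem_univ i) (Set.indicator_of_notMem hi _)).symm
  have hm : ∀ i, Measurable ((s i).indicator fun x => ENNReal.ofReal (1 + t * g x)) :=
    fun i => (by fun_prop : Measurable fun x => ENNReal.ofReal (1 + t * g x)).indicator (hs i)
  simp only [h1]
  have h2 := lintegral_prod_eq_prod_lintegral_of_indepFun (μ := Measure.pi fun _ : Fin n => P)
    Finset.univ (fun i w => (s i).indicator (fun x => ENNReal.ofReal (1 + t * g x)) (w i))
    (iIndepFun_pi (μ := fun _ : Fin n => P) fun i => (hm i).aemeasurable)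
    (fun i => (hm i).comp (measurable_pi_apply i))
  rw [h2]
  refine Finset.prod_congr rfl fun i _ => ?_
  rw [(measurePreserving_eval (fun _ : Fin n => P) i).lintegral_comp (hm i),
    lintegral_indicator (hs i), tilt, withDensity_apply _ (hs i)]

theorem measurable_tiltLik (hg : Measurable g) (n : ℕ) :
    Measurable fun w : Fin n → 𝒲 => tiltLik g t w :=
  Finset.measurable_fun_prod _ fun i _ =>
    (hg.comp (measurable_pi_apply i)).const_mul t |>.const_add 1

theorem tiltLik_nonneg {𝒲 : Type*} {g : 𝒲 → ℝ} {B t : ℝ} (hB : ∀ w, |g w| ≤ B) (ht : 0 ≤ t) (htB :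
    t * B ≤ 1 / 2) {n : ℕ}
    (w : Fin n → 𝒲) : 0 ≤ tiltLik g t w :=
  Finset.prod_nonneg fun i _ => by linarith [half_le_one_add_mul hB ht htB (w i)]

/-- By independence the second moment is an `n`-th power, and centring of `g` leaves `(1 + t²
E[g²])ⁿ ≤ exp (n t² B²)`. The scaling `n t² ≤ 1` of local alternatives makes this uniform in `n`. -/
theorem integral_tiltLik_sq_le (hg : Measurable g) (hB : ∀ w, |g w| ≤ B)
    (h0 : ∫ w, g w ∂P = 0) {n : ℕ} (hn : n * t ^ 2 ≤ 1) :
    ∫ w, tiltLik g t w ^ 2 ∂(Measure.pi fun _ : Fin n => P) ≤ Real.exp (B ^ 2) := by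
  simp only [tiltLik, ← Finset.prod_pow]
  rw [integral_fintype_prod_eq_pow (fun x => (1 + t * g x) ^ 2), Fintype.card_fin]
  have hi := integrable_of_abs_le (P := P) hg hB
  have hsq : ∀ w, |g w ^ 2| ≤ B ^ 2 := fun w => by
    rw [abs_pow]; exact pow_le_pow_left₀ (abs_nonneg _) (hB w) 2
  have hi2 := integrable_of_abs_le (P := P) (hg.pow_const 2) hsq
  have h1 : ∫ w, (1 + t * g w) ^ 2 ∂P = 1 + t ^ 2 * ∫ w, g w ^ 2 ∂P := by
    have : ∀ w, (1 + t * g w) ^ 2 = 1 + (2 * t * g w + t ^ 2 * g w ^ 2) := fun w => by ring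
    simp only [this]
    have j : Integrable (fun w => 2 * t * g w + t ^ 2 * g w ^ 2) P :=
      (hi.const_mul _).add (hi2.const_mul _)
    rw [integral_add (integrable_const 1) j, integral_add (hi.const_mul _) (hi2.const_mul _),
      integral_const_mul, integral_const_mul, h0]
    simp
  have h2 : ∫ w, g w ^ 2 ∂P ≤ B ^ 2 := by
    have := integral_mono hi2 (integrable_const (B ^ 2)) fun w => (le_abs_self _).trans (hsq w)
    simpa using this
  have h3 : 0 ≤ ∫ w, g w ^ 2 ∂P := integral_nonneg fun w => sq_nonneg _
  rw [h1]
  calc (1 + t ^ 2 * ∫ w, g w ^ 2 ∂P) ^ n ≤ (Real.exp (t ^ 2 * B ^ 2)) ^ n := by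
        refine pow_le_pow_left₀ (by positivity) ?_ n
        have := Real.add_one_le_exp (t ^ 2 * B ^ 2)
        nlinarith [mul_le_mul_of_nonneg_left h2 (sq_nonneg t)]
    _ = Real.exp ((n * t ^ 2) * B ^ 2) := by rw [← Real.exp_nat_mul]; congr 1; ring
    _ ≤ Real.exp (B ^ 2) := by
        refine Real.exp_le_exp.2 ?_
        nlinarith [mul_le_mul_of_nonneg_right hn (sq_nonneg B)]

theorem integrable_tiltLik_sq (hg : Measurable g) (hB : ∀ w, |g w| ≤ B) (ht : 0 ≤ t)
    (htB : t * B ≤ 1 / 2) (n : ℕ) :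
    MemLp (fun w => tiltLik g t w) 2 (Measure.pi fun _ : Fin n => P) := by
  refine MemLp.of_bound (measurable_tiltLik hg n).aestronglyMeasurable (2 ^ n)
    (ae_of_all _ fun w => ?_)
  rw [Real.norm_of_nonneg (tiltLik_nonneg hB ht htB w)]
  calc tiltLik g t w ≤ ∏ _i : Fin n, (2 : ℝ) :=
        Finset.prod_le_prod (fun i _ => by linarith [half_le_one_add_mul hB ht htB (w i)])
          fun i _ => one_add_mul_le_two hB ht htB (w i)
    _ = 2 ^ n := by simp

/-- Contiguity of product measures of tilted laws. -/
theorem pi_tilt_real_le (hg : Measurable g) (hB : ∀ w, |g w| ≤ B) (h0 : ∫ w, g w ∂P = 0)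
    (ht : 0 ≤ t) (htB : t * B ≤ 1 / 2) [IsProbabilityMeasure (tilt P g t)] {n : ℕ}
    (hn : n * t ^ 2 ≤ 1) {s : Set (Fin n → 𝒲)} (hs : MeasurableSet s) :
    (Measure.pi fun _ : Fin n => tilt P g t).real s ≤
      √((Measure.pi fun _ : Fin n => P).real s) * √(Real.exp (B ^ 2)) := by
  set ν := Measure.pi fun _ : Fin n => P
  have hL := integrable_tiltLik_sq (P := P) hg hB ht htB n
  have h1 : (Measure.pi fun _ : Fin n => tilt P g t).real s
      = ∫ w, s.indicator 1 w * tiltLik g t w ∂ν := by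
    rw [measureReal_def, pi_tilt hg hB ht htB, withDensity_apply _ hs,
      ← integral_eq_lintegral_of_nonneg_ae (ae_of_all _ fun w => tiltLik_nonneg hB ht htB w)
        (measurable_tiltLik hg n).aestronglyMeasurable, ← integral_indicator hs]
    congr 1; ext w
    by_cases hw : w ∈ s <;> simp [hw]
  have hI : MemLp (s.indicator (1 : (Fin n → 𝒲) → ℝ)) 2 ν := (memLp_const (1 : ℝ)).indicator hs
  rw [h1]
  -- Cauchy-Schwarz between the indicator of the event and the likelihood ratio; the bounded second
  -- moment of the latter is all that contiguity needs here.
  refine (le_abs_self _).trans ((abs_integral_mul_le_sqrt_mul_sqrt hI hL).trans ?_)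
  have h2 : ∫ w, s.indicator (1 : (Fin n → 𝒲) → ℝ) w ^ 2 ∂ν = ν.real s := by
    rw [← integral_indicator_one hs]
    congr 1; ext w
    by_cases hw : w ∈ s <;> simp [hw]
  rw [h2]
  gcongr
  exact integral_tiltLik_sq_le hg hB h0 hn

end LeCam

/-! ### Limit law of sums under local alternatives -/

section LocalAlternatives

variable {𝒲 : Type*} [MeasurableSpace 𝒲] {P : Measure 𝒲} [IsProbabilityMeasure P]
  {g ψ : 𝒲 → ℝ} {B : ℝ}

open Complex in
-- Second order Taylor expansion at `0` of the characteristic function of `ψ`, evaluated at `u /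
-- √n`. Two moments make the remainder `o(1/n)`, and the linear term vanishes by centring.
theorem tendsto_charFun_second_order (hψm : Measurable ψ) (hψ : MemLp ψ 2 P)
    (hψ0 : ∫ w, ψ w ∂P = 0) (u : ℝ) :
    Tendsto (fun n : ℕ => (n : ℂ) *
      (∫ w, cexp ((u * (√n)⁻¹ * ψ w : ℝ) * I) ∂P - 1)) atTop
      (𝓝 (-((∫ w, ψ w ^ 2 ∂P : ℝ) * u ^ 2 / 2))) := by
  have hmem : MemLp id 2 (P.map ψ) := by
    rw [memLp_map_measure_iff aestronglyMeasurable_id hψm.aemeasurable]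
    exact hψ
  have : IsProbabilityMeasure (P.map ψ) := Measure.isProbabilityMeasure_map hψm.aemeasurable
  have htay := taylor_isLittleO_univ (x₀ := 0) (contDiff_charFun (n := 2) hmem)
  have hlim : Tendsto (fun n : ℕ => u * (√(n : ℝ))⁻¹) atTop (𝓝 0) := by
    simpa using (tendsto_inv_atTop_zero.comp (Real.tendsto_sqrt_atTop.comp
      tendsto_natCast_atTop_atTop)).const_mul u
  have h1 := htay.comp_tendsto hlim
  have h2 : (fun n : ℕ => (u * (√(n : ℝ))⁻¹ - 0) ^ 2) =O[atTop] fun n : ℕ => (n : ℝ)⁻¹ := by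
    refine Asymptotics.IsBigO.of_bound (u ^ 2) (Eventually.of_forall fun n => le_of_eq ?_)
    rw [sub_zero, mul_pow, inv_pow, Real.sq_sqrt (Nat.cast_nonneg n), norm_mul, norm_pow,
      Real.norm_eq_abs, sq_abs]
  have h3 := h1.trans_isBigO h2
  have h4 : Tendsto (fun n : ℕ => (n : ℝ) • (charFun (P.map ψ) (u * (√(n : ℝ))⁻¹) -
      taylorWithinEval (charFun (P.map ψ)) 2 Set.univ 0 (u * (√(n : ℝ))⁻¹))) atTop (𝓝 0) := by
    simpa using h3.tendsto_inv_smul_nhds_zero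
  have h5 := h4.add_const (-((∫ w, ψ w ^ 2 ∂P : ℝ) * (u : ℂ) ^ 2 / 2))
  rw [zero_add] at h5
  refine h5.congr' ?_
  filter_upwards [eventually_ne_atTop 0] with n hn
  have hn' : (n : ℂ) ≠ 0 := by exact_mod_cast hn
  rw [taylorWithinEval_charFun_two_zero hψm.aemeasurable hmem, hψ0, charFun_apply_real,
    integral_map hψm.aemeasurable (by fun_prop)]
  have h6 : ((((√(n : ℝ))⁻¹ : ℝ) : ℂ)) ^ 2 = (n : ℂ)⁻¹ := by
    rw [← ofReal_pow, inv_pow, Real.sq_sqrt (Nat.cast_nonneg n)]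
    simp
  simp only [Complex.real_smul, ofReal_mul, mul_pow, h6, Pi.pow_apply, ofReal_natCast, ofReal_zero,
    zero_mul, add_zero]
  generalize ∫ w, cexp (_ : ℂ) ∂P = F
  field_simp
  ring

open Complex in
-- Since `g` is centred, `1` may be subtracted from the exponential. Then `√n (exp (i u ψ / √n) -
-- 1)` tends pointwise to `i u ψ` and is dominated by `|u| |ψ|`. This term produces the mean shift
-- under local alternatives.
theorem tendsto_charFun_cross (hg : Measurable g) (hB : ∀ w, |g w| ≤ B) (hψm : Measurable ψ)
    (hψ : MemLp ψ 2 P) (h0 : ∫ w, g w ∂P = 0) (u : ℝ) :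
    Tendsto (fun n : ℕ => (√(n : ℝ) : ℂ) *
      ∫ w, (g w : ℂ) * cexp ((u * (√n)⁻¹ * ψ w : ℝ) * I) ∂P) atTop
      (𝓝 (u * (∫ w, ψ w * g w ∂P : ℝ) * I)) := by
  have hψi : Integrable ψ P := hψ.integrable (by norm_num)
  have hgi := integrable_of_abs_le (P := P) hg hB
  have hlim : Tendsto (fun n : ℕ => ∫ w, (g w : ℂ) * ((√(n : ℝ) : ℂ) *
      (cexp ((u * (√n)⁻¹ * ψ w : ℝ) * I) - 1)) ∂P) atTop
      (𝓝 (∫ w, (g w : ℂ) * (u * ψ w * I) ∂P)) := by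
    refine tendsto_integral_of_dominated_convergence (fun w => B * (|u| * |ψ w|))
      (fun n => by fun_prop) ((hψi.abs.const_mul _).const_mul _)
      (fun n => ae_of_all _ fun w => ?_) (ae_of_all _ fun w => ?_)
    · rw [norm_mul, norm_mul, norm_real, norm_real, Real.norm_eq_abs, Real.norm_eq_abs,
        abs_of_nonneg (Real.sqrt_nonneg _), mul_comm (Complex.ofReal _) I]
      have h1 := Real.norm_exp_I_mul_ofReal_sub_one_le (x := u * (√(n : ℝ))⁻¹ * ψ w)
      have hB0 : 0 ≤ B := (abs_nonneg _).trans (hB w)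
      refine mul_le_mul (hB w) ?_ (by positivity) hB0
      calc √(n : ℝ) * ‖cexp (I * (u * (√(n : ℝ))⁻¹ * ψ w : ℝ)) - 1‖
          ≤ √(n : ℝ) * ‖u * (√(n : ℝ))⁻¹ * ψ w‖ := by gcongr
        _ = (√(n : ℝ) * (√(n : ℝ))⁻¹) * (|u| * |ψ w|) := by
            rw [norm_mul, norm_mul, Real.norm_eq_abs, Real.norm_eq_abs, Real.norm_eq_abs,
              abs_of_nonneg (inv_nonneg.2 (Real.sqrt_nonneg (n : ℝ)))]
            ring
        _ ≤ 1 * (|u| * |ψ w|) := by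
            gcongr
            exact mul_inv_le_one
        _ = _ := one_mul _
    · refine Tendsto.const_mul _ ?_
      have hd : HasDerivAt (fun x : ℝ => cexp ((u * x * ψ w : ℝ) * I)) (u * ψ w * I) 0 := by
        have h1 : HasDerivAt (fun x : ℝ => ((u * x * ψ w : ℝ) : ℂ)) ((u * 1 * ψ w : ℝ) : ℂ) 0 :=
          (((hasDerivAt_id (0 : ℝ)).const_mul u).mul_const (ψ w)).ofReal_comp
        have h2 := (h1.mul_const I).cexp
        simpa using h2
      have hs := hd.tendsto_slope_zero_right
      have hinv : Tendsto (fun n : ℕ => (√(n : ℝ))⁻¹) atTop (𝓝[>] 0) :=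
        tendsto_inv_atTop_nhdsGT_zero.comp (Real.tendsto_sqrt_atTop.comp
          tendsto_natCast_atTop_atTop)
      refine (hs.comp hinv).congr fun n => ?_
      simp
  have hrhs : ∫ w, (g w : ℂ) * (u * ψ w * I) ∂P = u * (∫ w, ψ w * g w ∂P : ℝ) * I := by
    rw [← integral_complex_ofReal, ← integral_const_mul, ← integral_mul_const]
    congr 1; ext w; push_cast; ring
  rw [hrhs] at hlim
  refine hlim.congr fun n => ?_
  have hint : Integrable (fun w => (g w : ℂ) * cexp ((u * (√n)⁻¹ * ψ w : ℝ) * I)) P := by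
    refine Integrable.of_bound (by fun_prop) B (ae_of_all _ fun w => ?_)
    rw [norm_mul, norm_exp_ofReal_mul_I, mul_one, norm_real]
    exact hB w
  have hg0 : ∫ w, (g w : ℂ) ∂P = 0 := by rw [integral_complex_ofReal, h0, ofReal_zero]
  have h7 : ∀ w, (g w : ℂ) * ((√(n : ℝ) : ℂ) * (cexp ((u * (√n)⁻¹ * ψ w : ℝ) * I) - 1))
      = (√(n : ℝ) : ℂ) * ((g w : ℂ) * cexp ((u * (√n)⁻¹ * ψ w : ℝ) * I) - (g w : ℂ)) :=
    fun w => by ring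
  have hgi' : Integrable (fun w => (g w : ℂ)) P := hgi.ofReal
  simp only [h7]
  rw [integral_const_mul, integral_sub hint hgi', hg0, sub_zero]

open Complex in
/-- The characteristic function of a normalized sum under local alternatives. -/
theorem tendsto_integral_exp_sum_pi_tilt (hg : Measurable g) (hB : ∀ w, |g w| ≤ B)
    (hψm : Measurable ψ) (hψ : MemLp ψ 2 P) (hψ0 : ∫ w, ψ w ∂P = 0) (h0 : ∫ w, g w ∂P = 0)
    (u : ℝ) (Q : ℕ → Measure 𝒲) [∀ n, IsProbabilityMeasure (Q n)]
    (hQ : ∀ᶠ n : ℕ in atTop, 1 / √(n : ℝ) * B ≤ 1 / 2 ∧ Q n = tilt P g (1 / √(n : ℝ))) :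
    Tendsto (fun n : ℕ => ∫ w, cexp ((u * ((√n)⁻¹ * ∑ i, ψ (w i)) : ℝ) * I)
      ∂(Measure.pi fun _ : Fin n => Q n)) atTop
      (𝓝 (cexp (-((∫ w, ψ w ^ 2 ∂P : ℝ) * u ^ 2 / 2) + u * (∫ w, ψ w * g w ∂P : ℝ) * I))) := by
  have hadd := (tendsto_charFun_second_order hψm hψ hψ0 u).add
    (tendsto_charFun_cross hg hB hψm hψ h0 u)
  have hf : Tendsto (fun n : ℕ => (n : ℂ) * (∫ w, cexp ((u * (√n)⁻¹ * ψ w : ℝ) * I)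
      ∂(Q n) - 1)) atTop
      (𝓝 (-((∫ w, ψ w ^ 2 ∂P : ℝ) * u ^ 2 / 2) + u * (∫ w, ψ w * g w ∂P : ℝ) * I)) := by
    -- The density `1 + g / √n` splits the integral into the null part and a part carrying `1 / √n`;
    -- multiplied by `n`, the latter has the factor `√n` of the cross term.
    refine hadd.congr' ?_
    filter_upwards [hQ, eventually_ne_atTop 0] with n hn hn0
    rw [hn.2, integral_tilt hg hB (by positivity) hn.1]
    have i1 : Integrable (fun w => cexp ((u * (√n)⁻¹ * ψ w : ℝ) * I)) P :=
      Integrable.of_bound (by fun_prop) 1 (ae_of_all _ fun w => by rw [norm_exp_ofReal_mul_I])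
    have i2 : Integrable (fun w => (g w : ℂ) * cexp ((u * (√n)⁻¹ * ψ w : ℝ) * I)) P := by
      refine Integrable.of_bound (by fun_prop) B (ae_of_all _ fun w => ?_)
      rw [norm_mul, norm_exp_ofReal_mul_I, mul_one, norm_real]
      exact hB w
    have h1 : ∀ w, ((1 + 1 / √(n : ℝ) * g w : ℝ)) • cexp ((u * (√n)⁻¹ * ψ w : ℝ) * I)
        = cexp ((u * (√n)⁻¹ * ψ w : ℝ) * I) + ((√(n : ℝ))⁻¹ : ℝ) *
          ((g w : ℂ) * cexp ((u * (√n)⁻¹ * ψ w : ℝ) * I)) := by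
      intro w
      rw [Complex.real_smul]
      push_cast
      ring
    simp only [h1]
    rw [integral_add i1 (i2.const_mul _), integral_const_mul]
    have h2 : (n : ℂ) * (((√(n : ℝ))⁻¹ : ℝ) : ℂ) = (√(n : ℝ) : ℂ) := by
      have : (n : ℝ) * (√(n : ℝ))⁻¹ = √(n : ℝ) := by
        rw [← div_eq_mul_inv, Real.div_sqrt]
      rw [← ofReal_natCast, ← ofReal_mul, this]
    rw [← h2]
    ring
  refine (tendsto_one_add_pow_exp_of_tendsto hf).congr fun n => ?_
  rw [add_sub_cancel]
  have h3 : ∀ w : Fin n → 𝒲, cexp ((u * ((√n)⁻¹ * ∑ i, ψ (w i)) : ℝ) * I)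
      = ∏ i, cexp ((u * (√n)⁻¹ * ψ (w i) : ℝ) * I) := by
    intro w
    rw [← Complex.exp_sum, ← Finset.sum_mul, ← ofReal_sum, ← Finset.mul_sum, mul_assoc]
  simp only [h3]
  rw [integral_fintype_prod_eq_pow (fun x => cexp ((u * (√n)⁻¹ * ψ x : ℝ) * I)), Fintype.card_fin]

open Complex in
-- A quantitative Slutsky step: where the variables are `ε`-close the exponential is
-- `|u|`-Lipschitz, elsewhere the difference is at most `2`.
theorem norm_integral_exp_sub_le {Ω : Type*} [MeasurableSpace Ω] {μ : Measure Ω}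
    [IsProbabilityMeasure μ] {X Y : Ω → ℝ} (hX : Measurable X) (hY : Measurable Y) (u : ℝ) {ε : ℝ}
    (hε : 0 ≤ ε) :
    ‖∫ ω, cexp ((u * X ω : ℝ) * I) ∂μ - ∫ ω, cexp ((u * Y ω : ℝ) * I) ∂μ‖
      ≤ |u| * ε + 2 * μ.real {ω | ε ≤ |X ω - Y ω|} := by
  have i : ∀ {Z : Ω → ℝ}, Measurable Z → Integrable (fun ω => cexp ((u * Z ω : ℝ) * I)) μ :=
    fun hZ => Integrable.of_bound (by fun_prop) 1 (ae_of_all _ fun w => by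
      rw [norm_exp_ofReal_mul_I])
  set S := {ω | ε ≤ |X ω - Y ω|} with hS
  have mS : MeasurableSet S := measurableSet_le measurable_const (hX.sub hY).abs
  rw [← integral_sub (i hX) (i hY)]
  have h1 : ∀ ω, ‖cexp ((u * X ω : ℝ) * I) - cexp ((u * Y ω : ℝ) * I)‖
      ≤ |u| * ε + S.indicator (fun _ => (2 : ℝ)) ω := by
    intro ω
    by_cases hω : ω ∈ S
    · rw [Set.indicator_of_mem hω]
      refine (norm_sub_le _ _).trans ?_
      rw [norm_exp_ofReal_mul_I, norm_exp_ofReal_mul_I]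
      nlinarith [mul_nonneg (abs_nonneg u) hε]
    · rw [Set.indicator_of_notMem hω, add_zero]
      have h2 : cexp ((u * X ω : ℝ) * I) - cexp ((u * Y ω : ℝ) * I)
          = cexp ((u * Y ω : ℝ) * I) * (cexp (I * (u * (X ω - Y ω) : ℝ)) - 1) := by
        rw [mul_sub, ← Complex.exp_add, mul_one]
        congr 2
        push_cast; ring
      rw [h2, norm_mul, norm_exp_ofReal_mul_I, one_mul]
      refine Real.norm_exp_I_mul_ofReal_sub_one_le.trans ?_
      rw [Real.norm_eq_abs, abs_mul]
      gcongr
      exact (not_le.1 hω).le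
  refine (norm_integral_le_integral_norm _).trans ?_
  calc _ ≤ ∫ ω, (|u| * ε + S.indicator (fun _ => (2 : ℝ)) ω) ∂μ :=
        integral_mono ((i hX).sub (i hY)).norm
          ((integrable_const _).add ((integrable_const _).indicator mS)) h1
    _ = |u| * ε + 2 * μ.real S := by
        rw [integral_add (integrable_const _) ((integrable_const _).indicator mS),
          integral_indicator mS]
        simp [mul_comm]

/-! ### Regular asymptotically linear estimators -/

variable {𝓜 : Set (ProbabilityMeasure 𝒲)} {e : 𝒲 → ℝ} {ϑ : ProbabilityMeasure 𝒲 → ℝ}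
  {T : ∀ n : ℕ, (Fin n → 𝒲) → ℝ}

theorem IsRAL.congr {P : ProbabilityMeasure 𝒲} {ψ' : 𝒲 → ℝ} (hT : IsRAL 𝓜 e ϑ P T ψ)
    (h : ψ =ᵐ[(P : Measure 𝒲)] ψ') : IsRAL 𝓜 e ϑ P T ψ' where
  measurable := hT.measurable
  memLp := (memLp_congr_ae h).1 hT.memLp
  mean_zero := by rw [← integral_congr_ae h, hT.mean_zero]
  regular := hT.regular
  asymptoticallyLinear ε hε := by
    refine (hT.asymptoticallyLinear ε hε).congr fun n => measure_congr ?_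
    have : ∀ᵐ w ∂(Measure.pi fun _ : Fin n => (P : Measure 𝒲)), ∀ i, ψ (w i) = ψ' (w i) :=
      eventually_all.2 fun i => (Measure.tendsto_eval_ae_ae
        (μ := fun _ : Fin n => (P : Measure 𝒲)) (i := i)).eventually h
    filter_upwards [this] with w hw
    refine propext ?_
    change (ε ≤ _) ↔ (ε ≤ _)
    simp only [hw]

open Complex in
/-- Along the linear path with score `g`, the limit law of a regular asymptotically linear
estimator has characteristic function
`exp (-σ² u² / 2 + i u (E[ψ g] - c))`, where `c` is the derivative of the functional. -/
theorem IsRAL.charFun_eq {P : ProbabilityMeasure 𝒲} (hT : IsRAL 𝓜 e ϑ P T ψ)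
    (hψm : Measurable ψ) (hg : Measurable g) (hB : ∀ w, |g w| ≤ B)
    (h0 : ∫ w, g w ∂(P : Measure 𝒲) = 0) {Q : ℝ → ProbabilityMeasure 𝒲}
    (hQt : ∀ᶠ t in 𝓝[>] (0 : ℝ), t * B ≤ 1 / 2 ∧ (Q t : Measure 𝒲) = tilt (P : Measure 𝒲) g t)
    {c : ℝ} (hc : Tendsto (fun t : ℝ => (ϑ (Q t) - ϑ P) / t) (𝓝[>] 0) (𝓝 c))
    {L : ProbabilityMeasure ℝ}
    (hL : TendstoInDistribution
      (fun (n : ℕ) (w : Fin n → 𝒲) => √(n : ℝ) * (T n w - ϑ (Q (1 / √(n : ℝ)))))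
      atTop (id : ℝ → ℝ)
      (fun n : ℕ => Measure.pi fun _ : Fin n => (Q (1 / √(n : ℝ)) : Measure 𝒲))
      (L : Measure ℝ)) (u : ℝ) :
    charFun (L : Measure ℝ) u = cexp (-((∫ w, ψ w ^ 2 ∂(P : Measure 𝒲) : ℝ) * u ^ 2 / 2)
      + u * (∫ w, ψ w * g w ∂(P : Measure 𝒲) - c : ℝ) * I) := by
  have hinv : Tendsto (fun n : ℕ => 1 / √(n : ℝ)) atTop (𝓝[>] 0) := by
    simpa [Function.comp_def] using tendsto_inv_atTop_nhdsGT_zero.comp (Real.tendsto_sqrt_atTop.comp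
      tendsto_natCast_atTop_atTop)
  have hQn := hinv.eventually hQt
  have hcn : Tendsto (fun n : ℕ => √(n : ℝ) * (ϑ (Q (1 / √(n : ℝ))) - ϑ P)) atTop (𝓝 c) := by
    refine (hc.comp hinv).congr fun n => ?_
    simp [mul_comm]
  set ν : ∀ n : ℕ, Measure (Fin n → 𝒲) :=
    fun n => Measure.pi fun _ : Fin n => (Q (1 / √(n : ℝ)) : Measure 𝒲) with hν
  set X : ∀ n : ℕ, (Fin n → 𝒲) → ℝ := fun n w => √(n : ℝ) * (T n w - ϑ (Q (1 / √(n : ℝ))))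
  -- The linear expansion recentred at the alternative: `X n - Y n` is exactly the remainder in
  -- asymptotic linearity at `P`, while the recentring constant tends to `c`.
  set Y : ∀ n : ℕ, (Fin n → 𝒲) → ℝ := fun n w => (√(n : ℝ))⁻¹ * ∑ i, ψ (w i)
    - √(n : ℝ) * (ϑ (Q (1 / √(n : ℝ))) - ϑ P)
  have hXm : ∀ n, Measurable (X n) := fun n => ((hT.measurable n).sub_const _).const_mul _
  have hSm : ∀ n : ℕ, Measurable fun w : Fin n → 𝒲 => (√(n : ℝ))⁻¹ * ∑ i, ψ (w i) := fun n =>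
    (Finset.measurable_fun_sum _ fun i _ => hψm.comp (measurable_pi_apply i)).const_mul _
  have hYm : ∀ n, Measurable (Y n) := fun n => (hSm n).sub_const _
  have hXlim : Tendsto (fun n => ∫ w, cexp ((u * X n w : ℝ) * I) ∂(ν n)) atTop
      (𝓝 (charFun (L : Measure ℝ) u)) := by
    have h1 := (ProbabilityMeasure.tendsto_iff_tendsto_charFun.1 hL.tendsto) u
    simp only [ProbabilityMeasure.coe_mk, Measure.map_id] at h1
    refine h1.congr fun n => ?_
    rw [charFun_apply_real, integral_map (hXm n).aemeasurable (by fun_prop)]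
    simp only [ofReal_mul, hν]
  have hYlim : Tendsto (fun n => ∫ w, cexp ((u * Y n w : ℝ) * I) ∂(ν n)) atTop
      (𝓝 (cexp (-((∫ w, ψ w ^ 2 ∂(P : Measure 𝒲) : ℝ) * u ^ 2 / 2)
        + u * (∫ w, ψ w * g w ∂(P : Measure 𝒲) - c : ℝ) * I))) := by
    have h1 := tendsto_integral_exp_sum_pi_tilt hg hB hψm hT.memLp hT.mean_zero h0 u
      (fun n : ℕ => (Q (1 / √(n : ℝ)) : Measure 𝒲)) hQn
    have h2 : Tendsto (fun n : ℕ => cexp (-(u * (√(n : ℝ) * (ϑ (Q (1 / √(n : ℝ))) - ϑ P)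
        : ℝ)) * I)) atTop (𝓝 (cexp (-(u * c) * I))) := by
      have h3 := (((continuous_ofReal.tendsto c).comp hcn).const_mul (u : ℂ)).neg.mul_const I
      exact (Complex.continuous_exp.tendsto _).comp h3
    have h4 := h1.mul h2
    rw [← Complex.exp_add] at h4
    have h5 : (-((∫ w, ψ w ^ 2 ∂(P : Measure 𝒲) : ℝ) * u ^ 2 / 2)
        + u * (∫ w, ψ w * g w ∂(P : Measure 𝒲) - c : ℝ) * I : ℂ)
        = -((∫ w, ψ w ^ 2 ∂(P : Measure 𝒲) : ℝ) * u ^ 2 / 2)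
          + u * (∫ w, ψ w * g w ∂(P : Measure 𝒲) : ℝ) * I + -(u * c) * I := by
      push_cast; ring
    rw [h5]
    refine h4.congr fun n => ?_
    rw [← integral_mul_const]
    congr 1; ext w
    rw [← Complex.exp_add]
    congr 1
    simp only [Y]
    push_cast; ring
  have hdiff : Tendsto (fun n => ∫ w, cexp ((u * X n w : ℝ) * I) ∂(ν n)
      - ∫ w, cexp ((u * Y n w : ℝ) * I) ∂(ν n)) atTop (𝓝 0) := by
    rw [Metric.tendsto_nhds]
    intro ε hε
    set κ := ε / (2 * (|u| + 1)) with hκ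
    have hκ0 : 0 < κ := by positivity
    have hal := (ENNReal.tendsto_toReal ENNReal.zero_ne_top).comp (hT.asymptoticallyLinear κ hκ0)
    have hbd : Tendsto (fun n : ℕ => 2 * (√((Measure.pi fun _ : Fin n => (P : Measure 𝒲)).real
        {w | κ ≤ |√(n : ℝ) * (T n w - ϑ P) - (√(n : ℝ))⁻¹ * ∑ i, ψ (w i)|})
        * √(Real.exp (B ^ 2)))) atTop (𝓝 0) := by
      have := (((Real.continuous_sqrt.tendsto _).comp hal).mul_const √(Real.exp (B ^ 2))).const_mul
        2
      simpa [measureReal_def] using this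
    filter_upwards [hbd.eventually_lt_const (half_pos hε), hQn, hinv.eventually self_mem_nhdsWithin]
      with n h1 h2 h3
    rw [dist_zero_right]
    have h3' : 0 ≤ 1 / √(n : ℝ) := le_of_lt h3
    refine (norm_integral_exp_sub_le (hXm n) (hYm n) u hκ0.le).trans_lt ?_
    have hset : {w | κ ≤ |X n w - Y n w|}
        = {w | κ ≤ |√(n : ℝ) * (T n w - ϑ P) - (√(n : ℝ))⁻¹ * ∑ i, ψ (w i)|} := by
      ext w
      simp only [X, Y, Set.mem_ofPred_eq]
      rw [show √(n : ℝ) * (T n w - ϑ (Q (1 / √(n : ℝ)))) - ((√(n : ℝ))⁻¹ * ∑ i, ψ (w i)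
        - √(n : ℝ) * (ϑ (Q (1 / √(n : ℝ))) - ϑ P))
        = √(n : ℝ) * (T n w - ϑ P) - (√(n : ℝ))⁻¹ * ∑ i, ψ (w i) by ring]
    -- Asymptotic linearity is known only under `P`; contiguity carries the negligible remainder
    -- over to the local alternatives.
    have hcont : (ν n).real {w | κ ≤ |X n w - Y n w|} ≤
        √((Measure.pi fun _ : Fin n => (P : Measure 𝒲)).real {w | κ ≤ |X n w - Y n w|})
          * √(Real.exp (B ^ 2)) := by
      have hpr : IsProbabilityMeasure (tilt (P : Measure 𝒲) g (1 / √(n : ℝ))) := by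
        rw [← h2.2]; infer_instance
      have hn : (n : ℝ) * (1 / √(n : ℝ)) ^ 2 ≤ 1 := by
        rw [one_div, inv_pow, Real.sq_sqrt (Nat.cast_nonneg n)]
        exact mul_inv_le_one
      have hmS : MeasurableSet {w | κ ≤ |X n w - Y n w|} :=
        measurableSet_le measurable_const ((hXm n).sub (hYm n)).abs
      simp only [hν, h2.2]
      exact pi_tilt_real_le hg hB h0 h3' h2.1 hn hmS
    have hu : |u| * κ ≤ ε / 2 := by
      rw [hκ, mul_div_assoc', div_le_iff₀ (by positivity)]
      nlinarith [abs_nonneg u]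
    rw [← hset] at h1
    linarith
  have := hdiff.add hYlim
  simp only [sub_add_cancel, zero_add] at this
  exact tendsto_nhds_unique hXlim this

open Complex in
theorem eq_zero_of_forall_exp_mul_I_eq_one {c : ℝ} (h : ∀ u : ℝ, cexp (u * c * I) = 1) :
    c = 0 := by
  by_contra hc
  have h1 := h (Real.pi / c)
  rw [← ofReal_mul, div_mul_cancel₀ _ hc, Complex.exp_pi_mul_I] at h1
  norm_num at h1

/-- The influence function of a regular asymptotically linear estimator represents the derivative
of the functional along linear paths. -/
theorem IsRAL.integral_mul_eq {P : ProbabilityMeasure 𝒲} (hT : IsRAL 𝓜 e ϑ P T ψ)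
    (hP : P ∈ 𝓜) (he : MemLp e 2 (P : Measure 𝒲)) (hg : Measurable g) (hB : ∀ w, |g w| ≤ B)
    (h0 : ∫ w, g w ∂(P : Measure 𝒲) = 0) {Q : ℝ → ProbabilityMeasure 𝒲}
    (hQ : IsRegularSubmodel 𝓜 e P Q g)
    (hQt : ∀ᶠ t in 𝓝[>] (0 : ℝ), t * B ≤ 1 / 2 ∧ (Q t : Measure 𝒲) = tilt (P : Measure 𝒲) g t)
    {c : ℝ} (hc : Tendsto (fun t : ℝ => (ϑ (Q t) - ϑ P) / t) (𝓝[>] 0) (𝓝 c)) :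
    ∫ w, ψ w * g w ∂(P : Measure 𝒲) = c := by
  wlog hψm : Measurable ψ generalizing ψ
  · obtain ⟨ψ', hψ', hψψ'⟩ := hT.memLp.aestronglyMeasurable.aemeasurable
    rw [← this (hT.congr hψψ') hψ']
    exact integral_congr_ae (hψψ'.mono fun w hw => by simp only [hw])
  obtain ⟨L, hL⟩ := hT.regular
  have htilt0 : ∀ t, tilt (P : Measure 𝒲) (fun _ => 0) t = P := by
    intro t; simp [tilt]
  -- The constant path is the reference: regularity forces the same limit law along it and along
  -- `Q`. Dividing the two characteristic functions leaves a pure phase that equals `1` for all `u`.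
  obtain ⟨Q₀, hQ₀, hQ₀t⟩ := exists_isRegularSubmodel_tilt (e := e) (g := fun _ => 0) (B := 0) hP
    measurable_const (by simp) (by simp) he one_pos fun t _ _ _ R hR => by
      rw [htilt0] at hR; rwa [Subtype.ext hR]
  have hc0 : Tendsto (fun t : ℝ => (ϑ (Q₀ t) - ϑ P) / t) (𝓝[>] 0) (𝓝 0) := by
    refine tendsto_const_nhds.congr' ?_
    filter_upwards [hQ₀t] with t ht
    rw [htilt0] at ht
    rw [show Q₀ t = P from Subtype.ext ht.2]
    simp
  have e0 := fun u => hT.charFun_eq hψm measurable_const (by simp) (by simp) hQ₀t hc0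
    (hL Q₀ _ hQ₀) u
  have e1 := fun u => hT.charFun_eq hψm hg hB h0 hQt hc (hL Q g hQ) u
  have := eq_zero_of_forall_exp_mul_I_eq_one (c := ∫ w, ψ w * g w ∂(P : Measure 𝒲) - c)
    fun u => by
      have h2 := (e1 u).symm.trans (e0 u)
      simp only [mul_zero, integral_zero, sub_zero, Complex.ofReal_zero, zero_mul, add_zero] at h2
      rw [Complex.exp_add] at h2
      exact mul_left_cancel₀ (Complex.exp_ne_zero _) (h2.trans (mul_one _).symm)
  linarith

end LocalAlternatives

/-! ### Measurability of the observed variables -/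

theorem ind_nonneg (b : Bool) : 0 ≤ ind b := by cases b <;> simp [ind]

theorem ind_le_one (b : Bool) : ind b ≤ 1 := by cases b <;> simp [ind]

theorem ind_mul_self (b : Bool) : ind b * ind b = ind b := by cases b <;> simp [ind]

theorem abs_ind_le_one (b : Bool) : |ind b| ≤ 1 := by cases b <;> simp [ind]

theorem measurable_ind : Measurable ind := Measurable.of_discrete

theorem integral_mul_condExp {Ω : Type*} {m m₀ : MeasurableSpace Ω} {μ : Measure Ω}
    [IsFiniteMeasure μ] (hm : m ≤ m₀) {f g : Ω → ℝ} (hf : StronglyMeasurable[m] f)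
    (hfg : Integrable (fun ω => f ω * g ω) μ) (hg : Integrable g μ) :
    ∫ ω, f ω * (μ[g | m]) ω ∂μ = ∫ ω, f ω * g ω ∂μ := by
  have h := condExp_mul_of_stronglyMeasurable_left (m := m) hf hfg hg
  rw [← integral_condExp hm (f := fun ω => f ω * g ω)]
  exact (integral_congr_ae h).symm

section Observed

variable {d k l : ℕ}

namespace Obs

theorem measurable_outcome : Measurable (outcome : Obs d k l → ℝ) := measurable_fst
theorem measurable_treat : Measurable (treat : Obs d k l → Bool) :=
  measurable_fst.comp measurable_snd
theorem measurable_covs : Measurable (covs : Obs d k l → Fin d → ℝ) :=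
  measurable_fst.comp (measurable_snd.comp measurable_snd)
theorem measurable_instr : Measurable (instr : Obs d k l → ℝ) :=
  measurable_fst.comp (measurable_snd.comp (measurable_snd.comp measurable_snd))
theorem measurable_annot : Measurable (annot : Obs d k l → Bool) :=
  measurable_fst.comp (measurable_snd.comp (measurable_snd.comp
    (measurable_snd.comp measurable_snd)))
theorem measurable_annotCovs : Measurable (annotCovs : Obs d k l → Fin k → ℝ) :=
  measurable_fst.comp (measurable_snd.comp (measurable_snd.comp
    (measurable_snd.comp (measurable_snd.comp measurable_snd))))
theorem measurable_unstr : Measurable (unstr : Obs d k l → Fin l → ℝ) :=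
  measurable_snd.comp (measurable_snd.comp (measurable_snd.comp
    (measurable_snd.comp (measurable_snd.comp measurable_snd))))
theorem measurable_feat : Measurable (feat : Obs d k l → Feat d k l) :=
  measurable_annotCovs.prodMk (measurable_unstr.prodMk (measurable_instr.prodMk measurable_covs))

end Obs

/-- The residualized instrument as a function of the features. -/
def featResid (γ : Fin d → ℝ) (x : Feat d k l) : ℝ := x.2.2.1 - ∑ j, γ j * x.2.2.2 j

theorem resid_eq_featResid (γ : Fin d → ℝ) (w : Obs d k l) : w.resid γ = featResid γ w.feat := rfl

theorem measurable_featResid (γ : Fin d → ℝ) :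
    Measurable (featResid γ : Feat d k l → ℝ) := by
  unfold featResid; fun_prop

theorem measurable_resid (γ : Fin d → ℝ) : Measurable fun w : Obs d k l => w.resid γ :=
  (measurable_featResid γ).comp Obs.measurable_feat

theorem measurable_ind_annot : Measurable fun w : Obs d k l => ind w.annot :=
  measurable_ind.comp Obs.measurable_annot

theorem measurable_ind_treat : Measurable fun w : Obs d k l => ind w.treat :=
  measurable_ind.comp Obs.measurable_treat

theorem measurable_momentFun (γ : Fin d → ℝ) : Measurable (momentFun γ : Obs d k l → ℝ) :=
  (measurable_resid γ).abs.mul (Obs.measurable_outcome.abs.const_add 1)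

theorem measurable_imputationFun (Q : Measure (Obs d k l)) : Measurable (imputationFun Q) :=
  (StronglyMeasurable.integral_condDistrib (X := Obs.feat) (Y := Obs.treat)
    (μ := Q[|{w | w.annot = true}])
    (measurable_ind.comp measurable_snd).stronglyMeasurable (f := fun p => ind p.2)).measurable

theorem imputationFun_nonneg (Q : Measure (Obs d k l)) (x : Feat d k l) : 0 ≤ imputationFun Q x :=
  integral_nonneg fun m => ind_nonneg m

theorem imputationFun_le_one (Q : Measure (Obs d k l)) (x : Feat d k l) :
    imputationFun Q x ≤ 1 := by
  refine (integral_mono_of_nonneg (ae_of_all _ fun m => ind_nonneg m) (integrable_const 1)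
    (ae_of_all _ fun m => ind_le_one m)).trans ?_
  simp

theorem abs_imputationFun_le_one (Q : Measure (Obs d k l)) (x : Feat d k l) :
    |imputationFun Q x| ≤ 1 :=
  abs_le.2 ⟨by linarith [imputationFun_nonneg Q x], imputationFun_le_one Q x⟩

theorem measurable_pseudoTreat {π : (Fin k → ℝ) → ℝ} (hπ : Measurable π) {f : Feat d k l → ℝ}
    (hf : Measurable f) : Measurable (pseudoTreat π f : Obs d k l → ℝ) := by
  have h1 := hf.comp (Obs.measurable_feat (d := d) (k := k) (l := l))
  exact h1.add ((measurable_ind_annot.div (hπ.comp Obs.measurable_annotCovs)).mul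
    (measurable_ind_treat.sub h1))

/-! ### Laws with known annotation score -/

/-- `π` is the conditional probability of annotation given the features under `Q`. -/
def HasScore (π : (Fin k → ℝ) → ℝ) (Q : Measure (Obs d k l)) : Prop :=
  Q[fun w => ind w.annot | MeasurableSpace.comap Obs.feat inferInstance] =ᵐ[Q]
    fun w => π w.annotCovs

variable {π : (Fin k → ℝ) → ℝ} {γ : Fin d → ℝ} {η : ℝ} {Q : Measure (Obs d k l)}

theorem integrable_ind_annot [IsProbabilityMeasure Q] : Integrable (fun w : Obs d k l => ind
    w.annot) Q :=
  integrable_of_abs_le measurable_ind_annot fun _ => abs_ind_le_one _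

theorem integrable_ind_annot_mul {f : Obs d k l → ℝ} (hf : Integrable f Q) :
    Integrable (fun w => ind w.annot * f w) Q :=
  hf.bdd_mul measurable_ind_annot.aestronglyMeasurable (ae_of_all _ fun _ => abs_ind_le_one _)

theorem integrable_ind_treat_mul {f : Obs d k l → ℝ} (hf : Integrable f Q) :
    Integrable (fun w => f w * ind w.treat) Q :=
  hf.mul_bdd measurable_ind_treat.aestronglyMeasurable (ae_of_all _ fun _ => abs_ind_le_one _)

/-- Annotation may be replaced by the annotation score in moments of the features. -/
theorem HasScore.integral_mul [IsProbabilityMeasure Q] (hQ : HasScore π Q) {F : Feat d k l → ℝ} (hF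
    : Measurable F)
    (hFi : Integrable (fun w : Obs d k l => F w.feat) Q) :
    ∫ w, ind w.annot * F w.feat ∂Q = ∫ w, π w.annotCovs * F w.feat ∂Q := by
  have h1 := integral_mul_condExp (μ := Q) Obs.measurable_feat.comap_le
    (f := fun w => F w.feat) (g := fun w => ind w.annot)
    (hF.comp (comap_measurable Obs.feat)).stronglyMeasurable
    (by simpa only [mul_comm] using integrable_ind_annot_mul hFi) integrable_ind_annot
  simp only [mul_comm (ind _), ← h1, mul_comm (π _)]
  refine integral_congr_ae ?_
  filter_upwards [hQ] with w hw
  rw [hw]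

/-- The annotated treatment may be replaced by the imputation function on annotated units. -/
theorem integral_annot_mul_treat [IsProbabilityMeasure Q] {F : Feat d k l → ℝ} (hF : Measurable F)
    (hFi : Integrable (fun w : Obs d k l => F w.feat) Q) :
    ∫ w, ind w.annot * (F w.feat * ind w.treat) ∂Q
      = ∫ w, ind w.annot * (F w.feat * imputationFun Q w.feat) ∂Q := by
  set s : Set (Obs d k l) := {w | w.annot = true} with hs
  have ms : MeasurableSet s := Obs.measurable_annot (measurableSet_singleton true)
  have hind : ∀ f : Obs d k l → ℝ, ∫ w, ind w.annot * f w ∂Q = ∫ w in s, f w ∂Q := by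
    intro f
    rw [← integral_indicator ms]
    congr 1; ext w
    by_cases hw : w.annot = true
    · simp [hs, hw, ind]
    · simp only [Bool.not_eq_true] at hw
      simp [hs, hw, ind]
  rw [hind, hind]
  by_cases h0 : Q s = 0
  · rw [Measure.restrict_eq_zero.2 h0, integral_zero_measure, integral_zero_measure]
  have hpr : IsProbabilityMeasure (Q[|s]) := cond_isProbabilityMeasure h0
  have hFc : Integrable (fun w : Obs d k l => F w.feat) (Q[|s]) :=
    hFi.restrict.smul_measure (by simp [h0])
  have hce := condExp_ae_eq_integral_condDistrib (μ := Q[|s]) (X := Obs.feat) (Y := Obs.treat)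
    Obs.measurable_feat Obs.measurable_treat.aemeasurable measurable_ind.stronglyMeasurable
    (integrable_of_abs_le measurable_ind_treat fun _ => abs_ind_le_one _)
  have h1 := integral_mul_condExp (μ := Q[|s]) Obs.measurable_feat.comap_le
    (f := fun w => F w.feat) (g := fun w => ind w.treat)
    (hF.comp (comap_measurable Obs.feat)).stronglyMeasurable
    (integrable_ind_treat_mul hFc)
    (integrable_of_abs_le measurable_ind_treat fun _ => abs_ind_le_one _)
  have h2 : ∫ w, F w.feat * ind w.treat ∂(Q[|s])
      = ∫ w, F w.feat * imputationFun Q w.feat ∂(Q[|s]) := by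
    rw [← h1]
    refine integral_congr_ae ?_
    filter_upwards [hce] with w hw
    rw [hw]; rfl
  simp only [ProbabilityTheory.cond, integral_smul_measure] at h2
  have h3 : ((Q s)⁻¹).toReal ≠ 0 := by
    rw [ENNReal.toReal_inv]
    exact inv_ne_zero (ENNReal.toReal_ne_zero.2 ⟨h0, measure_ne_top _ _⟩)
  exact smul_right_injective ℝ h3 h2

theorem integrable_div_score (hπ : Measurable π) (hη : 0 < η) (hπη : ∀ x, π x ∈ Set.Icc η 1)
    {f : Obs d k l → ℝ} (hf : Integrable f Q) :
    Integrable (fun w => f w / π w.annotCovs) Q := by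
  have h1 : ∀ w : Obs d k l, ‖(π w.annotCovs)⁻¹‖ ≤ η⁻¹ := fun w => by
    rw [norm_inv, Real.norm_of_nonneg (hη.le.trans (hπη _).1)]
    exact inv_anti₀ hη (hπη _).1
  simpa only [div_eq_mul_inv, Pi.inv_apply, Function.comp_apply] using
    hf.mul_bdd (hπ.comp Obs.measurable_annotCovs).inv.aestronglyMeasurable (ae_of_all _ h1)

theorem integrable_resid_mul {f : Feat d k l → ℝ} (hf : Measurable f) {K : ℝ}
    (hK : ∀ x, |f x| ≤ K) (hr : Integrable (fun w : Obs d k l => w.resid γ) Q) :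
    Integrable (fun w : Obs d k l => w.resid γ * f w.feat) Q :=
  hr.mul_bdd (hf.comp Obs.measurable_feat).aestronglyMeasurable (ae_of_all _ fun _ => hK _)

theorem integral_score_mul_div (hη : 0 < η) (hπη : ∀ x, π x ∈ Set.Icc η 1) (f g : Obs d k l → ℝ) :
    ∫ w, π w.annotCovs * (f w / π w.annotCovs * g w) ∂Q = ∫ w, f w * g w ∂Q := by
  congr 1; ext w
  have : π w.annotCovs ≠ 0 := (hη.trans_le (hπη _).1).ne'
  field_simp

/-- The denominator functional is a linear functional of laws with annotation score `π`. -/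
theorem HasScore.thetaDen_eq [IsProbabilityMeasure Q] (hQ : HasScore π Q) (hπ : Measurable π)
    (hη : 0 < η) (hπη : ∀ x, π x ∈ Set.Icc η 1)
    (hr : Integrable (fun w : Obs d k l => w.resid γ) Q) :
    thetaDen γ Q = ∫ w, ind w.annot * (w.resid γ / π w.annotCovs * ind w.treat) ∂Q := by
  have hF : Measurable fun x : Feat d k l => featResid γ x / π x.1 :=
    (measurable_featResid γ).div (hπ.comp measurable_fst)
  have hFi := integrable_div_score hπ hη hπη hr
  have hm := measurable_imputationFun Q
  have h1 := integral_annot_mul_treat (Q := Q) hF hFi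
  have h2 := hQ.integral_mul (hF.mul hm)
    (hFi.mul_bdd (hm.comp Obs.measurable_feat).aestronglyMeasurable
      (ae_of_all _ fun _ => abs_imputationFun_le_one Q _))
  -- The chain is `E[Z^⊥ μ] = E[π (Z^⊥ / π) μ] = E[A (Z^⊥ / π) μ] = E[A (Z^⊥ / π) M]`.
  exact (integral_score_mul_div hη hπη (fun w => w.resid γ) _).symm.trans (h2.symm.trans h1.symm)

/-- The augmented inverse probability weighted moment identifies the denominator, whatever the
imputation function. -/
theorem HasScore.integral_resid_mul_pseudoTreat [IsProbabilityMeasure Q] (hQ : HasScore π Q)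
    (hπ : Measurable π) (hη : 0 < η) (hπη : ∀ x, π x ∈ Set.Icc η 1)
    (hr : Integrable (fun w : Obs d k l => w.resid γ) Q) {f : Feat d k l → ℝ} (hf : Measurable f)
    (hfi : Integrable (fun w : Obs d k l => w.resid γ * f w.feat) Q) :
    Integrable (fun w => w.resid γ * pseudoTreat π f w) Q ∧
      ∫ w, w.resid γ * pseudoTreat π f w ∂Q = thetaDen γ Q := by
  have hF : Measurable fun x : Feat d k l => featResid γ x * f x / π x.1 :=
    ((measurable_featResid γ).mul hf).div (hπ.comp measurable_fst)
  have hFi := integrable_div_score hπ hη hπη hfi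
  have hGi := integrable_div_score hπ hη hπη hr
  have h1 := hQ.integral_mul hF hFi
  have h2 : ∫ w, π w.annotCovs * (w.resid γ * f w.feat / π w.annotCovs) ∂Q
      = ∫ w, w.resid γ * f w.feat ∂Q := by
    have := integral_score_mul_div (Q := Q) hη hπη (fun w => w.resid γ * f w.feat) fun _ => 1
    simpa using this
  -- The inverse weighted treatment alone has mean `θ_den`; the two terms in `f` cancel in the mean
  -- because `A` averages to `π` given the features.
  have h3 : ∀ w : Obs d k l, w.resid γ * pseudoTreat π f w = w.resid γ * f w.feat
      + (ind w.annot * (w.resid γ / π w.annotCovs * ind w.treat)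
        - ind w.annot * (w.resid γ * f w.feat / π w.annotCovs)) := fun w => by
    simp only [pseudoTreat]; ring
  have i1 := integrable_ind_annot_mul (integrable_ind_treat_mul hGi)
  have i2 := integrable_ind_annot_mul hFi
  have i3 : Integrable (fun w => ind w.annot * (w.resid γ / π w.annotCovs * ind w.treat)
        - ind w.annot * (w.resid γ * f w.feat / π w.annotCovs)) Q := i1.sub i2
  refine ⟨?_, ?_⟩
  · simp only [h3]; exact hfi.add i3
  · simp only [h3]
    rw [integral_add hfi i3, integral_sub i1 i2, ← hQ.thetaDen_eq hπ hη hπη hr]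
    have h4 : ∫ w, ind w.annot * (w.resid γ * f w.feat / π w.annotCovs) ∂Q
      = ∫ w, w.resid γ * f w.feat ∂Q := h1.trans h2
    rw [h4]; ring

/-! ### The influence function -/

theorem memLp_resid_of_momentFun [IsProbabilityMeasure Q] (h : MemLp (momentFun γ) 2 Q) :
    MemLp (fun w : Obs d k l => w.resid γ) 2 Q :=
  h.mono (measurable_resid γ).aestronglyMeasurable (ae_of_all _ fun w => by
    rw [Real.norm_eq_abs, Real.norm_eq_abs]
    refine le_trans ?_ (le_abs_self _)
    simp only [momentFun]
    nlinarith [abs_nonneg (w.resid γ), abs_nonneg w.outcome,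
      mul_nonneg (abs_nonneg (w.resid γ)) (abs_nonneg w.outcome)])

theorem abs_pseudoTreat_le (hη : 0 < η) (hπη : ∀ x, π x ∈ Set.Icc η 1) {f : Feat d k l → ℝ}
    (hf : ∀ x, |f x| ≤ 1) (w : Obs d k l) : |pseudoTreat π f w| ≤ 1 + 2 / η := by
  have hp : 0 < π w.annotCovs := hη.trans_le (hπη _).1
  have h1 : |ind w.annot / π w.annotCovs| ≤ 1 / η := by
    rw [abs_div, abs_of_pos hp]
    exact div_le_div₀ zero_le_one (abs_ind_le_one _) hη (hπη _).1
  have h2 : |ind w.treat - f w.feat| ≤ 2 := by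
    refine (abs_sub _ _).trans ?_
    linarith [abs_ind_le_one w.treat, hf w.feat]
  calc |pseudoTreat π f w| ≤ |f w.feat| + |ind w.annot / π w.annotCovs| *
        |ind w.treat - f w.feat| := by
        rw [← abs_mul]; exact abs_add_le _ _
    _ ≤ 1 + 1 / η * 2 := by gcongr; exact hf _
    _ = _ := by ring

theorem abs_numMoment_le (γ : Fin d → ℝ) (w : Obs d k l) :
    |w.resid γ * w.outcome| ≤ 1 * momentFun γ w := by
  rw [abs_mul, momentFun]
  nlinarith [abs_nonneg (w.resid γ)]

theorem abs_denMoment_le (hη : 0 < η) (hπη : ∀ x, π x ∈ Set.Icc η 1) {f : Feat d k l → ℝ}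
    (hf : ∀ x, |f x| ≤ 1) (γ : Fin d → ℝ) (w : Obs d k l) :
    |w.resid γ * pseudoTreat π f w| ≤ (1 + 2 / η) * momentFun γ w := by
  rw [abs_mul, momentFun]
  have h1 := abs_pseudoTreat_le hη hπη hf w
  have h2 : 0 ≤ 1 + 2 / η := by positivity
  have h3 : 1 ≤ 1 + |w.outcome| := by linarith [abs_nonneg w.outcome]
  calc |w.resid γ| * |pseudoTreat π f w| ≤ |w.resid γ| * (1 + 2 / η) := by gcongr
    _ ≤ |w.resid γ| * (1 + 2 / η) * (1 + |w.outcome|) :=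
        le_mul_of_one_le_right (by positivity) h3
    _ = _ := by ring

theorem memLp_of_abs_le_momentFun {h : Obs d k l → ℝ} (hh : Measurable h) {c : ℝ}
    (hc : ∀ w, |h w| ≤ c * momentFun γ w) (he : MemLp (momentFun γ) 2 Q) : MemLp h 2 Q :=
  (he.const_mul c).mono hh.aestronglyMeasurable (ae_of_all _ fun w => (hc w).trans (le_abs_self _))

/-- The centring constants cancel, since `θ_num = θ θ_den`. -/
theorem phi_eq {P : ProbabilityMeasure (Obs d k l)} (hden : thetaDen γ (P : Measure (Obs d k l)) ≠
    0)
    (w : Obs d k l) : phi π γ (P : Measure (Obs d k l)) (theta γ P) w = (thetaDen γ (P : Measure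
      (Obs d k l)))⁻¹ *
      (w.resid γ * w.outcome - theta γ P * (w.resid γ * pseudoTreat π (imputationFun (P : Measure
        (Obs d k l))) w)) := by
  simp only [phi, phiNum, phiDen, theta]
  field_simp
  ring

/-- The imputation function varies with the law, but on the model `θ_den` is also the mean of the
augmented moment with `μ_P` held fixed. Numerator and denominator are then moments of fixed
functions dominated by `momentFun`, hence differentiable along submodels. The difference quotient of
the ratio is exactly `θ_den(Q_t)⁻¹` times that of the numerator minus `θ(P)` times that of the
denominator. -/
theorem isInfluenceFunction_phi {P : ProbabilityMeasure (Obs d k l)} (hπ : Measurable π)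
    (hη : 0 < η) (hπη : ∀ x, π x ∈ Set.Icc η 1) (hP : P ∈ modelKnownScore π γ) :
    IsInfluenceFunction (modelKnownScore π γ) (momentFun γ) (theta γ) P
      (phi π γ (P : Measure (Obs d k l)) (theta γ P)) := by
  have hmod : ∀ Q : ProbabilityMeasure (Obs d k l), Q ∈ modelKnownScore π γ →
      ∫ w, w.resid γ * pseudoTreat π (imputationFun (P : Measure (Obs d k l))) w ∂(Q : Measure (Obs
        d k l))
        = thetaDen γ (Q : Measure (Obs d k l)) := fun Q hQ => by
    have hr := (memLp_resid_of_momentFun hQ.2.2.1).integrable (by norm_num)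
    exact (HasScore.integral_resid_mul_pseudoTreat hQ.2.1 hπ hη hπη hr
      (measurable_imputationFun _)
      (integrable_resid_mul (measurable_imputationFun _) (abs_imputationFun_le_one _) hr)).2
  have mN : Measurable fun w : Obs d k l => w.resid γ * w.outcome :=
    (measurable_resid γ).mul Obs.measurable_outcome
  have mD : Measurable fun w : Obs d k l => w.resid γ * pseudoTreat π (imputationFun (P : Measure
      (Obs d k l))) w :=
    (measurable_resid γ).mul (measurable_pseudoTreat hπ (measurable_imputationFun _))
  have hdenB := abs_denMoment_le (d := d) (l := l) hη hπη
    (abs_imputationFun_le_one (P : Measure (Obs d k l))) γ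
  have lN : MemLp _ 2 (P : Measure (Obs d k l)) :=
    memLp_of_abs_le_momentFun mN (abs_numMoment_le γ) hP.2.2.1
  have lD : MemLp _ 2 (P : Measure (Obs d k l)) := memLp_of_abs_le_momentFun mD hdenB hP.2.2.1
  have hD0 := hP.2.2.2
  have hphi : phi π γ (P : Measure (Obs d k l)) (theta γ P) = fun w => (thetaDen γ (P : Measure
      (Obs d k l)))⁻¹ *
      (w.resid γ * w.outcome - theta γ P * (w.resid γ * pseudoTreat π (imputationFun (P : Measure
        (Obs d k l))) w)) :=
    funext fun w => phi_eq hD0 w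
  have hnum : thetaNum γ (P : Measure (Obs d k l)) = theta γ P * thetaDen γ (P : Measure (Obs d k
      l)) := by
    simp only [theta]; field_simp
  rw [hphi]
  refine ⟨(lN.sub (lD.const_mul _)).const_mul _, ?_, fun Q g hQ => ?_⟩
  · have iN := lN.integrable (by norm_num)
    have iD := lD.integrable (by norm_num)
    rw [integral_const_mul, integral_sub iN (iD.const_mul _), integral_const_mul, hmod P hP]
    rw [show ∫ w, w.resid γ * w.outcome ∂(P : Measure (Obs d k l))
      = thetaNum γ (P : Measure (Obs d k l)) from rfl, hnum]
    simp
  · have he : ∀ t, MemLp (momentFun γ) 2 (Q t : Measure (Obs d k l)) := fun t => (hQ.mem t).2.2.1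
    have tN := hQ.tendsto_diffQuot_integral he mN (abs_numMoment_le γ)
    have tD := hQ.tendsto_diffQuot_integral he mD hdenB
    rw [hmod P hP] at tD
    simp only [fun t => hmod (Q t) (hQ.mem t)] at tD
    have htid : Tendsto (fun t : ℝ => t) (𝓝[>] 0) (𝓝 0) := nhdsWithin_le_nhds
    -- Continuity of the denominator at `0⁺` follows from its one-sided differentiability.
    have tD0 : Tendsto (fun t => thetaDen γ (Q t : Measure (Obs d k l))) (𝓝[>] 0)
        (𝓝 (thetaDen γ (P : Measure (Obs d k l)))) := by
      have h1 := (htid.mul tD).add_const (thetaDen γ (P : Measure (Obs d k l)))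
      rw [zero_mul, zero_add] at h1
      refine h1.congr' ?_
      filter_upwards [self_mem_nhdsWithin] with t ht
      have : t ≠ 0 := ne_of_gt ht
      field_simp
      ring
    have tot := (tD0.inv₀ hD0).mul (tN.sub (tD.const_mul (theta γ P)))
    have jN : Integrable (fun w => w.resid γ * w.outcome * g w) (P : Measure (Obs d k l)) :=
      lN.integrable_mul hQ.score_memLp
    have jD : Integrable (fun w => w.resid γ * pseudoTreat π (imputationFun (P : Measure (Obs d k
      l))) w * g w)
        (P : Measure (Obs d k l)) := lD.integrable_mul hQ.score_memLp
    have hlim : ∫ w, (thetaDen γ (P : Measure (Obs d k l)))⁻¹ * (w.resid γ * w.outcome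
          - theta γ P * (w.resid γ * pseudoTreat π (imputationFun (P : Measure (Obs d k l))) w)) *
            g w
          ∂(P : Measure (Obs d k l))
        = (thetaDen γ (P : Measure (Obs d k l)))⁻¹ * (∫ w, w.resid γ * w.outcome * g w ∂(P :
          Measure (Obs d k l))
          - theta γ P * ∫ w, w.resid γ * pseudoTreat π (imputationFun (P : Measure (Obs d k l))) w
            * g w
            ∂(P : Measure (Obs d k l))) := by
      rw [← integral_const_mul (theta γ P), ← integral_sub jN (jD.const_mul _),
        ← integral_const_mul]
      congr 1; ext w; ring
    rw [hlim]
    refine tot.congr fun t => ?_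
    have hDt := (hQ.mem t).2.2.2
    have e1 : ∫ w, w.resid γ * w.outcome ∂(Q t : Measure (Obs d k l))
        = theta γ (Q t) * thetaDen γ (Q t : Measure (Obs d k l)) := by
      simp only [theta, thetaNum]; field_simp
    have e2 : ∫ w, w.resid γ * w.outcome ∂(P : Measure (Obs d k l))
        = theta γ P * thetaDen γ (P : Measure (Obs d k l)) := hnum
    rw [e1, e2]
    field_simp
    ring

end Observed

/-! ### Bounded approximation of functions with equal conditional expectations -/

section Approx

variable {Ω : Type*} {m₁ m₂ m₀ : MeasurableSpace Ω} {μ : Measure Ω} [IsProbabilityMeasure μ]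

/-- The operator `D ↦ D - E[D | m₁] + E[D | m₂] - E D` fixes `φ` by hypothesis, increases the `L²`
norm at most by a factor `4`, and preserves boundedness. Applied to a simple function within `ε / 4`
of `φ`, it gives the required approximation. -/
theorem exists_bounded_approx (hm₁ : m₁ ≤ m₀) (hm₂ : m₂ ≤ m₀) {φ : Ω → ℝ} (hφ : MemLp φ 2 μ)
    (heq : μ[φ | m₁] =ᵐ[μ] μ[φ | m₂]) (h0 : ∫ ω, φ ω ∂μ = 0) {ε : ℝ≥0∞} (hε : 0 < ε) :
    ∃ (f g : Ω → ℝ) (B : ℝ), Measurable f ∧ Measurable g ∧ (∀ ω, |f ω| ≤ B) ∧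
      (∀ ω, |g ω| ≤ 4 * B) ∧ g =ᵐ[μ] f - μ[f | m₁] + μ[f | m₂] - (fun _ => ∫ ω, f ω ∂μ) ∧
      eLpNorm (φ - g) 2 μ < ε := by
  obtain ⟨f, hf, hfL⟩ := hφ.exists_simpleFunc_eLpNorm_sub_lt (by norm_num)
    (ε := ε / 4) (ENNReal.div_pos hε.ne' (by norm_num)).ne'
  obtain ⟨B, hB⟩ := f.exists_forall_norm_le
  simp only [Real.norm_eq_abs] at hB
  have hB0 : 0 ≤ B := by
    obtain ⟨ω⟩ : Nonempty Ω := nonempty_of_isProbabilityMeasure μ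
    exact (abs_nonneg _).trans (hB ω)
  have hfi : Integrable f μ := hfL.integrable (by norm_num)
  have hφi : Integrable φ μ := hφ.integrable (by norm_num)
  set g₀ : Ω → ℝ := ⇑f - μ[⇑f | m₁] + μ[⇑f | m₂] - (fun _ => ∫ ω, f ω ∂μ) with hg₀
  have mg₀ : Measurable g₀ :=
    ((f.measurable.sub (stronglyMeasurable_condExp.mono hm₁).measurable).add
      (stronglyMeasurable_condExp.mono hm₂).measurable).sub_const _
  have hce : ∀ m : MeasurableSpace Ω, ∀ᵐ ω ∂μ, |(μ[⇑f | m]) ω| ≤ B := fun m =>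
    ae_bdd_abs_condExp_of_ae_bdd_abs (ae_of_all _ hB)
  have hint : |∫ ω, f ω ∂μ| ≤ B := by
    have := norm_integral_le_of_norm_le_const (μ := μ) (f := ⇑f) (C := B) (ae_of_all _ hB)
    simpa using this
  have hg₀B : ∀ᵐ ω ∂μ, |g₀ ω| ≤ 4 * B := by
    filter_upwards [hce m₁, hce m₂] with ω h1 h2
    have h3 := abs_le.1 (hB ω)
    have h4 := abs_le.1 hint
    have h5 := abs_le.1 h1
    have h6 := abs_le.1 h2
    simp only [hg₀, Pi.sub_apply, Pi.add_apply]
    exact abs_le.2 ⟨by linarith, by linarith⟩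
  -- Conditional expectations are bounded only almost surely; clipping changes a null set and gives
  -- the everywhere bound that the tilts require.
  have hgg₀ : (fun ω => max (-(4 * B)) (min (g₀ ω) (4 * B))) =ᵐ[μ] g₀ := by
    filter_upwards [hg₀B] with ω h
    rw [min_eq_left (abs_le.1 h).2, max_eq_right (abs_le.1 h).1]
  refine ⟨f, fun ω => max (-(4 * B)) (min (g₀ ω) (4 * B)), B, f.measurable, by fun_prop, hB,
    fun ω => abs_le.2 ⟨le_max_left _ _, max_le (by linarith) (min_le_right _ _)⟩, hgg₀, ?_⟩
  set D : Ω → ℝ := φ - ⇑f with hD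
  have hDi : Integrable D μ := hφi.sub hfi
  have hdec : φ - (fun ω => max (-(4 * B)) (min (g₀ ω) (4 * B))) =ᵐ[μ]
      D - μ[D | m₁] + μ[D | m₂] - μ[D | ⊥] := by
    -- Writing the mean as a conditional expectation on the trivial σ-algebra lets one contraction
    -- bound serve all the projections.
    have hbot : μ[D | ⊥] = fun _ => -∫ ω, f ω ∂μ := by
      rw [condExp_bot, hD]
      ext
      simp only [Pi.sub_apply]
      rw [integral_sub hφi hfi, h0, zero_sub]
    filter_upwards [hgg₀, condExp_sub hφi hfi m₁, condExp_sub hφi hfi m₂, heq]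
      with ω h1 h2 h3 h4
    simp only [Pi.sub_apply, Pi.add_apply] at h1 h2 h3 ⊢
    rw [h1, hbot, hD, h2, h3, h4]
    simp only [hg₀, Pi.sub_apply, Pi.add_apply]
    ring
  rw [eLpNorm_congr_ae hdec]
  have hDs : AEStronglyMeasurable D μ := hDi.aestronglyMeasurable
  have hcs : ∀ m : MeasurableSpace Ω, AEStronglyMeasurable[m₀] (μ[D | m]) μ := fun m =>
    (integrable_condExp (m := m) (μ := μ) (f := D)).aestronglyMeasurable
  have hle : ∀ m : MeasurableSpace Ω, eLpNorm (μ[D | m]) 2 μ ≤ eLpNorm D 2 μ := fun m =>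
    eLpNorm_condExp_le_eLpNorm D (by norm_num)
  calc eLpNorm (D - μ[D | m₁] + μ[D | m₂] - μ[D | ⊥]) 2 μ
      ≤ eLpNorm (D - μ[D | m₁] + μ[D | m₂]) 2 μ + eLpNorm (μ[D | ⊥]) 2 μ :=
        eLpNorm_sub_le ((hDs.sub (hcs _)).add (hcs _)) (hcs _) (by norm_num)
    _ ≤ eLpNorm (D - μ[D | m₁]) 2 μ + eLpNorm (μ[D | m₂]) 2 μ + eLpNorm (μ[D | ⊥]) 2 μ := by
        gcongr
        exact eLpNorm_add_le (hDs.sub (hcs _)) (hcs _) (by norm_num)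
    _ ≤ eLpNorm D 2 μ + eLpNorm (μ[D | m₁]) 2 μ + eLpNorm (μ[D | m₂]) 2 μ
        + eLpNorm (μ[D | ⊥]) 2 μ := by
        gcongr
        exact eLpNorm_sub_le hDs (hcs _) (by norm_num)
    _ ≤ eLpNorm D 2 μ + eLpNorm D 2 μ + eLpNorm D 2 μ + eLpNorm D 2 μ := by
        gcongr <;> exact hle _
    _ = 4 * eLpNorm D 2 μ := by ring
    _ < 4 * (ε / 4) := ENNReal.mul_lt_mul_right (by norm_num) (by norm_num) hf
    _ = ε := ENNReal.mul_div_cancel (by norm_num) (by norm_num)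

end Approx

/-! ### The tangent space of the model with known annotation score -/

section Tangent

variable {d k l : ℕ} {π : (Fin k → ℝ) → ℝ} {γ : Fin d → ℝ} {η : ℝ}

/-- The σ-algebra generated by the features. -/
abbrev featAlg (d k l : ℕ) : MeasurableSpace (Obs d k l) :=
  MeasurableSpace.comap Obs.feat inferInstance

/-- The σ-algebra generated by the annotation indicator and the features. -/
abbrev annotFeatAlg (d k l : ℕ) : MeasurableSpace (Obs d k l) :=
  MeasurableSpace.comap (fun w => (w.annot, w.feat)) inferInstance

theorem featAlg_le : featAlg d k l ≤ (inferInstance : MeasurableSpace (Obs d k l)) :=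
    Obs.measurable_feat.comap_le

theorem annotFeatAlg_le : annotFeatAlg d k l ≤ (inferInstance : MeasurableSpace (Obs d k l)) :=
  (Obs.measurable_annot.prodMk Obs.measurable_feat).comap_le

theorem measurable_annotFeat :
    Measurable[annotFeatAlg d k l] fun w : Obs d k l => (w.annot, w.feat) :=
  comap_measurable _

theorem featAlg_le_annotFeatAlg : featAlg d k l ≤ annotFeatAlg d k l := by
  have : Measurable[annotFeatAlg d k l] (Obs.feat : Obs d k l → Feat d k l) :=
    measurable_snd.comp measurable_annotFeat
  exact this.comap_le

theorem measurable_annot_annotFeatAlg :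
    Measurable[annotFeatAlg d k l] fun w : Obs d k l => ind w.annot :=
  Measurable.comp (g := fun p : Bool × Feat d k l => ind p.1) (measurable_ind.comp measurable_fst)
    measurable_annotFeat

theorem HasScore.integral_mul_stronglyMeasurable {Q : Measure (Obs d k l)} [IsProbabilityMeasure Q]
    (hQ : HasScore π Q) {H : Obs d k l → ℝ} (hH : StronglyMeasurable[featAlg d k l] H)
    (hHi : Integrable H Q) :
    ∫ w, ind w.annot * H w ∂Q = ∫ w, π w.annotCovs * H w ∂Q := by
  have h1 := integral_mul_condExp (μ := Q) featAlg_le (f := H) (g := fun w => ind w.annot)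
    hH (by simpa only [mul_comm] using integrable_ind_annot_mul hHi) integrable_ind_annot
  simp only [mul_comm (ind _), ← h1, mul_comm (π _)]
  refine integral_congr_ae ?_
  filter_upwards [hQ] with w hw
  rw [hw]

/-- A bounded function `g` is a tangent direction if perturbing the law by `1 + t g` preserves the
annotation score. -/
def IsTangent (π : (Fin k → ℝ) → ℝ) (P : Measure (Obs d k l)) (g : Obs d k l → ℝ) : Prop :=
  ∀ s : Set (Feat d k l), MeasurableSet s →
    ∫ w, ind w.annot * (s.indicator 1 w.feat * g w) ∂P
      = ∫ w, π w.annotCovs * (s.indicator 1 w.feat * g w) ∂P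

/-- Both weights `A` and `π(X)` are functions of `(A, X̃)`, so `f - E[f | A, X̃]` integrates to zero
against them on feature events. What is left of `g` depends on the features only, where `A` and `π`
have equal moments. -/
theorem isTangent_of_decomposition {P : Measure (Obs d k l)} [IsProbabilityMeasure P]
    (hP : HasScore π P) (hπ : Measurable π) (hπη : ∀ x, π x ∈ Set.Icc η 1) (hη : 0 < η)
    {f g : Obs d k l → ℝ} (hf : Measurable f) {B : ℝ} (hB : ∀ w, |f w| ≤ B)
    (hg : g =ᵐ[P] f - P[f | annotFeatAlg d k l] + P[f | featAlg d k l]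
      - (fun _ => ∫ ω, f ω ∂P)) :
    IsTangent π P g ∧ ∫ w, g w ∂P = 0 := by
  have hfi : Integrable f P := integrable_of_abs_le hf hB
  refine ⟨fun s hs => ?_, ?_⟩
  · set F : Obs d k l → ℝ := fun w => s.indicator 1 w.feat with hF
    have mF : Measurable[featAlg d k l] F :=
      (measurable_one.indicator hs).comp (comap_measurable Obs.feat)
    have mF' : Measurable F := mF.mono featAlg_le le_rfl
    have bF : ∀ w, |F w| ≤ 1 := fun w => by
      by_cases h : w.feat ∈ s <;> simp [hF, h]
    have bπ : ∀ w : Obs d k l, |π w.annotCovs| ≤ 1 := fun w =>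
      abs_le.2 ⟨by linarith [(hπη w.annotCovs).1], (hπη _).2⟩
    have mπ : Measurable[annotFeatAlg d k l] fun w : Obs d k l => π w.annotCovs :=
      Measurable.comp (g := fun p : Bool × Feat d k l => π p.2.1)
        (hπ.comp (measurable_fst.comp measurable_snd)) measurable_annotFeat
    have bdd : ∀ {c h : Obs d k l → ℝ}, Measurable c → (∀ w, |c w| ≤ 1) → Integrable h P →
        Integrable (fun w => c w * h w) P := fun hc hc1 hh =>
      hh.bdd_mul hc.aestronglyMeasurable (ae_of_all _ hc1)
    have kill : ∀ c : Obs d k l → ℝ, Measurable[annotFeatAlg d k l] c → (∀ w, |c w| ≤ 1) →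
        ∫ w, c w * (F w * (f w - (P[f | annotFeatAlg d k l]) w)) ∂P = 0 := by
      intro c hc hc1
      have mc : Measurable c := hc.mono annotFeatAlg_le le_rfl
      have h1 := integral_mul_condExp (μ := P) annotFeatAlg_le (f := fun w => c w * F w) (g := f)
        (hc.mul (mF.mono featAlg_le_annotFeatAlg le_rfl)).stronglyMeasurable
        (by simpa only [mul_assoc] using bdd mc hc1 (bdd mF' bF hfi)) hfi
      have h2 : ∀ w, c w * (F w * (f w - (P[f | annotFeatAlg d k l]) w))
          = c w * F w * f w - c w * F w * (P[f | annotFeatAlg d k l]) w := fun w => by ring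
      simp only [h2]
      rw [integral_sub, h1, sub_self]
      · simpa only [mul_assoc] using bdd mc hc1 (bdd mF' bF hfi)
      · simpa only [mul_assoc] using bdd mc hc1 (bdd mF' bF integrable_condExp)
    set H : Obs d k l → ℝ := fun w => F w * ((P[f | featAlg d k l]) w - ∫ ω, f ω ∂P) with hH
    have sH : StronglyMeasurable[featAlg d k l] H :=
      (mF.mul (stronglyMeasurable_condExp.measurable.sub_const _)).stronglyMeasurable
    have iH : Integrable H P := bdd mF' bF (integrable_condExp.sub (integrable_const _))
    have hsplit : ∀ c : Obs d k l → ℝ, Measurable[annotFeatAlg d k l] c → (∀ w, |c w| ≤ 1) →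
        ∫ w, c w * (F w * g w) ∂P = ∫ w, c w * H w ∂P := by
      intro c hc hc1
      have mc : Measurable c := hc.mono annotFeatAlg_le le_rfl
      have ik : Integrable (fun w => c w * (F w * (f w - (P[f | annotFeatAlg d k l]) w))) P :=
        bdd mc hc1 (bdd mF' bF (hfi.sub integrable_condExp))
      rw [← zero_add (∫ w, c w * H w ∂P), ← kill c hc hc1, ← integral_add ik (bdd mc hc1 iH)]
      refine integral_congr_ae ?_
      filter_upwards [hg] with w hw
      rw [hw]
      simp only [hH, Pi.sub_apply, Pi.add_apply]
      ring
    rw [hsplit _ measurable_annot_annotFeatAlg fun w => abs_ind_le_one _, hsplit _ mπ bπ]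
    exact hP.integral_mul_stronglyMeasurable sH iH
  · rw [integral_congr_ae hg]
    simp only [Pi.sub_apply, Pi.add_apply]
    have i1 : Integrable (fun w => f w - (P[f | annotFeatAlg d k l]) w) P :=
      hfi.sub integrable_condExp
    have i2 : Integrable (fun w => f w - (P[f | annotFeatAlg d k l]) w
      + (P[f | featAlg d k l]) w) P := i1.add integrable_condExp
    rw [integral_sub i2 (integrable_const _), integral_add i1 integrable_condExp,
      integral_sub hfi integrable_condExp, integral_condExp annotFeatAlg_le,
      integral_condExp featAlg_le]
    simp

/-- Integrals over feature events under the tilt are affine in `t`: the constant terms for `A` and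
`π` agree by the score of `P`, the slopes by `IsTangent`. -/
theorem HasScore.tilt {P : Measure (Obs d k l)} [IsProbabilityMeasure P] (hP : HasScore π P)
    (hπ : Measurable π) (hπη : ∀ x, π x ∈ Set.Icc η 1) (hη : 0 < η) {g : Obs d k l → ℝ}
    (hg : Measurable g) {B t : ℝ} (hB : ∀ w, |g w| ≤ B) (hT : IsTangent π P g) (ht : 0 ≤ t)
    (htB : t * B ≤ 1 / 2) [IsProbabilityMeasure (MARS.tilt P g t)] :
    HasScore π (MARS.tilt P g t) := by
  have bπ : ∀ w : Obs d k l, |π w.annotCovs| ≤ 1 := fun w =>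
    abs_le.2 ⟨by linarith [(hπη w.annotCovs).1], (hπη _).2⟩
  have mπ : Measurable fun w : Obs d k l => π w.annotCovs := hπ.comp Obs.measurable_annotCovs
  refine (ae_eq_condExp_of_forall_setIntegral_eq featAlg_le integrable_ind_annot
    (fun s _ _ => (integrable_of_abs_le mπ bπ).integrableOn) ?_
    ((hπ.comp measurable_fst).comp
      (comap_measurable Obs.feat)).aestronglyMeasurable).symm
  rintro _ ⟨s, hs, rfl⟩ -
  have ms : MeasurableSet (Obs.feat ⁻¹' s : Set (Obs d k l)) := Obs.measurable_feat hs
  have mF : Measurable fun w : Obs d k l => s.indicator (1 : Feat d k l → ℝ) w.feat :=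
    (measurable_one.indicator hs).comp Obs.measurable_feat
  have iF : Integrable (fun w : Obs d k l => s.indicator (1 : Feat d k l → ℝ) w.feat) P :=
    integrable_of_abs_le (B := 1) mF fun w => by by_cases h : w.feat ∈ s <;> simp [h]
  have iFg : Integrable (fun w : Obs d k l => s.indicator (1 : Feat d k l → ℝ) w.feat * g w) P :=
    iF.mul_bdd hg.aestronglyMeasurable (ae_of_all _ hB)
  have key : ∀ c : Obs d k l → ℝ, Measurable c → (∀ w, |c w| ≤ 1) →
      ∫ w in Obs.feat ⁻¹' s, c w ∂(MARS.tilt P g t)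
        = ∫ w, c w * s.indicator 1 w.feat ∂P + t * ∫ w, c w * (s.indicator 1 w.feat * g w) ∂P := by
    intro c hc hc1
    rw [← integral_indicator ms, integral_tilt hg hB ht htB, ← integral_const_mul, ← integral_add
      (iF.bdd_mul hc.aestronglyMeasurable (ae_of_all _ hc1))
      ((iFg.bdd_mul hc.aestronglyMeasurable (ae_of_all _ hc1)).const_mul _)]
    congr 1; ext w
    by_cases h : w.feat ∈ s
    · simp [h]; ring
    · simp [h]
  rw [key _ mπ bπ, key _ measurable_ind_annot fun w => abs_ind_le_one _, hT s hs,
    hP.integral_mul (measurable_one.indicator hs) iF]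

/-- A density bounded by `2` preserves null sets and finite moments, and the tangent condition
preserves the score. Only the nonvanishing denominator limits `t`. -/
theorem tilt_mem_modelKnownScore {P : ProbabilityMeasure (Obs d k l)}
    (hP : P ∈ modelKnownScore π γ) (hπ : Measurable π) (hπη : ∀ x, π x ∈ Set.Icc η 1) (hη : 0 < η)
    {g : Obs d k l → ℝ} (hg : Measurable g) {B : ℝ} (hB : ∀ w, |g w| ≤ B)
    (hT : IsTangent π (P : Measure (Obs d k l)) g) :
    ∃ δ > 0, ∀ t, 0 < t → t < δ → t * B ≤ 1 / 2 → ∀ R : ProbabilityMeasure (Obs d k l),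
      (R : Measure (Obs d k l)) = tilt (P : Measure (Obs d k l)) g t →
      R ∈ modelKnownScore π γ := by
  set h : Obs d k l → ℝ := fun w => ind w.annot * (w.resid γ / π w.annotCovs * ind w.treat)
  set D := thetaDen γ (P : Measure (Obs d k l)) with hD
  have hr := (memLp_resid_of_momentFun hP.2.2.1).integrable (by norm_num)
  have ih : Integrable h (P : Measure (Obs d k l)) :=
    integrable_ind_annot_mul (integrable_ind_treat_mul (integrable_div_score hπ hη hπη hr))
  have ihg : Integrable (fun w => g w * h w) (P : Measure (Obs d k l)) :=
    ih.bdd_mul hg.aestronglyMeasurable (ae_of_all _ hB)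
  set G := ∫ w, g w * h w ∂(P : Measure (Obs d k l)) with hG
  have hD0 : 0 < |D| := abs_pos.2 hP.2.2.2
  -- Along the tilt the denominator is `D + t G`; for such `t` one has `t |G| < |D|`. The `+ 1`
  -- covers `G = 0`.
  refine ⟨|D| / (|G| + 1), by positivity, fun t ht htδ htB R hR => ?_⟩
  have hpr : IsProbabilityMeasure (tilt (P : Measure (Obs d k l)) g t) := by
    rw [← hR]; infer_instance
  have hle := tilt_le (P := (P : Measure (Obs d k l))) hB ht.le htB
  have hmem := hP.2.2.1.of_measure_le_smul (by norm_num) hle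
  have hsc := HasScore.tilt (P := (P : Measure (Obs d k l))) hP.2.1 hπ hπη hη hg hB hT ht.le htB
  have hr' := (memLp_resid_of_momentFun hmem).integrable (by norm_num)
  refine ⟨?_, ?_, ?_, ?_⟩
  · rw [hR]; exact (withDensity_absolutelyContinuous _ _).ae_le hP.1
  · rw [hR]; exact hsc
  · rw [hR]; exact hmem
  · rw [hR, hsc.thetaDen_eq hπ hη hπη hr', integral_tilt hg hB ht.le htB]
    have h1 : ∫ w, (1 + t * g w) • h w ∂(P : Measure (Obs d k l)) = D + t * G := by
      rw [hD, HasScore.thetaDen_eq hP.2.1 hπ hη hπη hr, hG, ← integral_const_mul,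
        ← integral_add ih (ihg.const_mul _)]
      congr 1; ext w
      simp only [smul_eq_mul, h]; ring
    rw [h1]
    intro h0
    have h2 : |D| = t * |G| := by
      rw [show D = -(t * G) by linarith, abs_neg, abs_mul, abs_of_pos ht]
    rw [lt_div_iff₀ (by positivity)] at htδ
    nlinarith [abs_nonneg G]

end Tangent

/-! ### Efficiency when the outcome is mean independent of annotation -/

section Efficient

variable {d k l : ℕ} {π : (Fin k → ℝ) → ℝ} {γ : Fin d → ℝ} {η : ℝ}

/-- The factor `A` reduces an event in `(A, X̃)` to its section at `A = 1`, which is a feature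
event. The defining property of the imputation function, applied to `F` restricted to that section,
gives zero. -/
theorem condExp_annot_mul_treat_sub {P : Measure (Obs d k l)} [IsProbabilityMeasure P]
    {F : Feat d k l → ℝ} (hF : Measurable F)
    (hFi : Integrable (fun w : Obs d k l => F w.feat) P) :
    P[fun w => ind w.annot * (F w.feat * (ind w.treat - imputationFun P w.feat)) |
      annotFeatAlg d k l] =ᵐ[P] fun _ => (0 : ℝ) := by
  have hm := measurable_imputationFun P
  have i1 : ∀ {G : Feat d k l → ℝ}, Integrable (fun w : Obs d k l => G w.feat) P →
      Integrable (fun w => ind w.annot * (G w.feat * ind w.treat)) P :=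
    fun hG => integrable_ind_annot_mul (integrable_ind_treat_mul hG)
  have i2 : ∀ {G : Feat d k l → ℝ}, Integrable (fun w : Obs d k l => G w.feat) P →
      Integrable (fun w => ind w.annot * (G w.feat * imputationFun P w.feat)) P :=
    fun hG => integrable_ind_annot_mul (hG.mul_bdd (hm.comp
      Obs.measurable_feat).aestronglyMeasurable
      (ae_of_all _ fun _ => abs_imputationFun_le_one _ _))
  have hV : ∀ G : Feat d k l → ℝ,
      (fun w : Obs d k l => ind w.annot * (G w.feat * (ind w.treat - imputationFun P w.feat)))
      = fun w => ind w.annot * (G w.feat * ind w.treat)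
        - ind w.annot * (G w.feat * imputationFun P w.feat) := fun G => by
    ext w; ring
  have iV : ∀ {G : Feat d k l → ℝ}, Integrable (fun w : Obs d k l => G w.feat) P → Integrable
      (fun w : Obs d k l => ind w.annot * (G w.feat * (ind w.treat - imputationFun P w.feat))) P :=
    fun {G} hG => by rw [hV]; exact (i1 hG).sub (i2 hG)
  refine (ae_eq_condExp_of_forall_setIntegral_eq annotFeatAlg_le (iV hFi)
    (fun s _ _ => (integrable_const _).integrableOn) ?_
    stronglyMeasurable_const.aestronglyMeasurable).symm
  rintro _ ⟨B, hB, rfl⟩ -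
  have ms : MeasurableSet ((fun w : Obs d k l => (w.annot, w.feat)) ⁻¹' B) :=
    (Obs.measurable_annot.prodMk Obs.measurable_feat) hB
  set B' : Set (Feat d k l) := {x | (true, x) ∈ B} with hB'
  have mB' : MeasurableSet B' := measurable_prodMk_left hB
  have mG : Measurable (B'.indicator F) := hF.indicator mB'
  have iG : Integrable (fun w : Obs d k l => B'.indicator F w.feat) P :=
    hFi.mono (mG.comp Obs.measurable_feat).aestronglyMeasurable
      (ae_of_all _ fun w => norm_indicator_le_norm_self F w.feat)
  have h1 : ∀ w : Obs d k l, ((fun w : Obs d k l => (w.annot, w.feat)) ⁻¹' B).indicator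
      (fun w => ind w.annot * (F w.feat * (ind w.treat - imputationFun P w.feat))) w
      = ind w.annot * (B'.indicator F w.feat * (ind w.treat - imputationFun P w.feat)) := by
    intro w
    cases ha : w.annot
    · by_cases h : (w.annot, w.feat) ∈ B
      · rw [Set.indicator_of_mem (by exact h)]; simp [ha, ind]
      · rw [Set.indicator_of_notMem (by exact h)]; simp [ind]
    · by_cases h : (true, w.feat) ∈ B
      · rw [Set.indicator_of_mem (by rw [Set.mem_preimage, ha]; exact h),
          Set.indicator_of_mem (by exact h), ha]
      · rw [Set.indicator_of_notMem (by rw [Set.mem_preimage, ha]; exact h),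
          Set.indicator_of_notMem (by exact h)]
        simp
  simp only [integral_zero]
  symm
  rw [← integral_indicator ms]
  refine (integral_congr_ae (ae_of_all _ h1)).trans ?_
  rw [hV, integral_sub (i1 iG) (i2 iG), integral_annot_mul_treat mG iG, sub_self]

/-- This is where outcome mean independence enters. The weighted residual `V` has conditional mean
zero given `(A, X̃)`, the imputed part `I` depends on the features alone, and `hY` removes `A` from
the conditional mean of `Y`. So the finer conditional expectation depends on the features only, and
the tower property identifies it with the coarser one. -/
theorem condExp_phi_annotFeatAlg {P : ProbabilityMeasure (Obs d k l)} (hπ : Measurable π)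
    (hη : 0 < η) (hπη : ∀ x, π x ∈ Set.Icc η 1) (hP : P ∈ modelKnownScore π γ)
    (hYi : Integrable Obs.outcome (P : Measure (Obs d k l)))
    (hY : (P : Measure (Obs d k l))[Obs.outcome | annotFeatAlg d k l]
      =ᵐ[(P : Measure (Obs d k l))] (P : Measure (Obs d k l))[Obs.outcome | featAlg d k l]) :
    (P : Measure (Obs d k l))[phi π γ (P : Measure (Obs d k l)) (theta γ P) | annotFeatAlg d k l]
      =ᵐ[(P : Measure (Obs d k l))]
    (P : Measure (Obs d k l))[phi π γ (P : Measure (Obs d k l)) (theta γ P) | featAlg d k l] := by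
  set p : Measure (Obs d k l) := (P : Measure (Obs d k l)) with hp
  set φ := phi π γ p (theta γ P) with hφ
  have hm := measurable_imputationFun p
  have hr := (memLp_resid_of_momentFun hP.2.2.1).integrable (by norm_num)
  have hF : Measurable fun x : Feat d k l => featResid γ x / π x.1 :=
    (measurable_featResid γ).div (hπ.comp measurable_fst)
  have hFi : Integrable (fun w : Obs d k l => featResid γ w.feat / π w.annotCovs) p :=
    integrable_div_score hπ hη hπη hr
  set V : Obs d k l → ℝ := fun w => ind w.annot *
    (featResid γ w.feat / π w.annotCovs * (ind w.treat - imputationFun p w.feat)) with hV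
  have hV0 : p[V | annotFeatAlg d k l] =ᵐ[p] fun _ => (0 : ℝ) := condExp_annot_mul_treat_sub hF hFi
  set N : Obs d k l → ℝ := fun w => w.resid γ * w.outcome with hN
  set I : Obs d k l → ℝ := fun w => w.resid γ * imputationFun p w.feat with hI
  have iV : Integrable V p := by
    refine integrable_ind_annot_mul (hFi.mul_bdd (c := 2)
      (measurable_ind_treat.sub (hm.comp Obs.measurable_feat)).aestronglyMeasurable
      (ae_of_all _ fun w => ?_))
    rw [Real.norm_eq_abs]
    refine (abs_sub _ _).trans ?_
    linarith [abs_ind_le_one w.treat, abs_imputationFun_le_one p w.feat]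
  have iN : Integrable N p := (memLp_of_abs_le_momentFun
    ((measurable_resid γ).mul Obs.measurable_outcome) (abs_numMoment_le γ)
    hP.2.2.1).integrable (by norm_num)
  have iI : Integrable I p := integrable_resid_mul hm (abs_imputationFun_le_one p) hr
  have hdec : φ = (thetaDen γ p)⁻¹ • (N - theta γ P • (I + V)) := by
    ext w
    rw [hφ, phi_eq hP.2.2.2]
    simp only [Pi.smul_apply, Pi.sub_apply, Pi.add_apply, smul_eq_mul, hN, hI, hV, pseudoTreat,
      resid_eq_featResid]
    ring
  have mr : Measurable[featAlg d k l] fun w : Obs d k l => w.resid γ :=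
    (measurable_featResid γ).comp (comap_measurable Obs.feat)
  have mI : Measurable[featAlg d k l] I :=
    mr.mul (hm.comp (comap_measurable Obs.feat))
  set G : Obs d k l → ℝ := (thetaDen γ p)⁻¹ •
    ((fun w => w.resid γ * (p[Obs.outcome | featAlg d k l]) w) - theta γ P • I) with hG
  have sG : StronglyMeasurable[featAlg d k l] G :=
    ((mr.stronglyMeasurable.mul stronglyMeasurable_condExp).sub
      (mI.stronglyMeasurable.const_smul _)).const_smul _
  have hN' : p[N | annotFeatAlg d k l] =ᵐ[p]
      fun w => w.resid γ * (p[Obs.outcome | annotFeatAlg d k l]) w :=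
    condExp_mul_of_stronglyMeasurable_left (m := annotFeatAlg d k l)
      (mr.mono featAlg_le_annotFeatAlg le_rfl).stronglyMeasurable iN hYi
  have hI' : p[I | annotFeatAlg d k l] = I :=
    condExp_of_stronglyMeasurable annotFeatAlg_le
      (mI.mono featAlg_le_annotFeatAlg le_rfl).stronglyMeasurable iI
  have h1 : p[φ | annotFeatAlg d k l] =ᵐ[p] G := by
    rw [hdec]
    have e1 := condExp_smul (μ := p) ((thetaDen γ p)⁻¹) (N - theta γ P • (I + V))
      (annotFeatAlg d k l)
    have e2 := condExp_sub iN ((iI.add iV).smul (theta γ P)) (annotFeatAlg d k l)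
    have e3 := condExp_smul (μ := p) (theta γ P) (I + V) (annotFeatAlg d k l)
    have e4 := condExp_add iI iV (annotFeatAlg d k l)
    filter_upwards [e1, e2, e3, e4, hN', hV0, hY] with w e1 e2 e3 e4 e5 e6 e7
    rw [hI'] at e4
    simp only [Pi.smul_apply, Pi.sub_apply, Pi.add_apply, smul_eq_mul, hG] at e1 e2 e3 e4 ⊢
    rw [e1, e2, e3, e4, e5, e6, e7, add_zero]
  have iG : Integrable G p := integrable_condExp.congr h1
  have h2 : p[φ | featAlg d k l] =ᵐ[p] G :=
    calc p[φ | featAlg d k l] =ᵐ[p] p[p[φ | annotFeatAlg d k l] | featAlg d k l] :=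
          (condExp_condExp_of_le featAlg_le_annotFeatAlg annotFeatAlg_le).symm
      _ =ᵐ[p] p[G | featAlg d k l] := condExp_congr_ae h1
      _ = G := condExp_of_stronglyMeasurable featAlg_le sG iG
  exact h1.trans h2.symm

/-- The explicit path is kept along with the score: membership in the tangent space needs only the
score, the bound for regular estimators needs the tilt itself. -/
theorem exists_score_near_phi {P : ProbabilityMeasure (Obs d k l)} (hπ : Measurable π)
    (hη : 0 < η) (hπη : ∀ x, π x ∈ Set.Icc η 1) (hP : P ∈ modelKnownScore π γ)
    (hYi : Integrable Obs.outcome (P : Measure (Obs d k l)))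
    (hY : (P : Measure (Obs d k l))[Obs.outcome | annotFeatAlg d k l]
      =ᵐ[(P : Measure (Obs d k l))] (P : Measure (Obs d k l))[Obs.outcome | featAlg d k l])
    {ε : ℝ≥0∞} (hε : 0 < ε) :
    ∃ (g : Obs d k l → ℝ) (B : ℝ) (Q : ℝ → ProbabilityMeasure (Obs d k l)),
      Measurable g ∧ (∀ w, |g w| ≤ B) ∧ ∫ w, g w ∂(P : Measure (Obs d k l)) = 0 ∧
      eLpNorm (phi π γ (P : Measure (Obs d k l)) (theta γ P) - g) 2 (P : Measure (Obs d k l)) < ε ∧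
      IsRegularSubmodel (modelKnownScore π γ) (momentFun γ) P Q g ∧
      ∀ᶠ t in 𝓝[>] 0, t * B ≤ 1 / 2 ∧
        (Q t : Measure (Obs d k l)) = tilt (P : Measure (Obs d k l)) g t := by
  have hφ := isInfluenceFunction_phi hπ hη hπη hP
  obtain ⟨f, g, B, hf, hg, hfB, hgB, hdec, hlt⟩ := exists_bounded_approx annotFeatAlg_le featAlg_le
    hφ.1 (condExp_phi_annotFeatAlg hπ hη hπη hP hYi hY) hφ.2.1 hε
  obtain ⟨hT, h0⟩ := isTangent_of_decomposition hP.2.1 hπ hπη hη hf hfB hdec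
  obtain ⟨δ, hδ, hmem⟩ := tilt_mem_modelKnownScore hP hπ hπη hη hg hgB hT
  obtain ⟨Q, hQ, hQt⟩ := exists_isRegularSubmodel_tilt hP hg hgB h0 hP.2.2.1 hδ hmem
  exact ⟨g, 4 * B, Q, hg, hgB, h0, hlt, hQ, hQt⟩

theorem abs_integral_mul_sub_lt {Ω : Type*} {m : MeasurableSpace Ω} {μ : Measure Ω} {f φ g : Ω → ℝ}
    (hf : MemLp f 2 μ) (hφ : MemLp φ 2 μ) (hg : MemLp g 2 μ) {ε : ℝ} (hε : 0 < ε)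
    (h : eLpNorm (φ - g) 2 μ < ENNReal.ofReal ε) :
    |∫ ω, f ω * φ ω ∂μ - ∫ ω, f ω * g ω ∂μ| ≤ √(∫ ω, f ω ^ 2 ∂μ) * ε := by
  have h1 := abs_integral_mul_le_sqrt_mul_sqrt hf (hφ.sub hg)
  have h2 : ∫ ω, f ω * φ ω ∂μ - ∫ ω, f ω * g ω ∂μ = ∫ ω, f ω * (φ - g) ω ∂μ := by
    refine (integral_sub (hf.integrable_mul hφ) (hf.integrable_mul hg)).symm.trans ?_
    congr 1; ext ω; simp only [Pi.sub_apply, Pi.mul_apply]; ring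
  rw [h2]
  refine h1.trans (mul_le_mul_of_nonneg_left ?_ (Real.sqrt_nonneg _))
  rw [(hφ.sub hg).eLpNorm_eq_integral_rpow_norm (by norm_num) (by norm_num),
    ENNReal.ofReal_lt_ofReal_iff hε] at h
  simp only [ENNReal.toReal_ofNat, Real.rpow_two, Real.norm_eq_abs, sq_abs] at h
  rw [Real.sqrt_eq_rpow, one_div]
  exact h.le

theorem isEfficientInfluenceFunction_phi {P : ProbabilityMeasure (Obs d k l)} (hπ : Measurable π)
    (hη : 0 < η) (hπη : ∀ x, π x ∈ Set.Icc η 1) (hP : P ∈ modelKnownScore π γ)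
    (hYi : Integrable Obs.outcome (P : Measure (Obs d k l)))
    (hY : (P : Measure (Obs d k l))[Obs.outcome | annotFeatAlg d k l]
      =ᵐ[(P : Measure (Obs d k l))] (P : Measure (Obs d k l))[Obs.outcome | featAlg d k l]) :
    IsEfficientInfluenceFunction (modelKnownScore π γ) (momentFun γ) (theta γ) P
      (phi π γ (P : Measure (Obs d k l)) (theta γ P)) := by
  refine ⟨isInfluenceFunction_phi hπ hη hπη hP, fun ε hε => ?_⟩
  obtain ⟨g, B, Q, -, -, -, hlt, hQ, -⟩ := exists_score_near_phi hπ hη hπη hP hYi hY hε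
  exact ⟨g, Submodule.subset_span ⟨Q, hQ⟩, hlt⟩

/-- `ψ` and `φ` have the same inner product with every approximating score, both being the pathwise
derivative. In the limit `E[ψ φ] = E[φ²]`, and Cauchy-Schwarz gives the bound. -/
theorem IsRAL.variance_phi_le {P : ProbabilityMeasure (Obs d k l)} (hπ : Measurable π)
    (hη : 0 < η) (hπη : ∀ x, π x ∈ Set.Icc η 1) (hP : P ∈ modelKnownScore π γ)
    (hYi : Integrable Obs.outcome (P : Measure (Obs d k l)))
    (hY : (P : Measure (Obs d k l))[Obs.outcome | annotFeatAlg d k l]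
      =ᵐ[(P : Measure (Obs d k l))] (P : Measure (Obs d k l))[Obs.outcome | featAlg d k l])
    {T : ∀ n : ℕ, (Fin n → Obs d k l) → ℝ} {ψ : Obs d k l → ℝ}
    (hT : IsRAL (modelKnownScore π γ) (momentFun γ) (theta γ) P T ψ) :
    variance (phi π γ (P : Measure (Obs d k l)) (theta γ P)) (P : Measure (Obs d k l))
      ≤ variance ψ (P : Measure (Obs d k l)) := by
  have hφ := isInfluenceFunction_phi hπ hη hπη hP
  set p : Measure (Obs d k l) := (P : Measure (Obs d k l)) with hp
  set φ := phi π γ p (theta γ P)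
  rw [variance_of_integral_eq_zero hφ.1.aestronglyMeasurable.aemeasurable hφ.2.1,
    variance_of_integral_eq_zero hT.memLp.aestronglyMeasurable.aemeasurable hT.mean_zero]
  set a := ∫ w, φ w ^ 2 ∂p with ha
  set b := ∫ w, ψ w ^ 2 ∂p with hb
  have ha0 : 0 ≤ a := integral_nonneg fun w => sq_nonneg _
  have hb0 : 0 ≤ b := integral_nonneg fun w => sq_nonneg _
  have key : a = ∫ w, ψ w * φ w ∂p := by
    refine eq_of_abs_sub_le_all fun ε hε => ?_
    set ε' := ε / (√a + √b + 1) with hε'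
    have hpos : 0 < √a + √b + 1 := by positivity
    have hε'0 : 0 < ε' := by positivity
    obtain ⟨g, B, Q, hg, hgB, h0, hlt, hQ, hQt⟩ := exists_score_near_phi hπ hη hπη hP hYi hY
      (ENNReal.ofReal_pos.2 hε'0)
    have hgL : MemLp g 2 p := hQ.score_memLp
    have h1 := abs_integral_mul_sub_lt hφ.1 hφ.1 hgL hε'0 hlt
    have h2 := abs_integral_mul_sub_lt hT.memLp hφ.1 hgL hε'0 hlt
    have h3 : ∫ w, ψ w * g w ∂p = ∫ w, φ w * g w ∂p :=
      hT.integral_mul_eq hP hP.2.2.1 hg hgB h0 hQ hQt (hφ.2.2 Q g hQ)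
    have h4 : ∫ w, φ w * φ w ∂p = a := by simp only [ha, sq]
    rw [h4] at h1
    have h5 : (√a + √b) * ε' ≤ ε := by
      rw [hε', mul_div_assoc', div_le_iff₀ hpos]
      nlinarith
    calc |a - ∫ w, ψ w * φ w ∂p|
        = |(a - ∫ w, φ w * g w ∂p) - (∫ w, ψ w * φ w ∂p - ∫ w, ψ w * g w ∂p)| := by
          rw [h3]; congr 1; ring
      _ ≤ √a * ε' + √b * ε' := (abs_sub _ _).trans (add_le_add h1 h2)
      _ ≤ ε := by linarith
  have h1 := abs_integral_mul_le_sqrt_mul_sqrt hT.memLp hφ.1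
  rw [← key, abs_of_nonneg ha0] at h1
  rw [← Real.sqrt_le_sqrt_iff hb0]
  by_contra hlt
  push Not at hlt
  have h2 := Real.mul_self_sqrt ha0
  nlinarith [Real.sqrt_nonneg a, Real.sqrt_nonneg b]

end Efficient

/-! ### Conditional independence and the annotation score -/

section Score

variable {Ω α β : Type*} {m₀ : MeasurableSpace Ω} [MeasurableSpace α] [MeasurableSpace β]
  {μ : Measure Ω} [IsProbabilityMeasure μ]

theorem integrable_ind_comp {A : Ω → Bool} (hA : Measurable A) : Integrable (fun ω => ind (A ω)) μ
    :=
  integrable_of_abs_le (measurable_ind.comp hA) fun _ => abs_ind_le_one _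

/-- Conditionally independent variables may be added to the conditioning. -/
theorem condExp_ind_prodMk [StandardBorelSpace Ω] {V : Ω → α} {f : Ω → β} {A : Ω → Bool}
    {p : α → ℝ} (hV : Measurable V) (hf : Measurable f) (hA : Measurable A) (hp : Measurable p)
    (hp0 : ∀ x, 0 ≤ p x) (hp1 : ∀ x, p x ≤ 1)
    (hci : CondIndepFun (MeasurableSpace.comap V inferInstance) hV.comap_le f A μ)
    (h : μ[fun ω => ind (A ω) | MeasurableSpace.comap V inferInstance] =ᵐ[μ] fun ω => p (V ω)) :
    μ[fun ω => ind (A ω) | MeasurableSpace.comap (fun ω => (V ω, f ω)) inferInstance]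
      =ᵐ[μ] fun ω => p (V ω) := by
  have hVf : Measurable fun ω => (V ω, f ω) := hV.prodMk hf
  have mA : Measurable fun ω => ind (A ω) := measurable_ind.comp hA
  have iA : Integrable (fun ω => ind (A ω)) μ := integrable_ind_comp hA
  have mp : Measurable fun ω => p (V ω) := hp.comp hV
  have bp : ∀ ω, |p (V ω)| ≤ 1 := fun ω => abs_le.2 ⟨by linarith [hp0 (V ω)], hp1 _⟩
  have ip : Integrable (fun ω => p (V ω)) μ := integrable_of_abs_le mp bp
  have hrect : ∀ {s : Set α} {t : Set β}, MeasurableSet s → MeasurableSet t →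
      ∫ ω in V ⁻¹' s ∩ f ⁻¹' t, ind (A ω) ∂μ = ∫ ω in V ⁻¹' s ∩ f ⁻¹' t, p (V ω) ∂μ := by
    intro s t hs ht
    have hci' := (condIndepFun_iff_condExp_inter_preimage_eq_mul hf hA).1 hci t {true} ht
      (measurableSet_singleton true)
    have mt : MeasurableSet (f ⁻¹' t) := hf ht
    have ms : MeasurableSet (V ⁻¹' s) := hV hs
    have mtA : MeasurableSet (f ⁻¹' t ∩ A ⁻¹' {true}) := mt.inter (hA (measurableSet_singleton
      true))
    have hAind : (A ⁻¹' {true}).indicator (fun _ => (1 : ℝ)) = fun ω => ind (A ω) := by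
      ext ω
      cases ha : A ω <;> simp [ind, ha]
    rw [hAind] at hci'
    have hsm : MeasurableSet[MeasurableSpace.comap V inferInstance] (V ⁻¹' s) := ⟨s, hs, rfl⟩
    have e1 : ∫ ω in V ⁻¹' s ∩ f ⁻¹' t, ind (A ω) ∂μ
        = ∫ ω in V ⁻¹' s, (f ⁻¹' t ∩ A ⁻¹' {true}).indicator (fun _ => (1 : ℝ)) ω ∂μ := by
      rw [← setIntegral_indicator mt]
      congr 1; ext ω
      cases ha : A ω <;> by_cases hω : f ω ∈ t <;> simp [ind, ha, hω, Set.indicator]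
    have i1 : Integrable ((f ⁻¹' t ∩ A ⁻¹' {true}).indicator fun _ => (1 : ℝ)) μ :=
      (integrable_const _).indicator mtA
    have it : Integrable ((f ⁻¹' t).indicator fun _ => (1 : ℝ)) μ :=
      (integrable_const _).indicator mt
    rw [e1, ← setIntegral_condExp hV.comap_le i1 hsm, ← integral_indicator ms,
      ← setIntegral_indicator mt]
    set q : Ω → ℝ := (V ⁻¹' s).indicator fun ω => p (V ω) with hq
    have sq : StronglyMeasurable[MeasurableSpace.comap V inferInstance] q :=
      ((hp.comp (comap_measurable V)).indicator hsm).stronglyMeasurable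
    have h2 := integral_mul_condExp (μ := μ) hV.comap_le sq
      (g := (f ⁻¹' t).indicator fun _ => (1 : ℝ))
      (it.bdd_mul (c := 1) (mp.indicator ms).aestronglyMeasurable (ae_of_all _ fun ω =>
        (norm_indicator_le_norm_self _ _).trans (bp ω))) it
    have h3 : ∫ ω in V ⁻¹' s, (f ⁻¹' t).indicator (fun ω => p (V ω)) ω ∂μ
        = ∫ ω, q ω * (f ⁻¹' t).indicator (fun _ => (1 : ℝ)) ω ∂μ := by
      rw [← integral_indicator ms]
      congr 1; ext ω
      by_cases h1 : V ω ∈ s <;> by_cases h2 : f ω ∈ t <;> simp [hq, Set.indicator, h1, h2]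
    rw [h3, ← h2]
    refine integral_congr_ae ?_
    filter_upwards [hci', h] with ω h4 h5
    by_cases h1 : V ω ∈ s
    · rw [Set.indicator_of_mem (by exact h1), h4, h5, hq, Set.indicator_of_mem (by exact h1),
        mul_comm]
    · rw [Set.indicator_of_notMem (by exact h1), hq, Set.indicator_of_notMem (by exact h1),
      zero_mul]
  -- Conditional independence gives the integral identity on rectangles only. Reading both sides as
  -- measures extends it to all events generated by `(V, f)`.
  have hmeas : (μ.withDensity fun ω => ENNReal.ofReal (ind (A ω))).map (fun ω => (V ω, f ω))
      = (μ.withDensity fun ω => ENNReal.ofReal (p (V ω))).map (fun ω => (V ω, f ω)) := by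
    have : IsFiniteMeasure (μ.withDensity fun ω => ENNReal.ofReal (ind (A ω))) :=
      isFiniteMeasure_withDensity_ofReal iA.2
    refine Measure.ext_prod fun {s t} hs ht => ?_
    have hst := hVf (hs.prod ht)
    rw [Measure.map_apply hVf (hs.prod ht), Measure.map_apply hVf (hs.prod ht),
      withDensity_apply _ hst, withDensity_apply _ hst,
      ← ofReal_integral_eq_lintegral_ofReal iA.integrableOn (ae_of_all _ fun _ => ind_nonneg _),
      ← ofReal_integral_eq_lintegral_ofReal ip.integrableOn (ae_of_all _ fun _ => hp0 _)]
    congr 1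
    exact hrect hs ht
  refine (ae_eq_condExp_of_forall_setIntegral_eq hVf.comap_le iA
    (fun s _ _ => ip.integrableOn) ?_ ?_).symm
  · rintro _ ⟨B, hB, rfl⟩ -
    have h1 := congrArg (fun ν => (ν B).toReal) hmeas
    simp only [Measure.map_apply hVf hB, withDensity_apply _ (hVf hB)] at h1
    rw [integral_eq_lintegral_of_nonneg_ae (ae_of_all _ fun _ => hp0 _) mp.aestronglyMeasurable,
      integral_eq_lintegral_of_nonneg_ae (ae_of_all _ fun _ => ind_nonneg _)
        mA.aestronglyMeasurable]
    exact h1.symm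
  · exact (Measurable.comp (g := fun x : α × β => p x.1) (hp.comp measurable_fst)
      (comap_measurable fun ω => (V ω, f ω))).aestronglyMeasurable

/-- Change of variables on the generating events. It moves mean independence from the underlying
probability space to the law of the observation. -/
theorem condExp_map_comp {T : β → α} {X : Ω → β} (hX : Measurable X) (hT : Measurable T)
    {g : β → ℝ} (hg : Integrable g (μ.map X)) :
    (fun ω => ((μ.map X)[g | MeasurableSpace.comap T inferInstance]) (X ω))
      =ᵐ[μ] μ[fun ω => g (X ω) | MeasurableSpace.comap (fun ω => T (X ω)) inferInstance] := by
  have hpm : IsProbabilityMeasure (μ.map X) := Measure.isProbabilityMeasure_map hX.aemeasurable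
  have hgX : Integrable (fun ω => g (X ω)) μ := hg.comp_measurable hX
  have hc : Integrable ((μ.map X)[g | MeasurableSpace.comap T inferInstance]) (μ.map X) :=
    integrable_condExp
  refine ae_eq_condExp_of_forall_setIntegral_eq (hT.comp hX).comap_le hgX
    (fun s _ _ => (hc.comp_measurable hX).integrableOn) ?_ ?_
  · rintro _ ⟨B, hB, rfl⟩ -
    have h1 := setIntegral_condExp (μ := μ.map X) hT.comap_le hg (s := T ⁻¹' B) ⟨B, hB, rfl⟩
    rwa [setIntegral_map (hT hB) hc.aestronglyMeasurable hX.aemeasurable,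
      setIntegral_map (hT hB) hg.aestronglyMeasurable hX.aemeasurable] at h1
  · have h2 : Measurable[MeasurableSpace.comap (fun ω => T (X ω)) inferInstance,
        MeasurableSpace.comap T inferInstance] X := by
      rintro _ ⟨B, hB, rfl⟩
      exact ⟨B, hB, rfl⟩
    exact (stronglyMeasurable_condExp.measurable.comp h2).aestronglyMeasurable

end Score

/-! ### Identification in the population -/

namespace Population

variable {Ω : Type*} [MeasurableSpace Ω] {Pr : Measure Ω} [IsProbabilityMeasure Pr] {d k l : ℕ}
  {S : Population Ω d k l} {π : (Fin k → ℝ) → ℝ} {γ : Fin d → ℝ} {η : ℝ}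

/-- The variables that determine the features and the true treatment. -/
def complete (S : Population Ω d k l) (ω : Ω) :
    ((Fin k → ℝ) × (Fin l → ℝ) × Bool) × (Fin d → ℝ) × ℝ :=
  ((S.X ω, S.U ω, S.Mstar ω), (S.C ω, S.Z ω))

theorem measurable_complete : Measurable S.complete :=
  S.measurable_XUMstar.prodMk (S.measurable_C.prodMk S.measurable_Z)

/-- The conditioning is enlarged twice, from `X` to `(X, U, M*)` by missingness at random and then
by `(C, Z)` through context independence; the score stays `π(X)` throughout. -/
theorem condExp_annot_complete [StandardBorelSpace Ω] (hMAR : S.MissingAtRandom Pr)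
    (hCtx : S.ContextIndependent Pr) (hπ : Measurable π) (hη : 0 < η)
    (hπη : ∀ x, π x ∈ Set.Icc η 1) (hScore : S.IsAnnotationScore Pr π) :
    Pr[fun ω => ind (S.A ω) | MeasurableSpace.comap S.complete inferInstance]
      =ᵐ[Pr] fun ω => π (S.X ω) := by
  have h0 : ∀ x, 0 ≤ π x := fun x => hη.le.trans (hπη x).1
  have h1 := condExp_ind_prodMk S.measurable_X (S.measurable_U.prodMk S.measurable_Mstar)
    S.measurable_A hπ h0 (fun x => (hπη x).2) hMAR hScore
  exact condExp_ind_prodMk S.measurable_XUMstar (S.measurable_C.prodMk S.measurable_Z)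
    S.measurable_A (hπ.comp measurable_fst) (fun x => h0 x.1) (fun x => (hπη x.1).2) hCtx h1

/-- The features as a function of the complete data. -/
def featOfComplete (x : ((Fin k → ℝ) × (Fin l → ℝ) × Bool) × (Fin d → ℝ) × ℝ) : Feat d k l :=
  (x.1.1, x.1.2.1, x.2.2, x.2.1)

theorem measurable_featOfComplete :
    Measurable (featOfComplete : _ → Feat d k l) := by
  unfold featOfComplete; fun_prop

theorem coe_law : (S.law Pr : Measure (Obs d k l)) = Pr.map S.obs := rfl

theorem hasScore_law [StandardBorelSpace Ω] (hMAR : S.MissingAtRandom Pr)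
    (hCtx : S.ContextIndependent Pr) (hπ : Measurable π) (hη : 0 < η)
    (hπη : ∀ x, π x ∈ Set.Icc η 1) (hScore : S.IsAnnotationScore Pr π) :
    HasScore π (S.law Pr : Measure (Obs d k l)) := by
  have hc := condExp_annot_complete hMAR hCtx hπ hη hπη hScore
  have mπ : Measurable fun w : Obs d k l => π w.annotCovs := hπ.comp Obs.measurable_annotCovs
  have iA : Integrable (fun ω => ind (S.A ω)) Pr := integrable_ind_comp S.measurable_A
  refine (ae_eq_condExp_of_forall_setIntegral_eq featAlg_le integrable_ind_annot
    (fun s _ _ => (integrable_of_abs_le (B := 1) mπ fun w =>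
      abs_le.2 ⟨by linarith [(hπη w.annotCovs).1], (hπη _).2⟩).integrableOn) ?_
    ((hπ.comp measurable_fst).comp
      (comap_measurable Obs.feat)).aestronglyMeasurable).symm
  rintro _ ⟨s, hs, rfl⟩ -
  rw [coe_law, setIntegral_map (Obs.measurable_feat hs) mπ.aestronglyMeasurable
    S.measurable_obs.aemeasurable, setIntegral_map (Obs.measurable_feat hs)
    measurable_ind_annot.aestronglyMeasurable S.measurable_obs.aemeasurable]
  have h1 := setIntegral_condExp (μ := Pr) S.measurable_complete.comap_le iA
    (s := S.complete ⁻¹' (featOfComplete ⁻¹' s)) ⟨_, measurable_featOfComplete hs, rfl⟩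
  exact (integral_congr_ae (ae_restrict_of_ae (hc.mono fun ω h => h.symm))).trans h1

theorem memLp_momentFun_law (hY : MemLp S.Y 2 Pr) (hBdd : ∃ B : ℝ, ∀ᵐ ω ∂Pr, |S.resid γ ω| ≤ B) :
    MemLp (momentFun γ) 2 (S.law Pr : Measure (Obs d k l)) := by
  obtain ⟨B, hB⟩ := hBdd
  rw [coe_law, memLp_map_measure_iff (measurable_momentFun γ).aestronglyMeasurable
    S.measurable_obs.aemeasurable]
  refine (((memLp_const (1 : ℝ)).add hY.abs).const_mul B).mono
    ((measurable_momentFun γ).comp S.measurable_obs).aestronglyMeasurable ?_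
  filter_upwards [hB] with ω hω
  have h0 : 0 ≤ 1 + |S.Y ω| := by positivity
  have hB0 : 0 ≤ B := (abs_nonneg _).trans hω
  change |(|S.resid γ ω| * (1 + |S.Y ω|))| ≤ |B * (1 + |S.Y ω|)|
  rw [abs_of_nonneg (mul_nonneg (abs_nonneg _) h0), abs_of_nonneg (mul_nonneg hB0 h0)]
  exact mul_le_mul_of_nonneg_right hω h0

theorem integrable_resid (hBdd : ∃ B : ℝ, ∀ᵐ ω ∂Pr, |S.resid γ ω| ≤ B) :
    Integrable (S.resid γ) Pr := by
  obtain ⟨B, hB⟩ := hBdd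
  exact (integrable_const B).mono
    ((measurable_resid γ).comp S.measurable_obs).aestronglyMeasurable
    (hB.mono fun ω h => h.trans (le_abs_self B))

/-- Consistency turns `A M` into `A M*`. Since `Z^⊥`, `X` and `M*` are functions of the complete
data, given which `A` averages to `π(X)`, the weight cancels. -/
theorem thetaDen_law [StandardBorelSpace Ω] (hMAR : S.MissingAtRandom Pr)
    (hCtx : S.ContextIndependent Pr)
    (hCons : ∀ᵐ ω ∂Pr, ind (S.M ω) = ind (S.A ω) * ind (S.Mstar ω)) (hπ : Measurable π)
    (hη : 0 < η) (hπη : ∀ x, π x ∈ Set.Icc η 1) (hScore : S.IsAnnotationScore Pr π)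
    (hr : Integrable (S.resid γ) Pr) :
    thetaDen γ (S.law Pr : Measure (Obs d k l)) = ∫ ω, S.resid γ ω * ind (S.Mstar ω) ∂Pr := by
  have hmr : Measurable (S.resid γ) := (measurable_resid γ).comp S.measurable_obs
  have hc := condExp_annot_complete hMAR hCtx hπ hη hπη hScore
  have iA : Integrable (fun ω => ind (S.A ω)) Pr := integrable_ind_comp S.measurable_A
  have hrl : Integrable (fun w : Obs d k l => w.resid γ) (S.law Pr : Measure (Obs d k l)) :=
    (integrable_map_measure (measurable_resid γ).aestronglyMeasurable
      S.measurable_obs.aemeasurable).2 hr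
  have hmd : Measurable fun w : Obs d k l =>
      ind w.annot * (w.resid γ / π w.annotCovs * ind w.treat) :=
    measurable_ind_annot.mul
      (((measurable_resid γ).div (hπ.comp Obs.measurable_annotCovs)).mul measurable_ind_treat)
  rw [(hasScore_law hMAR hCtx hπ hη hπη hScore).thetaDen_eq hπ hη hπη hrl, coe_law,
    integral_map S.measurable_obs.aemeasurable hmd.aestronglyMeasurable]
  set F : Ω → ℝ := fun ω => S.resid γ ω / π (S.X ω) * ind (S.Mstar ω) with hF
  have hinv : ∀ ω, ‖(π (S.X ω))⁻¹‖ ≤ η⁻¹ := fun ω => by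
    rw [norm_inv, Real.norm_of_nonneg (hη.le.trans (hπη _).1)]
    exact inv_anti₀ hη (hπη _).1
  have iF : Integrable F Pr :=
    (hr.mul_bdd (hπ.comp S.measurable_X).inv.aestronglyMeasurable (ae_of_all _ hinv)).mul_bdd
      (measurable_ind.comp S.measurable_Mstar).aestronglyMeasurable
      (ae_of_all _ fun _ => abs_ind_le_one _)
  have sF : StronglyMeasurable[MeasurableSpace.comap S.complete inferInstance] F := by
    have h : Measurable fun x : ((Fin k → ℝ) × (Fin l → ℝ) × Bool) × (Fin d → ℝ) × ℝ =>
        featResid γ (featOfComplete x) / π x.1.1 * ind x.1.2.2 :=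
      (((measurable_featResid γ).comp measurable_featOfComplete).div
        (hπ.comp (measurable_fst.comp measurable_fst))).mul
        (measurable_ind.comp (measurable_snd.comp (measurable_snd.comp measurable_fst)))
    exact (h.comp (comap_measurable S.complete)).stronglyMeasurable
  have h1 := integral_mul_condExp (μ := Pr) S.measurable_complete.comap_le sF
    (g := fun ω => ind (S.A ω))
    (iF.mul_bdd (measurable_ind.comp S.measurable_A).aestronglyMeasurable
      (ae_of_all _ fun _ => abs_ind_le_one _)) iA
  calc ∫ ω, ind (S.obs ω).annot *
        ((S.obs ω).resid γ / π (S.obs ω).annotCovs * ind (S.obs ω).treat) ∂Pr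
      = ∫ ω, F ω * ind (S.A ω) ∂Pr := by
        refine integral_congr_ae ?_
        filter_upwards [hCons] with ω hω
        change ind (S.A ω) * (S.resid γ ω / π (S.X ω) * ind (S.M ω)) = _
        rw [hω, hF]
        linear_combination (S.resid γ ω / π (S.X ω) * ind (S.Mstar ω)) * ind_mul_self (S.A ω)
    _ = ∫ ω, S.resid γ ω * ind (S.Mstar ω) ∂Pr := by
        rw [← h1]
        refine integral_congr_ae ?_
        filter_upwards [hc] with ω hω
        have h0 : π (S.X ω) ≠ 0 := (hη.trans_le (hπη _).1).ne'
        rw [hω, hF]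
        field_simp

theorem law_mem_modelKnownScore [StandardBorelSpace Ω] (hMAR : S.MissingAtRandom Pr)
    (hCtx : S.ContextIndependent Pr)
    (hCons : ∀ᵐ ω ∂Pr, ind (S.M ω) = ind (S.A ω) * ind (S.Mstar ω)) (hπ : Measurable π)
    (hη : 0 < η) (hπη : ∀ x, π x ∈ Set.Icc η 1) (hScore : S.IsAnnotationScore Pr π)
    (hY : MemLp S.Y 2 Pr) (hBdd : ∃ B : ℝ, ∀ᵐ ω ∂Pr, |S.resid γ ω| ≤ B)
    (hRel : S.RelevantInstrument Pr γ) : S.law Pr ∈ modelKnownScore π γ := by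
  refine ⟨?_, hasScore_law hMAR hCtx hπ hη hπη hScore, memLp_momentFun_law hY hBdd, ?_⟩
  · have hm : MeasurableSet {w : Obs d k l | w.annot = false → w.treat = false} :=
      (Obs.measurable_annot.prodMk Obs.measurable_treat)
        (MeasurableSet.of_discrete (s := {p : Bool × Bool | p.1 = false → p.2 = false}))
    rw [coe_law, ae_map_iff S.measurable_obs.aemeasurable hm]
    filter_upwards [hCons] with ω hω ha
    change S.M ω = false
    change S.A ω = false at ha
    rw [ha] at hω
    cases hM : S.M ω
    · rfl
    · simp [hM, ind] at hω
  · rw [thetaDen_law hMAR hCtx hCons hπ hη hπη hScore (integrable_resid hBdd)]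
    exact hRel

theorem ate_eq_theta [StandardBorelSpace Ω] (hMAR : S.MissingAtRandom Pr)
    (hCtx : S.ContextIndependent Pr)
    (hCons : ∀ᵐ ω ∂Pr, ind (S.M ω) = ind (S.A ω) * ind (S.Mstar ω)) (hπ : Measurable π)
    (hη : 0 < η) (hπη : ∀ x, π x ∈ Set.Icc η 1) (hScore : S.IsAnnotationScore Pr π)
    (hY : MemLp S.Y 2 Pr) (hC : ∀ j, MemLp (fun ω => S.C ω j) 2 Pr)
    (hBdd : ∃ B : ℝ, ∀ᵐ ω ∂Pr, |S.resid γ ω| ≤ B)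
    (hRel : S.RelevantInstrument Pr γ) (hOut : S.ConsistentOutcome Pr)
    (hExo : S.ExogenousInstrument Pr) (hHom : S.HomogeneousEffects Pr)
    (hLin : S.LinearOutcome Pr) (hProj : S.IsProjectionCoef Pr γ) :
    S.ate Pr = theta γ (S.law Pr) := by
  have hr := integrable_resid hBdd
  have hden := thetaDen_law hMAR hCtx hCons hπ hη hπη hScore hr
  obtain ⟨B, hB⟩ := hBdd
  obtain ⟨Δ, hΔ⟩ := hHom
  obtain ⟨β, hβ⟩ := hLin
  have hate : S.ate Pr = Δ := by
    rw [ate, integral_congr_ae hΔ]; simp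
  have hmr : Measurable (S.resid γ) := (measurable_resid γ).comp S.measurable_obs
  have hY0 : ∀ᵐ ω ∂Pr, S.Y ω = S.Ypot false ω + Δ * ind (S.Mstar ω) := by
    filter_upwards [hOut, hΔ] with ω h1 h2
    rw [h1]
    cases S.Mstar ω
    · simp [ind]
    · simp only [ind, if_true]; linarith
  have iY0 : Integrable (S.Ypot false) Pr := by
    refine ((hY.integrable (by norm_num)).sub
      ((integrable_ind_comp S.measurable_Mstar).const_mul Δ)).congr ?_
    filter_upwards [hY0] with ω h
    simp only [Pi.sub_apply, h]; ring
  have irY0 : Integrable (fun ω => S.resid γ ω * S.Ypot false ω) Pr :=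
    iY0.bdd_mul hmr.aestronglyMeasurable hB
  have hCZ : Measurable fun ω => (S.C ω, S.Z ω) := S.measurable_C.prodMk S.measurable_Z
  have sr : StronglyMeasurable[MeasurableSpace.comap (fun ω => (S.C ω, S.Z ω)) inferInstance]
      (S.resid γ) := by
    have h : Measurable fun x : (Fin d → ℝ) × ℝ => x.2 - ∑ j, γ j * x.1 j := by fun_prop
    exact (h.comp (comap_measurable fun ω => (S.C ω, S.Z ω))).stronglyMeasurable
  -- `Z^⊥` depends on `(C, Z)`, so `Y⁰` may be replaced by its conditional mean, linear in `C` by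
  -- exogeneity and `hβ`; the projection property then annihilates it.
  have hzero : ∫ ω, S.resid γ ω * S.Ypot false ω ∂Pr = 0 := by
    rw [← integral_mul_condExp hCZ.comap_le sr irY0 iY0]
    calc ∫ ω, S.resid γ ω * (Pr[S.Ypot false |
            MeasurableSpace.comap (fun ω => (S.C ω, S.Z ω)) inferInstance]) ω ∂Pr
        = ∫ ω, ∑ j, β j * (S.C ω j * S.resid γ ω) ∂Pr := by
          refine integral_congr_ae ?_
          filter_upwards [hExo false, hβ] with ω h1 h2
          rw [h1, h2, Finset.mul_sum]
          exact Finset.sum_congr rfl fun j _ => by ring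
      _ = 0 := by
          rw [integral_finsetSum]
          · refine Finset.sum_eq_zero fun j _ => ?_
            rw [integral_const_mul, hProj j, mul_zero]
          · exact fun j _ => (((hC j).integrable (by norm_num)).mul_bdd
              hmr.aestronglyMeasurable hB).const_mul _
  have hnum : thetaNum γ (S.law Pr : Measure (Obs d k l))
      = Δ * ∫ ω, S.resid γ ω * ind (S.Mstar ω) ∂Pr := by
    have hmn : Measurable fun w : Obs d k l => w.resid γ * w.outcome :=
      (measurable_resid γ).mul Obs.measurable_outcome
    rw [thetaNum, coe_law,
      integral_map S.measurable_obs.aemeasurable hmn.aestronglyMeasurable]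
    have irM : Integrable (fun ω => S.resid γ ω * ind (S.Mstar ω)) Pr :=
      hr.mul_bdd (measurable_ind.comp S.measurable_Mstar).aestronglyMeasurable
        (ae_of_all _ fun _ => abs_ind_le_one _)
    rw [← zero_add (Δ * _), ← hzero, ← integral_const_mul, ← integral_add irY0 (irM.const_mul Δ)]
    refine integral_congr_ae ?_
    filter_upwards [hY0] with ω h
    change S.resid γ ω * S.Y ω = _
    rw [h]; ring
  rw [hate, theta, hnum, hden]
  have : ∫ ω, S.resid γ ω * ind (S.Mstar ω) ∂Pr ≠ 0 := hRel
  field_simp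

theorem integrable_outcome_law (hY : MemLp S.Y 2 Pr) :
    Integrable Obs.outcome (S.law Pr : Measure (Obs d k l)) :=
  (integrable_map_measure Obs.measurable_outcome.aestronglyMeasurable
    S.measurable_obs.aemeasurable).2 (hY.integrable (by norm_num))

theorem OutcomeMeanIndependent.law (hY : MemLp S.Y 2 Pr) (h : S.OutcomeMeanIndependent Pr) :
    (S.law Pr : Measure (Obs d k l))[Obs.outcome | annotFeatAlg d k l]
      =ᵐ[(S.law Pr : Measure (Obs d k l))]
    (S.law Pr : Measure (Obs d k l))[Obs.outcome | featAlg d k l] := by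
  have hi := integrable_outcome_law hY
  have hm : MeasurableSet {w | ((S.law Pr : Measure (Obs d k l))[Obs.outcome | annotFeatAlg d k l])
      w
      = ((S.law Pr : Measure (Obs d k l))[Obs.outcome | featAlg d k l]) w} :=
    measurableSet_eq_fun (stronglyMeasurable_condExp.mono annotFeatAlg_le).measurable
      (stronglyMeasurable_condExp.mono featAlg_le).measurable
  refine (ae_map_iff (p := fun w =>
    ((S.law Pr : Measure (Obs d k l))[Obs.outcome | annotFeatAlg d k l]) w
      = ((S.law Pr : Measure (Obs d k l))[Obs.outcome | featAlg d k l]) w)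
    S.measurable_obs.aemeasurable hm).2 ?_
  have h1 := condExp_map_comp (μ := Pr) S.measurable_obs
    (Obs.measurable_annot.prodMk Obs.measurable_feat) hi
  have h2 := condExp_map_comp (μ := Pr) S.measurable_obs Obs.measurable_feat hi
  exact h1.trans (h.trans h2.symm)

end Population

/-! ### Normalized sums of independent variables -/

section NormalizedSums

variable {𝒲 Ω : Type*} [MeasurableSpace 𝒲] [MeasurableSpace Ω] {p : Measure 𝒲} {μ : Measure Ω}
  {W W' : ℕ → Ω → 𝒲}

theorem iIndepFun_inl (hI : iIndepFun (fun i : ℕ ⊕ ℕ => Sum.elim W W' i) μ) : iIndepFun W μ :=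
  hI.precomp (g := Sum.inl) Sum.inl_injective

theorem iIndepFun_inr (hI : iIndepFun (fun i : ℕ ⊕ ℕ => Sum.elim W W' i) μ) : iIndepFun W' μ :=
  hI.precomp (g := Sum.inr) Sum.inr_injective

variable [IsProbabilityMeasure μ]

theorem map_fin_eq_pi (hW : ∀ i, Measurable (W i)) (hlaw : ∀ i, μ.map (W i) = p)
    (hI : iIndepFun W μ) (n : ℕ) :
    μ.map (fun ω (i : Fin n) => W i ω) = Measure.pi fun _ => p := by
  have h := (iIndepFun_iff_map_fun_eq_pi_map (fun i : Fin n => (hW i).aemeasurable)).1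
    (hI.precomp (g := fun i : Fin n => (i : ℕ)) Fin.val_injective)
  rw [h]
  simp only [hlaw]

/-- Disjoint blocks of an independent family are independent. The product form lets the training
sample be held fixed by Fubini. -/
theorem map_prodMk_eq_prod_pi (hW : ∀ i, Measurable (W i)) (hW' : ∀ i, Measurable (W' i))
    (hlaw : ∀ i, μ.map (W i) = p) (hlaw' : ∀ i, μ.map (W' i) = p)
    (hI : iIndepFun (fun i : ℕ ⊕ ℕ => Sum.elim W W' i) μ) (m n : ℕ) :
    μ.map (fun ω => ((fun j : Fin m => W' j ω), (fun i : Fin n => W i ω)))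
      = (Measure.pi fun _ => p).prod (Measure.pi fun _ => p) := by
  classical
  set s : Finset (ℕ ⊕ ℕ) := (Finset.range m).map ⟨Sum.inr, Sum.inr_injective⟩ with hs
  set t : Finset (ℕ ⊕ ℕ) := (Finset.range n).map ⟨Sum.inl, Sum.inl_injective⟩ with ht
  have hst : Disjoint s t := by
    rw [Finset.disjoint_left]
    rintro (i | i) <;> simp [hs, ht]
  have hms : ∀ j : Fin m, Sum.inr (j : ℕ) ∈ s := fun j => by simp [hs, j.2]
  have hmt : ∀ i : Fin n, Sum.inl (i : ℕ) ∈ t := fun i => by simp [ht, i.2]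
  have hmeas : ∀ i : ℕ ⊕ ℕ, Measurable (Sum.elim W W' i) := by
    rintro (i | i)
    · exact hW i
    · exact hW' i
  have hind := (hI.indepFun_finset s t hst hmeas).comp
    (φ := fun (x : s → 𝒲) (j : Fin m) => x ⟨_, hms j⟩)
    (ψ := fun (x : t → 𝒲) (i : Fin n) => x ⟨_, hmt i⟩)
    (measurable_pi_lambda _ fun j => measurable_pi_apply _)
    (measurable_pi_lambda _ fun i => measurable_pi_apply _)
  have h := (indepFun_iff_map_prod_eq_prod_map_map
    (measurable_pi_lambda (fun ω (j : Fin m) => W' j ω) fun j => hW' j).aemeasurable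
    (measurable_pi_lambda (fun ω (i : Fin n) => W i ω) fun i => hW i).aemeasurable).1 hind
  rw [h, map_fin_eq_pi hW' hlaw' (iIndepFun_inr hI), map_fin_eq_pi hW hlaw (iIndepFun_inl hI)]

variable [IsProbabilityMeasure p]

theorem pi_le_abs_inv_sqrt_mul_sum_le {D : 𝒲 → ℝ} (hD : MemLp D 2 p) (h0 : ∫ w, D w ∂p = 0) {ε : ℝ}
    (hε : 0 < ε) (n : ℕ) :
    (Measure.pi fun _ : Fin n => p) {w | ε ≤ |(√(n : ℝ))⁻¹ * ∑ i, D (w i)|}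
      ≤ ENNReal.ofReal ((∫ w, D w ^ 2 ∂p) / ε ^ 2) := by
  have hL : ∀ i : Fin n, MemLp (fun w : Fin n → 𝒲 => D (w i)) 2 (Measure.pi fun _ => p) := fun i =>
    hD.comp_measurePreserving (measurePreserving_eval (fun _ : Fin n => p) i)
  set X : (Fin n → 𝒲) → ℝ := (√(n : ℝ))⁻¹ • ∑ i, fun w : Fin n → 𝒲 => D (w i) with hX
  have hXL : MemLp X 2 (Measure.pi fun _ : Fin n => p) :=
    (memLp_finsetSum' _ fun i _ => hL i).const_smul _
  have hXw : ∀ w, X w = (√(n : ℝ))⁻¹ * ∑ i, D (w i) := fun w => by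
    simp [hX, Finset.sum_apply]
  have hmean : ∫ w, X w ∂(Measure.pi fun _ : Fin n => p) = 0 := by
    simp only [hXw]
    rw [integral_const_mul, integral_finsetSum _ fun i _ => (hL i).integrable (by norm_num)]
    rw [Finset.sum_eq_zero, mul_zero]
    intro i _
    rw [integral_comp_eval (μ := fun _ : Fin n => p) (i := i) hD.aestronglyMeasurable, h0]
  have hvar : variance X (Measure.pi fun _ : Fin n => p) ≤ ∫ w, D w ^ 2 ∂p := by
    rw [hX, variance_smul, variance_sum_pi fun _ => hD,
      variance_of_integral_eq_zero hD.aestronglyMeasurable.aemeasurable h0]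
    have hnn : 0 ≤ ∫ w, D w ^ 2 ∂p := integral_nonneg fun _ => sq_nonneg _
    simp only [Finset.sum_const, Finset.card_univ, Fintype.card_fin, nsmul_eq_mul, inv_pow,
      Real.sq_sqrt (Nat.cast_nonneg n)]
    -- For the empty sample the factor `(√0)⁻¹` is `0`, so the variance is `0` and the uniform bound
    -- persists.
    rcases Nat.eq_zero_or_pos n with rfl | hn
    · simpa using hnn
    · have : (n : ℝ) ≠ 0 := by positivity
      rw [inv_mul_cancel_left₀ this]
  have h1 := meas_ge_le_variance_div_sq hXL hε
  rw [hmean] at h1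
  simp only [sub_zero, hXw] at h1
  refine h1.trans (ENNReal.ofReal_le_ofReal ?_)
  gcongr

theorem measure_le_abs_inv_sqrt_mul_sum_le (hW : ∀ i, Measurable (W i))
    (hlaw : ∀ i, μ.map (W i) = p) (hI : iIndepFun W μ) {D : 𝒲 → ℝ} (hDm : Measurable D)
    (hD : MemLp D 2 p) (h0 : ∫ w, D w ∂p = 0) {ε : ℝ} (hε : 0 < ε) (n : ℕ) :
    μ {ω | ε ≤ |(√(n : ℝ))⁻¹ * ∑ i : Fin n, D (W i ω)|}
      ≤ ENNReal.ofReal ((∫ w, D w ^ 2 ∂p) / ε ^ 2) := by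
  have h1 := pi_le_abs_inv_sqrt_mul_sum_le hD h0 hε n
  have hm : Measurable fun w : Fin n → 𝒲 => |(√(n : ℝ))⁻¹ * ∑ i, D (w i)| := by fun_prop
  have hWm : Measurable fun ω (i : Fin n) => W i ω := measurable_pi_lambda _ fun i => hW i
  rwa [← map_fin_eq_pi hW hlaw hI n,
    Measure.map_apply hWm (measurableSet_le measurable_const hm)] at h1

/-- Normalized sums of centred square integrable variables are bounded in probability. -/
theorem exists_measure_le_abs_inv_sqrt_mul_sum_le (hW : ∀ i, Measurable (W i))
    (hlaw : ∀ i, μ.map (W i) = p) (hI : iIndepFun W μ) {D : 𝒲 → ℝ} (hDm : Measurable D)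
    (hD : MemLp D 2 p) (h0 : ∫ w, D w ∂p = 0) {κ : ℝ} (hκ : 0 < κ) :
    ∃ K₀ : ℝ, ∀ K, K₀ ≤ K → ∀ n : ℕ,
      μ {ω | K ≤ |(√(n : ℝ))⁻¹ * ∑ i : Fin n, D (W i ω)|} ≤ ENNReal.ofReal κ := by
  set V := ∫ w, D w ^ 2 ∂p with hV
  have hV0 : 0 ≤ V := integral_nonneg fun _ => sq_nonneg _
  -- The `+ 1` ensures `K ≥ 1`, so that `V ≤ κ K ≤ κ K²`.
  refine ⟨V / κ + 1, fun K hK n => ?_⟩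
  have hq : 0 ≤ V / κ := by positivity
  have hK0 : 0 < K := by linarith
  refine (measure_le_abs_inv_sqrt_mul_sum_le hW hlaw hI hDm hD h0 hK0 n).trans
    (ENNReal.ofReal_le_ofReal ?_)
  rw [div_le_iff₀ (by positivity), ← hV]
  have h1 : V ≤ κ * K := by
    have : V / κ ≤ K := by linarith
    rwa [div_le_iff₀ hκ, mul_comm] at this
  nlinarith [mul_pos hκ hK0]

end NormalizedSums

/-! ### The contribution of the estimated imputation function -/

section Remainder

variable {d k l : ℕ} {π : (Fin k → ℝ) → ℝ} {γ : Fin d → ℝ} {η B : ℝ} {p : Measure (Obs d k l)}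
  [IsProbabilityMeasure p]

/-- The change of the denominator moment when the imputation function `h` is replaced by `f`. -/
def imputationShift (π : (Fin k → ℝ) → ℝ) (γ : Fin d → ℝ) (f h : Feat d k l → ℝ)
    (w : Obs d k l) : ℝ :=
  w.resid γ * pseudoTreat π f w - w.resid γ * pseudoTreat π h w

/-- The shift factors as `Z^⊥ (1 - A / π) (f - h)`. -/
theorem abs_imputationShift_le (hη : 0 < η) (hπη : ∀ x, π x ∈ Set.Icc η 1) {f h : Feat d k l → ℝ}
    {w : Obs d k l} (hB : |w.resid γ| ≤ B) :
    |imputationShift π γ f h w| ≤ B * (1 + 1 / η) * |f w.feat - h w.feat| := by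
  have hp : 0 < π w.annotCovs := hη.trans_le (hπη _).1
  have h1 : |ind w.annot / π w.annotCovs| ≤ 1 / η := by
    rw [abs_div, abs_of_pos hp]
    exact div_le_div₀ zero_le_one (abs_ind_le_one _) hη (hπη _).1
  have h2 : |1 - ind w.annot / π w.annotCovs| ≤ 1 + 1 / η := by
    refine (abs_sub _ _).trans ?_
    rw [abs_one]; linarith
  have h3 : imputationShift π γ f h w
      = w.resid γ * (1 - ind w.annot / π w.annotCovs) * (f w.feat - h w.feat) := by
    simp only [imputationShift, pseudoTreat]; ring
  rw [h3, abs_mul, abs_mul]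
  have hB0 : 0 ≤ B := (abs_nonneg _).trans hB
  gcongr

/-- Both imputation functions give the same denominator moment, so the shift is centred and
Chebyshev applies with second moment at most a constant times the squared error. The bound does not
depend on `n`, hence no rate is asked of the learner. -/
theorem pi_le_abs_sum_imputationShift_le (hp : HasScore π p) (hπ : Measurable π) (hη : 0 < η)
    (hπη : ∀ x, π x ∈ Set.Icc η 1) (hB0 : 0 < B) (hB : ∀ᵐ w : Obs d k l ∂p, |w.resid γ| ≤ B)
    {f h : Feat d k l → ℝ} (hf : Measurable f) (hh : Measurable h) (hh1 : ∀ x, |h x| ≤ 1) {ε : ℝ}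
    (hε : 0 < ε) (n : ℕ) :
    (Measure.pi fun _ : Fin n => p)
        {w | ε ≤ |(√(n : ℝ))⁻¹ * ∑ i, imputationShift π γ f h (w i)|}
      ≤ ENNReal.ofReal ((B * (1 + 1 / η)) ^ 2 / ε ^ 2)
        * ∫⁻ x, ENNReal.ofReal ((f x - h x) ^ 2) ∂(p.map Obs.feat) := by
  set c := B * (1 + 1 / η) with hc
  have hc0 : 0 < c := by positivity
  have hfm := hf.comp (Obs.measurable_feat (d := d) (k := k) (l := l))
  have hhm := hh.comp (Obs.measurable_feat (d := d) (k := k) (l := l))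
  have hΔm : Measurable fun w : Obs d k l => f w.feat - h w.feat := hfm.sub hhm
  have hsq : Measurable fun x : Feat d k l => ENNReal.ofReal ((f x - h x) ^ 2) := by fun_prop
  rw [lintegral_map hsq Obs.measurable_feat]
  set I := ∫⁻ w : Obs d k l, ENNReal.ofReal ((f w.feat - h w.feat) ^ 2) ∂p with hI
  -- An infinite squared error makes the bound trivial; a finite one makes `f` integrable enough for
  -- the moment identity.
  rcases eq_or_ne I ⊤ with htop | hfin
  · rw [htop, ENNReal.mul_top (ENNReal.ofReal_pos.2 (by positivity)).ne']
    exact le_top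
  have hΔ : MemLp (fun w : Obs d k l => f w.feat - h w.feat) 2 p := by
    refine (memLp_two_iff_integrable_sq hΔm.aestronglyMeasurable).2
      ⟨(hΔm.pow_const 2).aestronglyMeasurable, ?_⟩
    rw [hasFiniteIntegral_iff_ofReal (ae_of_all _ fun _ => sq_nonneg _)]
    exact lt_top_iff_ne_top.2 hfin
  have hr : Integrable (fun w : Obs d k l => w.resid γ) p :=
    (integrable_const B).mono (measurable_resid γ).aestronglyMeasurable
      (hB.mono fun w hw => hw.trans (le_abs_self B))
  have hrh := integrable_resid_mul (γ := γ) hh hh1 hr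
  have hrf : Integrable (fun w : Obs d k l => w.resid γ * f w.feat) p := by
    have h1 := ((hΔ.integrable (by norm_num)).bdd_mul
      (measurable_resid γ).aestronglyMeasurable hB).add hrh
    refine h1.congr (ae_of_all _ fun w => ?_)
    simp only [Pi.add_apply]; ring
  obtain ⟨i1, e1⟩ := hp.integral_resid_mul_pseudoTreat hπ hη hπη hr hf hrf
  obtain ⟨i2, e2⟩ := hp.integral_resid_mul_pseudoTreat hπ hη hπη hr hh hrh
  have hD0 : ∫ w, imputationShift π γ f h w ∂p = 0 := by
    simp only [imputationShift]
    rw [integral_sub i1 i2, e1, e2, sub_self]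
  have hDm : Measurable (imputationShift π γ f h : Obs d k l → ℝ) :=
    ((measurable_resid γ).mul (measurable_pseudoTreat hπ hf)).sub
      ((measurable_resid γ).mul (measurable_pseudoTreat hπ hh))
  have hbd : ∀ᵐ w ∂p, |imputationShift π γ f h w| ≤ c * |f w.feat - h w.feat| :=
    hB.mono fun w hw => abs_imputationShift_le hη hπη hw
  have hDL : MemLp (imputationShift π γ f h) 2 p := by
    refine (hΔ.const_mul c).mono hDm.aestronglyMeasurable (hbd.mono fun w hw => ?_)
    rwa [Real.norm_eq_abs, Real.norm_eq_abs, abs_mul, abs_of_pos hc0]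
  refine (pi_le_abs_inv_sqrt_mul_sum_le hDL hD0 hε n).trans ?_
  have hI' : I = ENNReal.ofReal (∫ w : Obs d k l, (f w.feat - h w.feat) ^ 2 ∂p) :=
    (ofReal_integral_eq_lintegral_ofReal hΔ.integrable_sq (ae_of_all _ fun _ => sq_nonneg _)).symm
  rw [hI', ← ENNReal.ofReal_mul (by positivity)]
  refine ENNReal.ofReal_le_ofReal ?_
  rw [div_mul_eq_mul_div]
  gcongr
  rw [← integral_const_mul]
  refine integral_mono_ae hDL.integrable_sq (hΔ.integrable_sq.const_mul _) (hbd.mono fun w hw => ?_)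
  simp only
  rw [← sq_abs (imputationShift π γ f h w), ← sq_abs (f w.feat - h w.feat), ← mul_pow]
  gcongr

variable {Ω : Type*} [MeasurableSpace Ω] {μ : Measure Ω} [IsProbabilityMeasure μ]
  {W W' : ℕ → Ω → Obs d k l}

theorem measurable_imputationShift {m : ℕ} {f : (Fin m → Obs d k l) → Feat d k l → ℝ}
    (hf : Measurable fun q : (Fin m → Obs d k l) × Feat d k l => f q.1 q.2)
    {h : Feat d k l → ℝ} (hh : Measurable h) (hπ : Measurable π) :
    Measurable fun q : (Fin m → Obs d k l) × Obs d k l => imputationShift π γ (f q.1) h q.2 := by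
  have h1 : Measurable fun q : (Fin m → Obs d k l) × Obs d k l => f q.1 q.2.feat :=
    hf.comp (measurable_fst.prodMk (Obs.measurable_feat.comp measurable_snd))
  have h2 : Measurable fun q : (Fin m → Obs d k l) × Obs d k l =>
      h q.2.feat := hh.comp (Obs.measurable_feat.comp measurable_snd)
  have h3 : Measurable fun q : (Fin m → Obs d k l) × Obs d k l =>
      q.2.resid γ := (measurable_resid γ).comp measurable_snd
  have h4 : Measurable fun q : (Fin m → Obs d k l) × Obs d k l =>
      ind q.2.annot / π q.2.annotCovs := (measurable_ind_annot.div
        (hπ.comp Obs.measurable_annotCovs)).comp measurable_snd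
  have h5 : Measurable fun q : (Fin m → Obs d k l) × Obs d k l => ind q.2.treat :=
    measurable_ind_treat.comp measurable_snd
  exact (h3.mul (h1.add (h4.mul (h5.sub h1)))).sub (h3.mul (h2.add (h4.mul (h5.sub h2))))

/-- Independence of the two samples makes the learned function deterministic after conditioning; the
fixed-function bound is integrated over the training sample. -/
theorem measure_le_abs_sum_imputationShift_le (hp : HasScore π p) (hπ : Measurable π) (hη : 0 < η)
    (hπη : ∀ x, π x ∈ Set.Icc η 1) (hB0 : 0 < B) (hB : ∀ᵐ w : Obs d k l ∂p, |w.resid γ| ≤ B)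
    {m : ℕ} {f : (Fin m → Obs d k l) → Feat d k l → ℝ}
    (hf : Measurable fun q : (Fin m → Obs d k l) × Feat d k l => f q.1 q.2)
    {h : Feat d k l → ℝ} (hh : Measurable h) (hh1 : ∀ x, |h x| ≤ 1)
    (hW : ∀ i, Measurable (W i)) (hW' : ∀ i, Measurable (W' i))
    (hlaw : ∀ i, μ.map (W i) = p) (hlaw' : ∀ i, μ.map (W' i) = p)
    (hI : iIndepFun (fun i : ℕ ⊕ ℕ => Sum.elim W W' i) μ) {ε : ℝ} (hε : 0 < ε) (n : ℕ) :
    μ {ω | ε ≤ |(√(n : ℝ))⁻¹ * ∑ i : Fin n,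
        imputationShift π γ (f fun j => W' j ω) h (W i ω)|}
      ≤ ENNReal.ofReal ((B * (1 + 1 / η)) ^ 2 / ε ^ 2)
        * ∫⁻ v, ∫⁻ x, ENNReal.ofReal ((f v x - h x) ^ 2) ∂(p.map Obs.feat)
          ∂(Measure.pi fun _ : Fin m => p) := by
  set s : Set ((Fin m → Obs d k l) × (Fin n → Obs d k l)) :=
    {q | ε ≤ |(√(n : ℝ))⁻¹ * ∑ i, imputationShift π γ (f q.1) h (q.2 i)|} with hs
  have ms : MeasurableSet s := by
    refine measurableSet_le measurable_const ?_
    refine ((Finset.measurable_sum _ fun i _ => ?_).const_mul _).abs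
    exact (measurable_imputationShift hf hh hπ).comp
      (measurable_fst.prodMk ((measurable_pi_apply i).comp measurable_snd))
  have hm : Measurable fun ω => ((fun j : Fin m => W' j ω), (fun i : Fin n => W i ω)) :=
    (measurable_pi_lambda (fun ω (j : Fin m) => W' j ω) fun j => hW' j).prodMk
      (measurable_pi_lambda _ fun i => hW i)
  have h1 := Measure.map_apply (μ := μ) hm ms
  rw [map_prodMk_eq_prod_pi hW hW' hlaw hlaw' hI, Measure.prod_apply ms] at h1
  refine h1.symm.le.trans ?_
  rw [← lintegral_const_mul' _ _ ENNReal.ofReal_ne_top]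
  exact lintegral_mono fun v => pi_le_abs_sum_imputationShift_le hp hπ hη hπη hB0 hB
    (hf.comp measurable_prodMk_left) hh hh1 hε n

end Remainder

/-! ### Asymptotic linearity and normality of the estimator -/

/-- Linearization of a ratio `a / b` with `b = s² D + s (E + R)`. -/
theorem abs_mul_ratio_sub_le {s D θ a b b₀ K δ : ℝ} (hs : 0 < s) (hD : D ≠ 0) (hK : 0 ≤ K)
    (hδ1 : δ ≤ 1) (hR : |s⁻¹ * (b - b₀)| ≤ δ) (hE : |s⁻¹ * (b₀ - s ^ 2 * D)| ≤ K)
    (hG : |s⁻¹ * (D⁻¹ * (a - θ * b₀))| ≤ K) (hsK : 2 * (K + 1) ≤ s * |D|) :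
    |s * (a / b - θ) - s⁻¹ * (D⁻¹ * (a - θ * b₀))|
      ≤ 2 * |θ| * δ / |D| + 2 * (K + 1) * K / (|D| * s) := by
  set R := s⁻¹ * (b - b₀) with hRd
  set E := s⁻¹ * (b₀ - s ^ 2 * D) with hEd
  set G := s⁻¹ * (D⁻¹ * (a - θ * b₀)) with hGd
  have hD' : 0 < |D| := abs_pos.2 hD
  have eb0 : b₀ = s * E + s ^ 2 * D := by rw [hEd]; field_simp; ring
  have eb : b = s * (s * D + E + R) := by
    have : b = b₀ + s * R := by rw [hRd]; field_simp; ring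
    rw [this, eb0]; ring
  have ea : a = s * D * G + θ * b₀ := by rw [hGd]; field_simp; ring
  have hER : |E + R| ≤ K + 1 := (abs_add_le _ _).trans (by linarith)
  have hden : s * |D| / 2 ≤ |s * D + E + R| := by
    have h1 : |s * D| ≤ |s * D + E + R| + |E + R| := by
      have := abs_sub (s * D + E + R) (E + R)
      rwa [show s * D + E + R - (E + R) = s * D by ring] at this
    rw [abs_mul, abs_of_pos hs] at h1
    linarith
  have hpos : 0 < |s * D + E + R| := lt_of_lt_of_le (by positivity) hden
  have hne : s * D + E + R ≠ 0 := abs_pos.1 hpos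
  have key : s * (a / b - θ) - G = -(s * θ * R + (E + R) * G) / (s * D + E + R) := by
    have h2 : a - θ * b = s * (D * G - θ * R) := by rw [ea, eb, eb0]; ring
    have h3 : a / b - θ = (a - θ * b) / b := by
      rw [eb]; field_simp
    rw [h3, h2, eb]
    field_simp
    ring
  rw [key, abs_div, abs_neg, div_le_iff₀ hpos]
  have hδ0 : 0 ≤ δ := (abs_nonneg _).trans hR
  have h4 : |s * θ * R + (E + R) * G| ≤ s * |θ| * δ + (K + 1) * K := by
    refine (abs_add_le _ _).trans (add_le_add ?_ ?_)
    · rw [abs_mul, abs_mul, abs_of_pos hs]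
      gcongr
    · rw [abs_mul]
      gcongr
  refine h4.trans ?_
  calc s * |θ| * δ + (K + 1) * K
      = (2 * |θ| * δ / |D| + 2 * (K + 1) * K / (|D| * s)) * (s * |D| / 2) := by field_simp
    _ ≤ _ := by gcongr

section Asymptotics

variable {d k l : ℕ} {π : (Fin k → ℝ) → ℝ} {γ : Fin d → ℝ} {η B : ℝ}
  {P : ProbabilityMeasure (Obs d k l)} {Ω : Type*} [MeasurableSpace Ω] {μ : Measure Ω}
  [IsProbabilityMeasure μ] {W W' : ℕ → Ω → Obs d k l}
  {muHat : ∀ m : ℕ, (Fin m → Obs d k l) → Feat d k l → ℝ}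

theorem measurable_phi (hπ : Measurable π) (p : Measure (Obs d k l)) (θ : ℝ) :
    Measurable (phi π γ p θ) := by
  have h1 : Measurable (phiNum γ p) :=
    ((measurable_resid γ).mul Obs.measurable_outcome).sub_const _
  have h2 : Measurable (phiDen π γ p) :=
    ((measurable_resid γ).mul (measurable_pseudoTreat hπ (measurable_imputationFun p))).sub_const _
  exact (h1.sub (h2.const_mul θ)).const_mul _

theorem measurable_phiDen (hπ : Measurable π) (p : Measure (Obs d k l)) :
    Measurable (phiDen π γ p) :=
  ((measurable_resid γ).mul (measurable_pseudoTreat hπ (measurable_imputationFun p))).sub_const _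

theorem memLp_phiDen (hπ : Measurable π) (hη : 0 < η) (hπη : ∀ x, π x ∈ Set.Icc η 1)
    (hP : P ∈ modelKnownScore π γ) :
    MemLp (phiDen π γ (P : Measure (Obs d k l))) 2 (P : Measure (Obs d k l)) :=
  (memLp_of_abs_le_momentFun ((measurable_resid γ).mul
    (measurable_pseudoTreat hπ (measurable_imputationFun _)))
    (abs_denMoment_le hη hπη (abs_imputationFun_le_one _) γ) hP.2.2.1).sub (memLp_const _)

theorem integral_phiDen (hπ : Measurable π) (hη : 0 < η) (hπη : ∀ x, π x ∈ Set.Icc η 1)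
    (hP : P ∈ modelKnownScore π γ) :
    ∫ w, phiDen π γ (P : Measure (Obs d k l)) w ∂(P : Measure (Obs d k l)) = 0 := by
  have hr := (memLp_resid_of_momentFun hP.2.2.1).integrable (by norm_num)
  have hm := measurable_imputationFun (P : Measure (Obs d k l))
  obtain ⟨i1, e1⟩ := HasScore.integral_resid_mul_pseudoTreat hP.2.1 hπ hη hπη hr hm
    (integrable_resid_mul hm (abs_imputationFun_le_one _) hr)
  simp only [phiDen]
  rw [integral_sub i1 (integrable_const _), e1]
  simp

theorem measurable_thetaHat (hπ : Measurable π)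
    (hmuHat : ∀ m, Measurable fun p : (Fin m → Obs d k l) × Feat d k l => muHat m p.1 p.2)
    (hW : ∀ i, Measurable (W i)) (hW' : ∀ i, Measurable (W' i)) (n m : ℕ) :
    Measurable fun ω => thetaHat π γ (muHat m fun j => W' j ω) (fun i : Fin n => W i ω) := by
  have hnum : Measurable fun w : Obs d k l => w.resid γ * w.outcome :=
    (measurable_resid γ).mul Obs.measurable_outcome
  have hW'm : Measurable fun ω (j : Fin m) => W' j ω := measurable_pi_lambda _ fun j => hW' j
  have hψ : Measurable (pseudoTreat π (fun _ => 0) : Obs d k l → ℝ) :=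
    measurable_pseudoTreat hπ measurable_const
  have hsum : Measurable fun ω => ∑ i : Fin n, (W i ω).resid γ * (W i ω).outcome :=
    Finset.measurable_sum _ fun i _ => hnum.comp (hW i)
  suffices hden : Measurable fun ω => ∑ i : Fin n,
      (W i ω).resid γ * pseudoTreat π (muHat m fun j => W' j ω) (W i ω) from hsum.div hden
  refine Finset.measurable_sum _ fun i _ => ?_
  -- Relative to the zero imputation function, the denominator summand is the shift plus a term free
  -- of the training sample.
  have h1 := (measurable_imputationShift (γ := γ) (hmuHat m) (h := fun _ => 0) measurable_const
    hπ).comp (hW'm.prodMk (hW i))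
  have h2 := (((measurable_resid γ).mul hψ).comp (hW i)).add h1
  convert! h2 using 1
  ext ω
  simp [imputationShift]

theorem sum_phi_eq (hP : P ∈ modelKnownScore π γ) {n : ℕ} (w : Fin n → Obs d k l) :
    ∑ i, phi π γ (P : Measure (Obs d k l)) (theta γ P) (w i)
      = (thetaDen γ (P : Measure (Obs d k l)))⁻¹ * (∑ i, (w i).resid γ * (w i).outcome - theta γ P *
        ∑ i, (w i).resid γ * pseudoTreat π (imputationFun (P : Measure (Obs d k l))) (w i)) := by
  simp only [phi_eq hP.2.2.2]
  rw [← Finset.mul_sum, Finset.sum_sub_distrib, ← Finset.mul_sum]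

/-- Off three events (a large shift, a large normalized sum of `φ`, a large one of `φ_den`) the
deterministic ratio bound `abs_mul_ratio_sub_le` applies. Chebyshev bounds the last two uniformly in
`n`, and the learner's consistency handles the first. -/
theorem tendstoInMeasure_thetaHat_sub (hπ : Measurable π) (hη : 0 < η)
    (hπη : ∀ x, π x ∈ Set.Icc η 1) (hP : P ∈ modelKnownScore π γ)
    (hB : ∀ᵐ w : Obs d k l ∂(P : Measure (Obs d k l)), |w.resid γ| ≤ B)
    (hmuHat : ∀ m, Measurable fun p : (Fin m → Obs d k l) × Feat d k l => muHat m p.1 p.2)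
    (hMSE : MSEConsistent P muHat) (hW : ∀ i, Measurable (W i)) (hW' : ∀ i, Measurable (W' i))
    (hlaw : ∀ i, μ.map (W i) = (P : Measure (Obs d k l)))
    (hlaw' : ∀ i, μ.map (W' i) = (P : Measure (Obs d k l)))
    (hI : iIndepFun (fun i : ℕ ⊕ ℕ => Sum.elim W W' i) μ) :
    TendstoInMeasure μ
      (fun (nm : ℕ × ℕ) ω => √(nm.1 : ℝ) *
          (thetaHat π γ (muHat nm.2 fun j => W' j ω) (fun i : Fin nm.1 => W i ω) - theta γ P)
        - (√(nm.1 : ℝ))⁻¹ * ∑ i : Fin nm.1,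
          phi π γ (P : Measure (Obs d k l)) (theta γ P) (W i ω))
      (atTop ×ˢ atTop) (fun _ => 0) := by
  set p : Measure (Obs d k l) := (P : Measure (Obs d k l)) with hp
  set D := thetaDen γ p with hD
  set θ := theta γ P with hθ
  have hD0 : D ≠ 0 := hP.2.2.2
  have hD' : 0 < |D| := abs_pos.2 hD0
  have hφ := isInfluenceFunction_phi hπ hη hπη hP
  set B' := max B 1 with hB'
  have hB'0 : 0 < B' := lt_of_lt_of_le one_pos (le_max_right _ _)
  have hBB' : ∀ᵐ w : Obs d k l ∂p, |w.resid γ| ≤ B' := hB.mono fun w h => h.trans (le_max_left _ _)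
  rw [tendstoInMeasure_iff_norm]
  intro ε hε
  -- Makes the first error term of the ratio bound at most `ε / 4`, while keeping `δ ≤ 1` as that
  -- bound requires.
  set δ : ℝ := min 1 (ε * |D| / (8 * (|θ| + 1))) with hδ
  have hδ0 : 0 < δ := lt_min one_pos (by positivity)
  have hδε : 2 * |θ| * δ / |D| ≤ ε / 4 := by
    have h1 : δ ≤ ε * |D| / (8 * (|θ| + 1)) := min_le_right _ _
    rw [le_div_iff₀ (by positivity)] at h1
    rw [div_le_iff₀ hD']
    nlinarith
  rw [ENNReal.tendsto_nhds_zero]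
  intro κ hκ
  obtain ⟨κ', hκ'0, hκ'⟩ : ∃ κ' : ℝ, 0 < κ' ∧ ENNReal.ofReal κ' ≤ κ / 3 := by
    obtain ⟨q, hq0, hq⟩ := ENNReal.lt_iff_exists_nnreal_btwn.1
      (ENNReal.div_pos hκ.ne' (by norm_num : (3 : ℝ≥0∞) ≠ ⊤))
    exact ⟨q, by exact_mod_cast hq0, by rw [ENNReal.ofReal_coe_nnreal]; exact hq.le⟩
  obtain ⟨K₁, hK₁⟩ := exists_measure_le_abs_inv_sqrt_mul_sum_le hW hlaw (iIndepFun_inl hI)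
    (measurable_phi hπ p θ) hφ.1 hφ.2.1 hκ'0
  obtain ⟨K₂, hK₂⟩ := exists_measure_le_abs_inv_sqrt_mul_sum_le hW hlaw (iIndepFun_inl hI)
    (measurable_phiDen hπ p) (memLp_phiDen hπ hη hπη hP) (integral_phiDen hπ hη hπη hP) hκ'0
  set K := max 0 (max K₁ K₂) with hK
  have hK0 : 0 ≤ K := le_max_left _ _
  have hKK₁ : K₁ ≤ K := (le_max_left _ _).trans (le_max_right _ _)
  have hKK₂ : K₂ ≤ K := (le_max_right _ _).trans (le_max_right _ _)
  have hsqrt : Tendsto (fun n : ℕ => √(n : ℝ)) atTop atTop :=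
    Real.tendsto_sqrt_atTop.comp tendsto_natCast_atTop_atTop
  have hn : ∀ᶠ n : ℕ in atTop, 0 < √(n : ℝ) ∧ 2 * (K + 1) ≤ √(n : ℝ) * |D| ∧
      2 * (K + 1) * K / (|D| * √(n : ℝ)) ≤ ε / 4 := by
    filter_upwards [hsqrt.eventually_gt_atTop 0, hsqrt.eventually_ge_atTop (2 * (K + 1) / |D|),
      hsqrt.eventually_ge_atTop (2 * (K + 1) * K / (|D| * (ε / 4)))] with n h1 h2 h3
    refine ⟨h1, (div_le_iff₀ hD').1 h2, ?_⟩
    rw [div_le_iff₀ (by positivity)] at h3 ⊢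
    linarith
  have hm : ∀ᶠ m : ℕ in atTop, ENNReal.ofReal ((B' * (1 + 1 / η)) ^ 2 / δ ^ 2) *
      ∫⁻ v, ∫⁻ x, ENNReal.ofReal ((muHat m v x - imputationFun p x) ^ 2) ∂(p.map Obs.feat)
        ∂(Measure.pi fun _ : Fin m => p) ≤ κ / 3 := by
    have h1 := ENNReal.Tendsto.const_mul (a := ENNReal.ofReal ((B' * (1 + 1 / η)) ^ 2 / δ ^ 2))
      hMSE (Or.inr ENNReal.ofReal_ne_top)
    rw [mul_zero] at h1
    exact (ENNReal.tendsto_nhds_zero.1 h1) _ (ENNReal.div_pos hκ.ne' (by norm_num))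
  -- The conditions on `n` and `m` are separate, so the two sample sizes may grow at unrelated
  -- speeds.
  filter_upwards [hn.prod_mk hm] with ⟨n, m⟩ ⟨⟨hs, hsK, hsε⟩, hmse⟩
  simp only at hs hsK hsε hmse ⊢
  have hR := measure_le_abs_sum_imputationShift_le (p := p) hP.2.1 hπ hη hπη hB'0 hBB' (hmuHat m)
    (measurable_imputationFun p) (abs_imputationFun_le_one p) hW hW' hlaw hlaw' hI hδ0 n
  have hsub : {ω | ε ≤ ‖√(n : ℝ) *
          (thetaHat π γ (muHat m fun j => W' j ω) (fun i : Fin n => W i ω) - θ)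
        - (√(n : ℝ))⁻¹ * ∑ i : Fin n, phi π γ p θ (W i ω) - 0‖} ⊆
      ({ω | δ ≤ |(√(n : ℝ))⁻¹ * ∑ i : Fin n,
        imputationShift π γ (muHat m fun j => W' j ω) (imputationFun p) (W i ω)|} ∪
      {ω | K ≤ |(√(n : ℝ))⁻¹ * ∑ i : Fin n, phi π γ p θ (W i ω)|}) ∪
      {ω | K ≤ |(√(n : ℝ))⁻¹ * ∑ i : Fin n, phiDen π γ p (W i ω)|} := by
    intro ω hω
    by_contra hnot
    simp only [Set.mem_union, Set.mem_ofPred_eq, not_or, not_le] at hnot hω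
    obtain ⟨⟨h1, h2⟩, h3⟩ := hnot
    rw [sub_zero, Real.norm_eq_abs, sum_phi_eq hP] at hω
    rw [sum_phi_eq hP] at h2
    have e1 : ∑ i : Fin n, imputationShift π γ (muHat m fun j => W' j ω) (imputationFun p) (W i ω)
        = ∑ i : Fin n, (W i ω).resid γ * pseudoTreat π (muHat m fun j => W' j ω) (W i ω)
          - ∑ i : Fin n, (W i ω).resid γ * pseudoTreat π (imputationFun p) (W i ω) := by
      simp only [imputationShift, Finset.sum_sub_distrib]
    have e2 : ∑ i : Fin n, phiDen π γ p (W i ω)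
        = ∑ i : Fin n, (W i ω).resid γ * pseudoTreat π (imputationFun p) (W i ω)
          - √(n : ℝ) ^ 2 * D := by
      simp only [phiDen, Finset.sum_sub_distrib, Real.sq_sqrt (Nat.cast_nonneg n)]
      simp [hD]
    rw [e1] at h1
    rw [e2] at h3
    have h4 := abs_mul_ratio_sub_le (θ := θ) (a := ∑ i : Fin n, (W i ω).resid γ * (W i ω).outcome)
      hs hD0 hK0 (min_le_left _ _) h1.le h3.le h2.le hsK
    have h5 : thetaHat π γ (muHat m fun j => W' j ω) (fun i : Fin n => W i ω)
        = (∑ i : Fin n, (W i ω).resid γ * (W i ω).outcome) / ∑ i : Fin n,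
          (W i ω).resid γ * pseudoTreat π (muHat m fun j => W' j ω) (W i ω) := rfl
    rw [h5] at hω
    linarith
  refine (measure_mono hsub).trans ((measure_union_le _ _).trans ?_)
  calc _ ≤ κ / 3 + κ / 3 + κ / 3 := by
        refine add_le_add ((measure_union_le _ _).trans (add_le_add (hR.trans hmse)
          ((hK₁ K hKK₁ n).trans hκ'))) ((hK₂ K hKK₂ n).trans hκ')
    _ = κ := ENNReal.add_thirds κ

theorem tendstoInDistribution_inv_sqrt_sum_phi (hπ : Measurable π) (hη : 0 < η)
    (hπη : ∀ x, π x ∈ Set.Icc η 1) (hP : P ∈ modelKnownScore π γ) (hW : ∀ i, Measurable (W i))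
    (hlaw : ∀ i, μ.map (W i) = (P : Measure (Obs d k l))) (hI : iIndepFun W μ) :
    TendstoInDistribution
      (fun (n : ℕ) ω => (√(n : ℝ))⁻¹ * ∑ i : Fin n,
        phi π γ (P : Measure (Obs d k l)) (theta γ P) (W i ω))
      atTop (id : ℝ → ℝ) (fun _ => μ)
      (gaussianReal 0 (variance (phi π γ (P : Measure (Obs d k l)) (theta γ P))
        (P : Measure (Obs d k l))).toNNReal) := by
  have hφ := isInfluenceFunction_phi hπ hη hπη hP
  set φ := phi π γ (P : Measure (Obs d k l)) (theta γ P) with hφd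
  have hφm : Measurable φ := measurable_phi hπ _ _
  have hmean : ∫ ω, φ (W 0 ω) ∂μ = 0 := by
    rw [← hφ.2.1, ← hlaw 0, integral_map (hW 0).aemeasurable hφm.aestronglyMeasurable]
  have hvar : variance φ (P : Measure (Obs d k l)) = variance (fun ω => φ (W 0 ω)) μ := by
    rw [← hlaw 0, variance_map hφm.aemeasurable (hW 0).aemeasurable]
    rfl
  have hY : HasLaw (id : ℝ → ℝ) (gaussianReal 0 (variance (fun ω => φ (W 0 ω)) μ).toNNReal)
      (gaussianReal 0 (variance (fun ω => φ (W 0 ω)) μ).toNNReal) := ⟨by fun_prop, Measure.map_id⟩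
  have hL : MemLp (fun ω => φ (W 0 ω)) 2 μ := by
    have h := hφ.1
    rw [← hlaw 0] at h
    exact h.comp_of_map (hW 0).aemeasurable
  have h := tendstoInDistribution_inv_sqrt_mul_sum_sub (X := fun i ω => φ (W i ω)) hY hL
    (hI.comp (fun _ => φ) fun _ => hφm) fun i =>
      (IdentDistrib.mk (hW i).aemeasurable (hW 0).aemeasurable ((hlaw i).trans (hlaw 0).symm)).comp
        hφm
  simp only [hmean, mul_zero, sub_zero, Finset.sum_range] at h
  rw [hvar]
  exact h

theorem tendstoInDistribution_thetaHat (hπ : Measurable π) (hη : 0 < η)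
    (hπη : ∀ x, π x ∈ Set.Icc η 1) (hP : P ∈ modelKnownScore π γ)
    (hB : ∀ᵐ w : Obs d k l ∂(P : Measure (Obs d k l)), |w.resid γ| ≤ B)
    (hmuHat : ∀ m, Measurable fun p : (Fin m → Obs d k l) × Feat d k l => muHat m p.1 p.2)
    (hMSE : MSEConsistent P muHat) (hW : ∀ i, Measurable (W i)) (hW' : ∀ i, Measurable (W' i))
    (hlaw : ∀ i, μ.map (W i) = (P : Measure (Obs d k l)))
    (hlaw' : ∀ i, μ.map (W' i) = (P : Measure (Obs d k l)))
    (hI : iIndepFun (fun i : ℕ ⊕ ℕ => Sum.elim W W' i) μ) :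
    TendstoInDistribution
      (fun (nm : ℕ × ℕ) ω => √(nm.1 : ℝ) *
        (thetaHat π γ (muHat nm.2 fun j => W' j ω) (fun i : Fin nm.1 => W i ω) - theta γ P))
      (atTop ×ˢ atTop) (id : ℝ → ℝ) (fun _ => μ)
      (gaussianReal 0 (variance (phi π γ (P : Measure (Obs d k l)) (theta γ P))
        (P : Measure (Obs d k l))).toNNReal) := by
  have h := tendstoInDistribution_inv_sqrt_sum_phi hπ hη hπη hP hW hlaw (iIndepFun_inl hI)
  -- Slutsky along the product filter; the linear term depends on the estimation sample size only,
  -- so its limit is pulled back along the first projection.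
  refine tendstoInDistribution_of_tendstoInMeasure_sub
    (X := fun (nm : ℕ × ℕ) ω => (√(nm.1 : ℝ))⁻¹ * ∑ i : Fin nm.1,
      phi π γ (P : Measure (Obs d k l)) (theta γ P) (W i ω)) _ _
    ⟨fun nm => h.forall_aemeasurable nm.1, h.aemeasurable_limit, h.tendsto.comp tendsto_fst⟩
    (tendstoInMeasure_thetaHat_sub hπ hη hπη hP hB hmuHat hMSE hW hW' hlaw hlaw' hI)
    fun nm => (((measurable_thetaHat hπ hmuHat hW hW' nm.1 nm.2).sub_const _).const_mul
      _).aemeasurable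

end Asymptotics

end MARS

end

theorem mainTheorem6
    {Ω : Type*} [MeasurableSpace Ω] [StandardBorelSpace Ω] (Pr : Measure Ω)
    [IsProbabilityMeasure Pr] {d k l : ℕ} (S : MARS.Population Ω d k l)
    -- linear instrumental variables setting
    (hOut : S.ConsistentOutcome Pr) (hExo : S.ExogenousInstrument Pr)
    (hHom : S.HomogeneousEffects Pr) (hLin : S.LinearOutcome Pr)
    (hY : MemLp S.Y 2 Pr) (hZ : MemLp S.Z 2 Pr) (hC : ∀ j, MemLp (fun ω => S.C ω j) 2 Pr)
    -- known residualized instrument, bounded almost surely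
    (γ : Fin d → ℝ) (hProj : S.IsProjectionCoef Pr γ) (hRel : S.RelevantInstrument Pr γ)
    (hBdd : ∃ B : ℝ, ∀ᵐ ω ∂Pr, |S.resid γ ω| ≤ B)
    -- missing structured data: consistency, missing at random, context independence
    (hCons : S.ConsistentAnnotation Pr) (hMAR : S.MissingAtRandom Pr)
    (hCtx : S.ContextIndependent Pr)
    -- known and bounded annotation score
    (π : (Fin k → ℝ) → ℝ) (hπ : Measurable π) (hScore : S.IsAnnotationScore Pr π)
    (η : ℝ) (hη0 : 0 < η) (hη1 : η < 1) (hπη : ∀ x, π x ∈ Set.Icc η 1)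
    -- the imputation function, learned on the training sample, is MSE consistent
    (muHat : ∀ m : ℕ, (Fin m → MARS.Obs d k l) → MARS.Feat d k l → ℝ)
    (hmuHat : ∀ m, Measurable fun p : (Fin m → MARS.Obs d k l) × MARS.Feat d k l =>
      muHat m p.1 p.2)
    (hMSE : MARS.MSEConsistent (S.law Pr) muHat)
    -- i.i.d. estimation sample `W` and training sample `W'`
    {Ω' : Type*} [MeasurableSpace Ω'] (Pr' : Measure Ω') [IsProbabilityMeasure Pr']
    (W W' : ℕ → Ω' → MARS.Obs d k l)
    (hW : ∀ i, Measurable (W i)) (hW' : ∀ i, Measurable (W' i))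
    (hWlaw : ∀ i, Pr'.map (W i) = (S.law Pr : Measure (MARS.Obs d k l)))
    (hW'law : ∀ i, Pr'.map (W' i) = (S.law Pr : Measure (MARS.Obs d k l)))
    (hIndep : iIndepFun (fun i : ℕ ⊕ ℕ => Sum.elim W W' i) Pr') :
    -- identification of the average treatment effect
    S.ate Pr = MARS.theta γ (S.law Pr) ∧
    -- asymptotic normality, as both sample sizes tend to infinity
    TendstoInDistribution
      (fun (nm : ℕ × ℕ) (ω : Ω') => √(nm.1 : ℝ) *
        (MARS.thetaHat π γ (muHat nm.2 fun j => W' j ω) (fun i : Fin nm.1 => W i ω) - S.ate Pr))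
      (atTop ×ˢ atTop) (id : ℝ → ℝ) (fun _ => Pr')
      (gaussianReal 0 (variance (MARS.phi π γ (S.law Pr) (S.ate Pr))
        (S.law Pr : Measure (MARS.Obs d k l))).toNNReal) ∧
    -- asymptotic linearity with influence function `φ`
    TendstoInMeasure Pr'
      (fun (nm : ℕ × ℕ) (ω : Ω') => √(nm.1 : ℝ) *
          (MARS.thetaHat π γ (muHat nm.2 fun j => W' j ω) (fun i : Fin nm.1 => W i ω) - S.ate Pr)
        - (√(nm.1 : ℝ))⁻¹ * ∑ i : Fin nm.1, MARS.phi π γ (S.law Pr) (S.ate Pr) (W i ω))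
      (atTop ×ˢ atTop) (fun _ => 0) ∧
    -- `φ` is an influence function of the functional in the model with known annotation score
    MARS.IsInfluenceFunction (MARS.modelKnownScore π γ) (MARS.momentFun γ) (MARS.theta γ)
      (S.law Pr) (MARS.phi π γ (S.law Pr) (S.ate Pr)) ∧
    -- `φ` is the efficient one, and no regular asymptotically linear estimator does better
    (S.OutcomeMeanIndependent Pr →
      MARS.IsEfficientInfluenceFunction (MARS.modelKnownScore π γ) (MARS.momentFun γ)
        (MARS.theta γ) (S.law Pr) (MARS.phi π γ (S.law Pr) (S.ate Pr)) ∧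
      ∀ (T : ∀ n : ℕ, (Fin n → MARS.Obs d k l) → ℝ) (ψ : MARS.Obs d k l → ℝ),
        MARS.IsRAL (MARS.modelKnownScore π γ) (MARS.momentFun γ) (MARS.theta γ) (S.law Pr) T ψ →
        variance (MARS.phi π γ (S.law Pr) (S.ate Pr)) (S.law Pr : Measure (MARS.Obs d k l)) ≤
          variance ψ (S.law Pr : Measure (MARS.Obs d k l))) := by
  have hP := MARS.Population.law_mem_modelKnownScore hMAR hCtx hCons hπ hη0 hπη hScore hY hBdd hRel
  have hate := MARS.Population.ate_eq_theta hMAR hCtx hCons hπ hη0 hπη hScore hY hC hBdd hRel hOut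
    hExo hHom hLin hProj
  obtain ⟨B, hB⟩ := hBdd
  have hBl : ∀ᵐ w : MARS.Obs d k l ∂(S.law Pr : Measure (MARS.Obs d k l)), |w.resid γ| ≤ B :=
    (ae_map_iff S.measurable_obs.aemeasurable
      (measurableSet_le (MARS.measurable_resid γ).abs measurable_const)).2 hB
  -- Once the treatment effect is written as a functional of the observed law, the other claims no
  -- longer involve the latent variables; outcome mean independence is transferred to that law
  -- separately.
  rw [hate]
  refine ⟨rfl, MARS.tendstoInDistribution_thetaHat hπ hη0 hπη hP hBl hmuHat hMSE hW hW' hWlaw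
    hW'law hIndep, MARS.tendstoInMeasure_thetaHat_sub hπ hη0 hπη hP hBl hmuHat hMSE hW hW' hWlaw
    hW'law hIndep, MARS.isInfluenceFunction_phi hπ hη0 hπη hP, fun hMI => ?_⟩
  have hYi := MARS.Population.integrable_outcome_law hY
  have hYl := MARS.Population.OutcomeMeanIndependent.law hY hMI
  exact ⟨MARS.isEfficientInfluenceFunction_phi hπ hη0 hπη hP hYi hYl, fun T ψ hT =>
    hT.variance_phi_le hπ hη0 hπη hP hYi hYl⟩
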